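/- **Notation.** Let $\mathcal D$ be the algebra of regular differential operators on the circle, spanned by $t^kf(D)$ ($k\in\mathbb Z$, $f\in\mathbb C[x]$, $D=t\,d/dt$), with $t^rf(D)\,t^sg(D)=t^{r+s}f(D+s)g(D)$. Let $\mathcal D_x^{\pm}$ be the Lie algebra of all $d\in\mathcal D D$ with $\sigma_\pm(d)=-d$, where $\sigma_\pm(t^kf(D)D)=-(\pm t)^kf(-D-k)D$. Let $\widehat{\mathcal D}_x^{\pm}=\mathcal D_x^\pm\oplus\mathbb C C$ be its central extension by the restriction of the skew-symmetric $2$-cocycle $\Psi$ given by $\Psi(t^rf(D),t^{-r}g(D))=\sum_{-r\le n\le -1}f(n)g(n+r)$ for $r>0$, and by $\Psi(t^rf(D),t^sg(D))=0$ if $r+s\neq0$ or $r=s=0$. It is $\mathbb Z$-graded by $\mathrm{wt}\,t^kf(D)=k$, $\mathrm{wt}\,C=0$. For an integer $m\ge0$ let $R_m=\mathbb C[u]/(u^{m+1})$, let $\mathfrak{gl}_\infty^{[m]}$ be the Lie algebra of matrices $(a_{ij})_{i,j\in\mathbb Z}$ over $R_m$ with finitely many nonzero diagonals, and let $\widehat{\mathfrak{gl}}_\infty^{[m]}=\mathfrak{gl}_\infty^{[m]}\oplus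 R_m$ be its central extension by the cocycle $\mathrm{tr}([J,A]B)$, $J=\sum_{j\le0}E_{jj}$, graded by $\mathrm{wt}\,E_{ij}=j-i$, $\mathrm{wt}\,R_m=0$. For a $\mathbb Z$-graded complex Lie algebra $\mathfrak g$ and $\lambda\in\mathfrak g_0^*$, let $L(\mathfrak g,\lambda)$ be the quotient of the Verma module with highest weight $\lambda$ (the highest weight vector, of degree $0$, is annihilated by $\mathfrak g_k$, $k>0$) by its maximal proper graded submodule. It is quasifinite if its homogeneous components are finite-dimensional. For $s\in\mathbb C$ let $\widehat\varphi_s^{[m]}:\widehat{\mathcal D}_x^\pm\to\widehat{\mathfrak{gl}}_\infty^{[m]}$ be the Lie algebra homomorphism with $\widehat\varphi_s^{[m]}(C)=1\in R_m$, with $$t^kf(D)\mapsto\sum_{j\in\mathbb Z}f(-j+s+u)\,E_{j-k,j}$$ on elements of degree $k\ne0$, and in degree $0$ given by the generating series $$\widehat\varphi_s^{[m]}(\sinh(xD))=\sum_{j\in\mathbb Z}\sinh\bigl(x(s-j+u)\bigr)E_{jj}+\frac{\cosh(x/2)}{2\sinh(x/2)}-\sum_{i=0}^m\frac{\eta_i(x,s)}{2\sinh(x/2)}u^i,$$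 where $\eta_i(x,s)=\frac{e^{(s-1/2)x}+(-1)^ie^{-(s-1/2)x}}2\,\frac{x^i}{i!}$ and the last two terms lie in the centre $R_m$. For $\lambda\in(\widehat{\mathfrak{gl}}_\infty^{[m]})_0^*$, $j\in\mathbb Z$, $0\le i\le m$, put ${}^ah_j^{(i)}=\lambda(u^iE_{jj})-\lambda(u^iE_{j+1,j+1})+\delta_{j,0}\,\lambda(u^i)$, where in the last term $u^i$ is an element of the centre $R_m$. For $\mu\in(\widehat{\mathcal D}_x^{\pm})_0^*$ let $\Delta_\mu(x)=-\sum_{l\ \mathrm{even}}\mu(D^lD)\,x^l/l!$. Let $e^+$ (resp. $e^-$) be a finite set of complex numbers, no two of which are equal or opposite, and with $0\notin e^-$, each with a multiplicity that is a nonzero even (resp. odd) polynomial: $q_e$ for $e\in e^+$, $r_e$ for $e\in e^-$. We say that $\mu$ has exponents $(e^+,e^-)$ if there is an even quasipolynomial $\phi$ (a linear combination of functions $q(x)e^{\alpha x}$, $q\in\mathbb C[x]$, $\alpha\in\mathbb C$) with $\phi(0)=0$ such that $$\Delta_\mu(x)=\frac{d}{dx}\left(\frac{\phi(x)}{2\sinh(x/2)}\right),\qquad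 \phi(x)+\mu(C)\cosh(x/2)=\sum_{e\in e^+}q_e(x)\cosh(ex)+\sum_{e\in e^-}r_e(x)\sinh(ex).$$ If exactly one $\mu$ has exponents $(e^+,e^-)$, write $L(\widehat{\mathcal D}_x^\pm;e^+,e^-)$ for $L(\widehat{\mathcal D}_x^\pm,\mu)$. **Proposition.** Let $s\in\mathbb C$ with $2s\notin\mathbb Z$, let $m\ge0$ be an integer, and let $\lambda\in(\widehat{\mathfrak{gl}}_\infty^{[m]})_0^*$ be such that $L(\widehat{\mathfrak{gl}}_\infty^{[m]},\lambda)$ is quasifinite. Then $\widehat\varphi_s^{[m]}$ is injective. Let $e^+$ (resp. $e^-$) consist of the exponents $s-j-\frac12$, $j\in\mathbb Z$, with multiplicities $$\sum_{\substack{0\le i\le m\\ i\ \mathrm{even}}}\frac{{}^ah_j^{(i)}x^i}{i!}\qquad\Bigl(\text{resp. }\sum_{\substack{0\le i\le m\\ i\ \mathrm{odd}}}\frac{{}^ah_j^{(i)}x^i}{i!}\Bigr),$$ where exponents with multiplicity zero are omitted. Then there is exactly one $\mu\in(\widehat{\mathcal D}_x^{\pm})_0^*$ with exponents $(e^+,e^-)$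 (in particular $e^+$ and $e^-$ are finite), $L(\widehat{\mathcal D}_x^{\pm};e^+,e^-)=L(\widehat{\mathcal D}_x^\pm,\mu)$ is quasifinite, and $L(\widehat{\mathfrak{gl}}_\infty^{[m]},\lambda)$, regarded as a $\widehat{\mathcal D}_x^{\pm}$-module via $\widehat\varphi_s^{[m]}$, is isomorphic to it. -/

import Mathlib

open Polynomial

noncomputable section

namespace DiffOpRep


/-! ### Two-cocycles with trivial coefficients and central extensions -/

section CentralExtension

variable {g h V : Type*} [LieRing g] [LieAlgebra ℂ g] [LieRing h] [LieAlgebra ℂ h]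
  [AddCommGroup V] [Module ℂ V]

/-- A two-cocycle on the Lie algebra `g` with values in the trivial module `V`. -/
structure LieTwoCocycle (g V : Type*) [LieRing g] [LieAlgebra ℂ g]
    [AddCommGroup V] [Module ℂ V] where
  toFun : g →ₗ[ℂ] g →ₗ[ℂ] V
  alt : ∀ x, toFun x x = 0
  jacobi : ∀ x y z, toFun ⁅x, y⁆ z + toFun ⁅y, z⁆ x + toFun ⁅z, x⁆ y = 0

/-- Restriction of a two-cocycle along a Lie algebra homomorphism. -/
def LieTwoCocycle.comap (ω : LieTwoCocycle g V) (f : h →ₗ⁅ℂ⁆ g) : LieTwoCocycle h V where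
  toFun := ω.toFun.compl₁₂ (f : h →ₗ[ℂ] g) (f : h →ₗ[ℂ] g)
  alt x := ω.alt (f x)
  jacobi x y z := by
    have := ω.jacobi (f x) (f y) (f z)
    simpa using this

theorem LieTwoCocycle.skew (ω : LieTwoCocycle g V) (x y : g) :
    ω.toFun x y = - ω.toFun y x := by
  have := ω.alt (x + y)
  simp only [map_add, LinearMap.add_apply, ω.alt] at this
  rw [eq_neg_iff_add_eq_zero]; simpa [add_comm] using this

/-- The central extension `g ⊕ V` of `g` by `V` given by the two-cocycle `ω`, with bracket
`[(x, a), (y, b)] = ([x, y], ω(x, y))`. -/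
@[ext]
structure CentralExt (ω : LieTwoCocycle g V) where
  base : g
  central : V

namespace CentralExt

variable (ω : LieTwoCocycle g V)

/-- The underlying vector space is `g × V`. -/
def equivProd : CentralExt ω ≃ g × V where
  toFun x := (x.base, x.central)
  invFun p := ⟨p.1, p.2⟩

instance : AddCommGroup (CentralExt ω) := (equivProd ω).addCommGroup
instance : Module ℂ (CentralExt ω) := (equivProd ω).module ℂ
instance : Bracket (CentralExt ω) (CentralExt ω) :=
  ⟨fun x y => ⟨⁅x.base, y.base⁆, ω.toFun x.base y.base⟩⟩

@[simp] theorem base_add (x y : CentralExt ω) : (x + y).base = x.base + y.base := rfl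
@[simp] theorem central_add (x y : CentralExt ω) : (x + y).central = x.central + y.central := rfl
@[simp] theorem base_zero : (0 : CentralExt ω).base = 0 := rfl
@[simp] theorem central_zero : (0 : CentralExt ω).central = 0 := rfl
@[simp] theorem base_smul (c : ℂ) (x : CentralExt ω) : (c • x).base = c • x.base := rfl
@[simp] theorem central_smul (c : ℂ) (x : CentralExt ω) : (c • x).central = c • x.central := rfl
@[simp] theorem base_lie (x y : CentralExt ω) : ⁅x, y⁆.base = ⁅x.base, y.base⁆ := rfl
@[simp] theorem central_lie (x y : CentralExt ω) :
    ⁅x, y⁆.central = ω.toFun x.base y.base := rfl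

instance : LieRing (CentralExt ω) where
  add_lie x y z := CentralExt.ext (by simp) (by simp)
  lie_add x y z := CentralExt.ext (by simp) (by simp)
  lie_self x := CentralExt.ext (by simp) (by simp [ω.alt])
  leibniz_lie x y z := CentralExt.ext (by simp) (by
    simp only [central_lie, base_lie, central_add]
    have h1 := ω.jacobi x.base y.base z.base
    rw [ω.skew x.base ⁅y.base, z.base⁆, ω.skew y.base ⁅x.base, z.base⁆,
      ← lie_skew x.base z.base]
    simp only [map_neg, LinearMap.neg_apply, neg_neg]
    rw [neg_eq_iff_add_eq_zero, ← h1]; abel)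

instance : LieAlgebra ℂ (CentralExt ω) where
  lie_smul c x y := CentralExt.ext (by simp) (by simp)

end CentralExt

end CentralExtension

/-! ### Infinite matrices with finitely many nonzero diagonals -/

section BandMatrix

variable (R : Type*) [CommRing R] [Algebra ℂ R]

/-- Matrices `(a i j)`, `i, j ∈ ℤ`, with finitely many nonzero diagonals. -/
def bandSubmodule : Submodule ℂ (Matrix ℤ ℤ R) where
  carrier := {A | ∃ N : ℤ, ∀ i j, N < |i - j| → A i j = 0}
  add_mem' := by
    rintro A B ⟨N, hN⟩ ⟨M, hM⟩
    refine ⟨max N M, fun i j h => ?_⟩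
    rw [Matrix.add_apply, hN i j (lt_of_le_of_lt (le_max_left _ _) h),
      hM i j (lt_of_le_of_lt (le_max_right _ _) h), add_zero]
  zero_mem' := ⟨0, fun _ _ _ => rfl⟩
  smul_mem' := by
    rintro c A ⟨N, hN⟩
    exact ⟨N, fun i j h => by rw [Matrix.smul_apply, hN i j h, smul_zero]⟩

/-- The algebra of matrices `(a i j)`, `i, j ∈ ℤ`, over `R` with finitely many nonzero diagonals. -/
def BandMatrix : Type _ := bandSubmodule R

namespace BandMatrix

variable {R}

instance : AddCommGroup (BandMatrix R) := inferInstanceAs (AddCommGroup (bandSubmodule R))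
instance : Module ℂ (BandMatrix R) := inferInstanceAs (Module ℂ (bandSubmodule R))

/-- The `(i, j)` entry. -/
def entry (A : BandMatrix R) (i j : ℤ) : R := A.1 i j

theorem exists_band (A : BandMatrix R) : ∃ N : ℤ, ∀ i j, N < |i - j| → A.entry i j = 0 := A.2

/-- Constructor of a matrix with finitely many nonzero diagonals from its entries. -/
def ofEntries (a : ℤ → ℤ → R) (h : ∃ N : ℤ, ∀ i j, N < |i - j| → a i j = 0) : BandMatrix R :=
  ⟨a, h⟩

@[simp] theorem entry_ofEntries (a : ℤ → ℤ → R) (h) (i j : ℤ) :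
    (ofEntries a h).entry i j = a i j := rfl
@[ext] theorem ext {A B : BandMatrix R} (h : ∀ i j, A.entry i j = B.entry i j) : A = B :=
  Subtype.ext (by funext i j; exact h i j)
@[simp] theorem entry_add (A B : BandMatrix R) (i j : ℤ) :
    (A + B).entry i j = A.entry i j + B.entry i j := rfl
@[simp] theorem entry_zero (i j : ℤ) : (0 : BandMatrix R).entry i j = 0 := rfl
@[simp] theorem entry_neg (A : BandMatrix R) (i j : ℤ) : (-A).entry i j = - A.entry i j := rfl
@[simp] theorem entry_sub (A B : BandMatrix R) (i j : ℤ) :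
    (A - B).entry i j = A.entry i j - B.entry i j := rfl
@[simp] theorem entry_smul (c : ℂ) (A : BandMatrix R) (i j : ℤ) :
    (c • A).entry i j = c • A.entry i j := rfl

theorem finsum_row {A : BandMatrix R} {N : ℤ} (hN : ∀ i j, N < |i - j| → A.entry i j = 0)
    (i : ℤ) (f : ℤ → R) (S : Finset ℤ) (hS : Finset.Icc (i - N) (i + N) ⊆ S) :
    ∑ᶠ k, A.entry i k * f k = ∑ k ∈ S, A.entry i k * f k := by
  apply finsum_eq_sum_of_support_subset
  intro k hk
  apply hS
  by_contra hc
  apply hk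
  have : N < |i - k| := by
    rw [lt_abs]; simp only [Finset.mem_Icc, not_and_or, not_le] at hc; omega
  simp [hN i k this]

theorem mul_band {A B : BandMatrix R} {N M : ℤ} (hN : ∀ i j, N < |i - j| → A.entry i j = 0)
    (hM : ∀ i j, M < |i - j| → B.entry i j = 0) (i j : ℤ) (h : N + M < |i - j|) (k : ℤ) :
    A.entry i k * B.entry k j = 0 := by
  by_cases h1 : N < |i - k|
  · rw [hN i k h1, zero_mul]
  · rw [hM k j, mul_zero]
    have := abs_sub_le i k j
    omega

/-- Matrix multiplication; each entry is a finite sum. -/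
instance : Mul (BandMatrix R) :=
  ⟨fun A B => ofEntries (fun i j => ∑ᶠ k, A.entry i k * B.entry k j) (by
    obtain ⟨N, hN⟩ := A.exists_band
    obtain ⟨M, hM⟩ := B.exists_band
    refine ⟨N + M, fun i j h => ?_⟩
    simp [mul_band hN hM i j h])⟩

theorem entry_mul (A B : BandMatrix R) (i j : ℤ) :
    (A * B).entry i j = ∑ᶠ k, A.entry i k * B.entry k j := rfl

/-- The matrix with prescribed entries on the `k`-th diagonal: `∑ⱼ a j • E_{j-k,j}`. -/
def diag (k : ℤ) (a : ℤ → R) : BandMatrix R :=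
  ofEntries (fun i j => if i = j - k then a j else 0)
    ⟨|k|, fun i j h => if_neg (by rintro rfl; simp at h)⟩

theorem entry_diag (k : ℤ) (a : ℤ → R) (i j : ℤ) :
    (diag k a).entry i j = if i = j - k then a j else 0 := rfl

instance : One (BandMatrix R) := ⟨diag 0 1⟩

theorem entry_one (i j : ℤ) : (1 : BandMatrix R).entry i j = if i = j then 1 else 0 := by
  change (diag 0 1).entry i j = _
  simp [entry_diag]

instance : Ring (BandMatrix R) where
  __ := (inferInstance : AddCommGroup (BandMatrix R))
  left_distrib A B C := by
    obtain ⟨N, hN⟩ := A.exists_band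
    ext i j
    simp only [entry_mul, entry_add]
    rw [finsum_row hN i _ _ subset_rfl, finsum_row hN i _ _ subset_rfl,
      finsum_row hN i _ _ subset_rfl, ← Finset.sum_add_distrib]
    simp only [mul_add]
  right_distrib A B C := by
    obtain ⟨N, hN⟩ := A.exists_band
    obtain ⟨M, hM⟩ := B.exists_band
    have hs : ∀ i j, max N M < |i - j| → (A + B).entry i j = 0 := fun i j h => by
      rw [entry_add, hN i j (lt_of_le_of_lt (le_max_left _ _) h),
        hM i j (lt_of_le_of_lt (le_max_right _ _) h), add_zero]
    ext i j
    have h1 := le_max_left N M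
    have h2 := le_max_right N M
    simp only [entry_mul, entry_add]
    rw [show (∑ᶠ k, (A.entry i k + B.entry i k) * C.entry k j) =
        ∑ᶠ k, (A + B).entry i k * C.entry k j from rfl,
      finsum_row hs i _ _ subset_rfl,
      finsum_row hN i _ _ (Finset.Icc_subset_Icc (by omega) (by omega) :
        _ ⊆ Finset.Icc (i - max N M) (i + max N M)),
      finsum_row hM i _ _ (Finset.Icc_subset_Icc (by omega) (by omega) :
        _ ⊆ Finset.Icc (i - max N M) (i + max N M)), ← Finset.sum_add_distrib]
    simp only [entry_add, add_mul]
  zero_mul A := by ext i j; simp [entry_mul]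
  mul_zero A := by ext i j; simp [entry_mul]
  one_mul A := by
    ext i j
    rw [entry_mul, finsum_eq_single _ i]
    · simp [entry_one]
    · intro k hk; simp [entry_one, hk.symm]
  mul_one A := by
    ext i j
    rw [entry_mul, finsum_eq_single _ j]
    · simp [entry_one]
    · intro k hk; simp [entry_one, hk]
  mul_assoc A B C := by
    obtain ⟨N, hN⟩ := A.exists_band
    obtain ⟨M, hM⟩ := B.exists_band
    have hs : ∀ i j, N + M < |i - j| → (A * B).entry i j = 0 := fun i j h => by
      rw [entry_mul]; simp [mul_band hN hM i j h]
    ext i j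
    rw [entry_mul, finsum_row hs i _ _ subset_rfl, entry_mul, finsum_row hN i _ _ subset_rfl]
    have e1 : ∀ l, (A * B).entry i l =
        ∑ k ∈ Finset.Icc (i - N) (i + N), A.entry i k * B.entry k l := fun l => by
      rw [entry_mul, finsum_row hN i _ _ subset_rfl]
    have e2 : ∀ k ∈ Finset.Icc (i - N) (i + N), (B * C).entry k j =
        ∑ l ∈ Finset.Icc (i - (N + M)) (i + (N + M)), B.entry k l * C.entry l j := by
      intro k hk
      rw [Finset.mem_Icc] at hk
      rw [entry_mul, finsum_row hM k _ (Finset.Icc (i - (N + M)) (i + (N + M)))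
        (Finset.Icc_subset_Icc (by omega) (by omega))]
    calc _ = ∑ l ∈ Finset.Icc (i - (N + M)) (i + (N + M)),
          ∑ k ∈ Finset.Icc (i - N) (i + N), A.entry i k * B.entry k l * C.entry l j :=
        Finset.sum_congr rfl (fun l _ => by rw [e1 l, Finset.sum_mul])
      _ = ∑ k ∈ Finset.Icc (i - N) (i + N), ∑ l ∈ Finset.Icc (i - (N + M)) (i + (N + M)),
          A.entry i k * B.entry k l * C.entry l j := Finset.sum_comm
      _ = _ := Finset.sum_congr rfl (fun k hk => by
        rw [e2 k hk, Finset.mul_sum]; simp only [mul_assoc])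

instance : Algebra ℂ (BandMatrix R) := Algebra.ofModule
  (fun c A B => by
    obtain ⟨N, hN⟩ := A.exists_band
    ext i j
    rw [entry_smul, entry_mul, entry_mul, smul_finsum' c]
    · simp
    · apply (Finset.Icc (i - N) (i + N)).finite_toSet.subset
      intro k hk
      by_contra hc
      apply hk
      have : N < |i - k| := by
        rw [lt_abs]
        simp only [Finset.coe_Icc, Set.mem_Icc, not_and_or, not_le] at hc; omega
      simp [hN i k this])
  (fun c A B => by
    obtain ⟨N, hN⟩ := A.exists_band
    ext i j
    rw [entry_smul, entry_mul, entry_mul, smul_finsum' c]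
    · simp
    · apply (Finset.Icc (i - N) (i + N)).finite_toSet.subset
      intro k hk
      by_contra hc
      apply hk
      have : N < |i - k| := by
        rw [lt_abs]
        simp only [Finset.coe_Icc, Set.mem_Icc, not_and_or, not_le] at hc; omega
      simp [hN i k this])

instance : LieRing (BandMatrix R) := LieRing.ofAssociativeRing
instance : LieAlgebra ℂ (BandMatrix R) := LieAlgebra.ofAssociativeAlgebra

theorem lie_eq (A B : BandMatrix R) : ⁅A, B⁆ = A * B - B * A := rfl

/-- The diagonal matrix `J = ∑_{j ≤ 0} E_{jj}`. -/
def J : BandMatrix R := diag 0 (fun j => if j ≤ 0 then 1 else 0)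

/-- The trace (a finite sum for every matrix to which it is applied below). -/
def trace (A : BandMatrix R) : R := ∑ᶠ i, A.entry i i

theorem entry_J_mul (A : BandMatrix R) (i j : ℤ) :
    (J * A).entry i j = (if i ≤ 0 then 1 else 0) * A.entry i j := by
  rw [entry_mul, finsum_eq_single _ i]
  · simp [J, entry_diag]
  · intro k hk; simp [J, entry_diag, hk.symm]

theorem entry_mul_J (A : BandMatrix R) (i j : ℤ) :
    (A * J).entry i j = (if j ≤ 0 then 1 else 0) * A.entry i j := by
  rw [entry_mul, finsum_eq_single _ j]
  · simp [J, entry_diag]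
  · intro k hk; simp [J, entry_diag, hk]

theorem entry_lie_J (A : BandMatrix R) (i j : ℤ) :
    ⁅(J : BandMatrix R), A⁆.entry i j = ((if i ≤ 0 then 1 else 0) - (if j ≤ 0 then 1 else 0)) * A.entry i j := by
  rw [lie_eq, entry_sub, entry_J_mul, entry_mul_J, sub_mul]

/-- All nonzero entries lie in the square `[-n, n] × [-n, n]`. -/
def InSquare (n : ℤ) (A : BandMatrix R) : Prop :=
  ∀ i j, A.entry i j ≠ 0 → |i| ≤ n ∧ |j| ≤ n

theorem InSquare.mono {n n' : ℤ} {A : BandMatrix R} (h : InSquare n A) (hn : n ≤ n') :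
    InSquare n' A := fun i j hij => ⟨(h i j hij).1.trans hn, (h i j hij).2.trans hn⟩

theorem inSquare_lie_J (A : BandMatrix R) : ∃ n, InSquare n ⁅(J : BandMatrix R), A⁆ := by
  obtain ⟨N, hN⟩ := A.exists_band
  refine ⟨N, fun i j h => ?_⟩
  rw [entry_lie_J] at h
  have h1 : ¬ N < |i - j| := fun hc => h (by rw [hN i j hc, mul_zero])
  have h2 : ¬ ((i ≤ 0) ↔ (j ≤ 0)) := fun hc => h (by simp [hc])
  rw [not_lt, abs_le] at h1
  rw [abs_le, abs_le]
  omega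

theorem trace_eq_sum {n : ℤ} {A : BandMatrix R} (h : InSquare n A) :
    trace A = ∑ i ∈ Finset.Icc (-n) n, A.entry i i := by
  apply finsum_eq_sum_of_support_subset
  intro i hi
  simpa [abs_le] using (h i i hi).1

theorem trace_add {n : ℤ} {A B : BandMatrix R} (hA : InSquare n A) (hB : InSquare n B) :
    trace (A + B) = trace A + trace B := by
  have hAB : InSquare n (A + B) := fun i j h => by
    by_cases h1 : A.entry i j = 0
    · by_cases h2 : B.entry i j = 0
      · simp [h1, h2] at h
      · exact hB i j h2
    · exact hA i j h1
  rw [trace_eq_sum hA, trace_eq_sum hB, trace_eq_sum hAB, ← Finset.sum_add_distrib]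
  rfl

theorem InSquare.neg {n : ℤ} {A : BandMatrix R} (hA : InSquare n A) : InSquare n (-A) :=
  fun i j h => hA i j (by simpa using h)

theorem trace_neg (A : BandMatrix R) : trace (-A) = - trace A := by
  simp [trace, finsum_neg_distrib]

theorem trace_sub {n : ℤ} {A B : BandMatrix R} (hA : InSquare n A) (hB : InSquare n B) :
    trace (A - B) = trace A - trace B := by
  rw [sub_eq_add_neg, trace_add hA hB.neg, trace_neg, sub_eq_add_neg]

theorem exists_mul_ne {A B : BandMatrix R} {i j : ℤ} (h : (A * B).entry i j ≠ 0) :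
    ∃ k, A.entry i k ≠ 0 ∧ B.entry k j ≠ 0 := by
  by_contra! hc
  apply h
  rw [entry_mul]
  apply finsum_eq_zero_of_forall_eq_zero
  intro k
  by_cases h1 : A.entry i k = 0
  · simp [h1]
  · simp [hc k h1]

theorem InSquare.mul_right {n : ℤ} {X : BandMatrix R} (hX : InSquare n X) (B : BandMatrix R) :
    ∃ n', InSquare n' (X * B) := by
  obtain ⟨M, hM⟩ := B.exists_band
  refine ⟨max n (n + M), fun i j h => ?_⟩
  obtain ⟨k, h1, h2⟩ := exists_mul_ne h
  have h3 := hX i k h1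
  have h4 : ¬ M < |k - j| := fun hc => h2 (hM k j hc)
  rw [not_lt] at h4
  simp only [abs_le] at *
  omega

theorem InSquare.mul_left {n : ℤ} {X : BandMatrix R} (hX : InSquare n X) (B : BandMatrix R) :
    ∃ n', InSquare n' (B * X) := by
  obtain ⟨M, hM⟩ := B.exists_band
  refine ⟨max n (n + M), fun i j h => ?_⟩
  obtain ⟨k, h1, h2⟩ := exists_mul_ne h
  have h3 := hX k j h2
  have h4 : ¬ M < |i - k| := fun hc => h1 (hM i k hc)
  rw [not_lt] at h4
  simp only [abs_le] at *
  omega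

theorem trace_mul {n : ℤ} {X : BandMatrix R} (hX : InSquare n X) (B : BandMatrix R) :
    trace (X * B) = ∑ i ∈ Finset.Icc (-n) n, ∑ k ∈ Finset.Icc (-n) n,
      X.entry i k * B.entry k i := by
  rw [trace, finsum_eq_sum_of_support_subset (s := Finset.Icc (-n) n)]
  · apply Finset.sum_congr rfl
    intro i _
    rw [entry_mul]
    apply finsum_eq_sum_of_support_subset
    intro k hk
    have := hX i k (fun h => hk (by simp [h]))
    simpa [abs_le] using this.2
  · intro i hi
    obtain ⟨k, h1, _⟩ := exists_mul_ne hi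
    simpa [abs_le] using (hX i k h1).1

theorem trace_mul_comm {n : ℤ} {X : BandMatrix R} (hX : InSquare n X) (B : BandMatrix R) :
    trace (B * X) = trace (X * B) := by
  rw [trace_mul hX, Finset.sum_comm,
    trace, finsum_eq_sum_of_support_subset (s := Finset.Icc (-n) n)]
  · apply Finset.sum_congr rfl
    intro i _
    rw [entry_mul]
    rw [finsum_eq_sum_of_support_subset (s := Finset.Icc (-n) n)]
    · simp only [mul_comm]
    intro k hk
    have := hX k i (fun h => hk (by simp [h]))
    simpa [abs_le] using this.1
  · intro i hi
    obtain ⟨k, _, h1⟩ := exists_mul_ne hi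
    simpa [abs_le] using (hX k i h1).2

theorem trace_lie_J (A : BandMatrix R) : trace ⁅(J : BandMatrix R), A⁆ = 0 := by
  apply finsum_eq_zero_of_forall_eq_zero
  intro i
  rw [entry_lie_J]; simp

/-- The bilinear form `C(A, B) = tr([J, A] B)`. -/
def cocycleForm : BandMatrix R →ₗ[ℂ] BandMatrix R →ₗ[ℂ] R :=
  LinearMap.mk₂ ℂ (fun A B => trace (⁅(J : BandMatrix R), A⁆ * B))
    (fun A A' B => by
      obtain ⟨n, hn⟩ := inSquare_lie_J A
      obtain ⟨n', hn'⟩ := inSquare_lie_J A'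
      obtain ⟨n'', hn''⟩ := inSquare_lie_J (A + A')
      have := hn.mono ((le_max_left n n').trans (le_max_left _ n''))
      have := hn'.mono ((le_max_right n n').trans (le_max_left _ n''))
      have := hn''.mono (le_max_right (max n n') n'')
      rw [trace_mul ‹InSquare _ ⁅J, A⁆›, trace_mul ‹InSquare _ ⁅J, A'⁆›,
        trace_mul ‹InSquare _ ⁅J, A + A'⁆›]
      simp only [lie_add, entry_add, add_mul, Finset.sum_add_distrib])
    (fun c A B => by
      obtain ⟨n, hn⟩ := inSquare_lie_J A
      obtain ⟨n', hn'⟩ := inSquare_lie_J (c • A)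
      have := hn.mono (le_max_left n n')
      have := hn'.mono (le_max_right n n')
      rw [trace_mul ‹InSquare _ ⁅J, A⁆›, trace_mul ‹InSquare _ ⁅J, c • A⁆›]
      simp only [lie_smul, entry_smul, smul_mul_assoc, Finset.smul_sum])
    (fun A B B' => by
      obtain ⟨n, hn⟩ := inSquare_lie_J A
      rw [trace_mul hn, trace_mul hn, trace_mul hn]
      simp only [entry_add, mul_add, Finset.sum_add_distrib])
    (fun c A B => by
      obtain ⟨n, hn⟩ := inSquare_lie_J A
      rw [trace_mul hn, trace_mul hn]
      simp only [entry_smul, mul_smul_comm, Finset.smul_sum])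

theorem cocycleForm_apply (A B : BandMatrix R) : cocycleForm A B = trace (⁅(J : BandMatrix R), A⁆ * B) := rfl

theorem inSquare_common {A B : BandMatrix R} (hA : ∃ n, InSquare n A) (hB : ∃ n, InSquare n B) :
    ∃ n, InSquare n A ∧ InSquare n B := by
  obtain ⟨n, hn⟩ := hA
  obtain ⟨n', hn'⟩ := hB
  exact ⟨max n n', hn.mono (le_max_left _ _), hn'.mono (le_max_right _ _)⟩

theorem cocycleForm_alt (A : BandMatrix R) : cocycleForm A A = 0 := by
  obtain ⟨n, hn⟩ := inSquare_lie_J A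
  have h1 : trace (⁅(J : BandMatrix R), A⁆ * A + A * ⁅(J : BandMatrix R), A⁆) = 0 := by
    rw [← trace_lie_J (A * A)]
    congr 1
    rw [lie_eq, lie_eq]; noncomm_ring
  obtain ⟨k, hk, hk'⟩ := inSquare_common (hn.mul_right A) (hn.mul_left A)
  rw [trace_add hk hk', trace_mul_comm hn, ← two_mul] at h1
  rw [cocycleForm_apply]
  have h2 : (2 : ℂ) • trace (⁅(J : BandMatrix R), A⁆ * A) = 0 := by
    rw [Algebra.smul_def, map_ofNat, h1]
  exact (smul_eq_zero.mp h2).resolve_left two_ne_zero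

theorem cocycleForm_skew (A B : BandMatrix R) : cocycleForm A B = - cocycleForm B A := by
  have := cocycleForm_alt (A + B)
  rw [map_add, LinearMap.map_add₂, LinearMap.map_add₂, cocycleForm_alt, cocycleForm_alt] at this
  rw [eq_neg_iff_add_eq_zero]; simpa [add_comm] using this

theorem cocycleForm_lie (A B C : BandMatrix R) :
    cocycleForm ⁅A, B⁆ C = cocycleForm A ⁅B, C⁆ + cocycleForm B ⁅C, A⁆ := by
  obtain ⟨n, hn⟩ := inSquare_lie_J A
  obtain ⟨n', hn'⟩ := inSquare_lie_J B
  have e : ⁅(J : BandMatrix R), ⁅A, B⁆⁆ * C = (⁅(J : BandMatrix R), A⁆ * (B * C) - B * (⁅(J : BandMatrix R), A⁆ * C))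
      + (A * (⁅(J : BandMatrix R), B⁆ * C) - ⁅(J : BandMatrix R), B⁆ * (A * C)) := by
    simp only [lie_eq]; noncomm_ring
  obtain ⟨a, ha⟩ := hn.mul_right C
  obtain ⟨b, hb⟩ := hn'.mul_right C
  obtain ⟨k1, h1⟩ := hn.mul_right (B * C)
  obtain ⟨k2, h2⟩ := ha.mul_left B
  obtain ⟨k3, h3⟩ := hb.mul_left A
  obtain ⟨k4, h4⟩ := hn'.mul_right (A * C)
  obtain ⟨k5, h5⟩ := hn.mul_right (C * B)
  obtain ⟨k6, h6⟩ := hn'.mul_right (C * A)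
  have sub_sq : ∀ {X Y : BandMatrix R}, (∃ n, InSquare n X) → (∃ n, InSquare n Y) →
      ∃ n, InSquare n (X - Y) := by
    intro X Y hX hY
    obtain ⟨n, h, h'⟩ := inSquare_common hX hY
    refine ⟨n, fun i j hij => ?_⟩
    by_cases hx : X.entry i j = 0
    · by_cases hy : Y.entry i j = 0
      · simp [hx, hy] at hij
      · exact h' i j hy
    · exact h i j hx
  have tsub : ∀ {X Y : BandMatrix R}, (∃ n, InSquare n X) → (∃ n, InSquare n Y) →
      trace (X - Y) = trace X - trace Y := by
    intro X Y hX hY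
    obtain ⟨n, h, h'⟩ := inSquare_common hX hY
    exact trace_sub h h'
  obtain ⟨k, hk, hk'⟩ := inSquare_common (sub_sq ⟨_, h1⟩ ⟨_, h2⟩) (sub_sq ⟨_, h3⟩ ⟨_, h4⟩)
  simp only [cocycleForm_apply]
  rw [e, trace_add hk hk', tsub ⟨_, h1⟩ ⟨_, h2⟩, tsub ⟨_, h3⟩ ⟨_, h4⟩,
    trace_mul_comm ha, trace_mul_comm hb, lie_eq B C, lie_eq C A, mul_sub, mul_sub,
    tsub ⟨_, h1⟩ ⟨_, h5⟩, tsub ⟨_, h6⟩ ⟨_, h4⟩, mul_assoc, mul_assoc]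

/-- The two-cocycle `C(A, B) = tr([J, A] B)` with values in `R`. -/
def cocycle : LieTwoCocycle (BandMatrix R) R where
  toFun := cocycleForm
  alt := cocycleForm_alt
  jacobi A B C := by
    set T := cocycleForm ⁅A, B⁆ C + cocycleForm ⁅B, C⁆ A + cocycleForm ⁅C, A⁆ B with hT
    have h1 : T = -T + -T := by
      conv_lhs => rw [hT]
      rw [cocycleForm_lie A B C, cocycleForm_lie B C A, cocycleForm_lie C A B,
        cocycleForm_skew A ⁅B, C⁆, cocycleForm_skew B ⁅C, A⁆, cocycleForm_skew C ⁅A, B⁆, hT]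
      abel
    have h2 : (3 : ℂ) • T = 0 := by
      rw [Algebra.smul_def]
      simp only [map_ofNat]
      linear_combination h1
    exact (smul_eq_zero.mp h2).resolve_left three_ne_zero

end BandMatrix

end BandMatrix
/-! ### Differential operators on the circle -/

/-- The algebra of regular differential operators on the circle. A finitely supported family
`(f_k)` of polynomials stands for the operator `∑ₖ t^k f_k(D)`, where `D = t d/dt`. -/
def DiffOp : Type := ℤ →₀ ℂ[X]

namespace DiffOp

instance : AddCommGroup DiffOp := inferInstanceAs (AddCommGroup (ℤ →₀ ℂ[X]))
instance : Module ℂ DiffOp := inferInstanceAs (Module ℂ (ℤ →₀ ℂ[X]))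

/-- The coefficient `f` of `t^k f(D)` in a differential operator. -/
def coeff (k : ℤ) : DiffOp →ₗ[ℂ] ℂ[X] := Finsupp.lapply k

/-- The operator `t^k f(D)`. -/
def term (k : ℤ) : ℂ[X] →ₗ[ℂ] DiffOp := Finsupp.lsingle k

theorem coeff_term (k l : ℤ) (f : ℂ[X]) : (term k f).coeff l = if k = l then f else 0 := by
  classical
  exact Finsupp.single_apply

@[simp] theorem coeff_term_same (k : ℤ) (f : ℂ[X]) : (term k f).coeff k = f := by
  simp [coeff_term]

@[ext] theorem ext {x y : DiffOp} (h : ∀ k, x.coeff k = y.coeff k) : x = y := Finsupp.ext h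

@[elab_as_elim]
theorem induction_on {P : DiffOp → Prop} (x : DiffOp) (h0 : P 0)
    (hadd : ∀ x y, P x → P y → P (x + y)) (hterm : ∀ k f, P (term k f)) : P x :=
  Finsupp.induction_linear x h0 hadd hterm

theorem hom_ext {V : Type*} [AddCommGroup V] [Module ℂ V] {F G : DiffOp →ₗ[ℂ] V}
    (h : ∀ k f, F (term k f) = G (term k f)) : F = G :=
  Finsupp.lhom_ext h

/-- The linear map on `DiffOp` with prescribed values on the operators `t^k f(D)`. -/
def lift {V : Type*} [AddCommGroup V] [Module ℂ V] (F : ℤ → ℂ[X] →ₗ[ℂ] V) : DiffOp →ₗ[ℂ] V :=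
  Finsupp.lsum ℂ F

@[simp] theorem lift_term {V : Type*} [AddCommGroup V] [Module ℂ V] (F : ℤ → ℂ[X] →ₗ[ℂ] V)
    (k : ℤ) (f : ℂ[X]) : lift F (term k f) = F k f :=
  Finsupp.lsum_single ℂ F k f

/-- The product, determined by `t^r f(D) · t^s g(D) = t^(r+s) f(D+s) g(D)`. -/
def mulHom : DiffOp →ₗ[ℂ] DiffOp →ₗ[ℂ] DiffOp :=
  lift fun r => LinearMap.flip <| lift fun s => LinearMap.flip <|
    ((LinearMap.mul ℂ ℂ[X]).compl₁₂ (taylor (s : ℂ)) LinearMap.id).compr₂ (term (r + s))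

instance : Mul DiffOp := ⟨fun x y => mulHom x y⟩

theorem mul_def (x y : DiffOp) : x * y = mulHom x y := rfl

theorem term_mul_term (r s : ℤ) (f g : ℂ[X]) :
    term r f * term s g = term (r + s) (taylor (s : ℂ) f * g) := by
  rw [mul_def, mulHom, lift_term, LinearMap.flip_apply, lift_term]
  rfl

instance : One DiffOp := ⟨term 0 1⟩

theorem one_def : (1 : DiffOp) = term 0 1 := rfl

instance : Ring DiffOp where
  __ := (inferInstance : AddCommGroup DiffOp)
  left_distrib x y z := map_add (mulHom x) y z
  right_distrib x y z := LinearMap.map_add₂ mulHom x y z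
  zero_mul x := LinearMap.map_zero₂ mulHom x
  mul_zero x := map_zero (mulHom x)
  one_mul x := by
    rw [mul_def]
    refine LinearMap.congr_fun (f := mulHom 1) (g := LinearMap.id) (hom_ext fun k f => ?_) x
    rw [← mul_def, one_def, term_mul_term]; simp
  mul_one x := by
    rw [mul_def]
    refine LinearMap.congr_fun (f := mulHom.flip 1) (g := LinearMap.id)
      (hom_ext fun k f => ?_) x
    rw [LinearMap.flip_apply, ← mul_def, one_def, term_mul_term]; simp
  mul_assoc x y z := by
    simp only [mul_def]
    induction x using induction_on with
    | h0 => simp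
    | hadd x x' h h' => simp only [map_add, LinearMap.add_apply, h, h']
    | hterm r f =>
      induction y using induction_on with
      | h0 => simp
      | hadd x x' h h' => simp only [map_add, LinearMap.add_apply, h, h']
      | hterm s g =>
        induction z using induction_on with
        | h0 => simp
        | hadd x x' h h' => simp only [map_add, h, h']
        | hterm q k =>
          simp only [← mul_def, term_mul_term, taylor_mul, taylor_taylor]
          push_cast
          rw [add_assoc, mul_assoc, add_comm (q : ℂ)]

instance : Algebra ℂ DiffOp := Algebra.ofModule
  (fun c x y => LinearMap.map_smul₂ mulHom c x y) (fun c x y => map_smul (mulHom x) c y)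

/-- `[t^r f(D), t^s g(D)] = t^(r+s) (f(D+s) g(D) - f(D) g(D+r))`. -/
instance : LieRing DiffOp := LieRing.ofAssociativeRing
instance : LieAlgebra ℂ DiffOp := LieAlgebra.ofAssociativeAlgebra

theorem lie_eq (x y : DiffOp) : ⁅x, y⁆ = x * y - y * x := rfl

/-- The action of differential operators on `⊕ⱼ R t^(-j+y)`, as matrices over `R`:
`t^k f(D) ↦ ∑ⱼ f(-j+y) E_{j-k,j}`. -/
def toMatrix {R : Type*} [CommRing R] [Algebra ℂ R] (y : R) : DiffOp →ₗ[ℂ] BandMatrix R where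
  toFun x := BandMatrix.ofEntries (fun i j => aeval (-(j : R) + y) (x.coeff (j - i))) (by
    induction x using induction_on with
    | h0 => exact ⟨0, by simp⟩
    | hadd x x' h h' =>
      obtain ⟨N, hN⟩ := h
      obtain ⟨M, hM⟩ := h'
      refine ⟨max N M, fun i j h => ?_⟩
      rw [map_add, map_add, hN i j (lt_of_le_of_lt (le_max_left _ _) h),
        hM i j (lt_of_le_of_lt (le_max_right _ _) h), add_zero]
    | hterm k f =>
      refine ⟨|k|, fun i j h => ?_⟩
      rw [coeff_term, if_neg, map_zero]
      rintro rfl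
      rw [abs_sub_comm] at h
      exact lt_irrefl _ h)
  map_add' x y := by ext i j; simp
  map_smul' c x := by ext i j; simp

section toMatrix

variable {R : Type*} [CommRing R] [Algebra ℂ R] (y : R)

theorem entry_toMatrix (x : DiffOp) (i j : ℤ) :
    (toMatrix y x).entry i j = aeval (-(j : R) + y) (x.coeff (j - i)) := rfl

theorem toMatrix_term (k : ℤ) (f : ℂ[X]) :
    toMatrix y (term k f) = BandMatrix.diag k fun j => aeval (-(j : R) + y) f := by
  ext i j
  rw [entry_toMatrix, coeff_term, BandMatrix.entry_diag]
  by_cases h : k = j - i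
  · rw [if_pos h, if_pos (by omega)]
  · rw [if_neg h, if_neg (by omega), map_zero]

theorem toMatrix_mul (a b : DiffOp) : toMatrix y (a * b) = toMatrix y a * toMatrix y b := by
  induction a using induction_on with
  | h0 => simp
  | hadd x x' h h' => simp only [add_mul, map_add, h, h']
  | hterm r f =>
    induction b using induction_on with
    | h0 => simp
    | hadd x x' h h' => simp only [mul_add, map_add, h, h']
    | hterm s g =>
      rw [term_mul_term, toMatrix_term, toMatrix_term, toMatrix_term]
      ext i j
      rw [BandMatrix.entry_mul, finsum_eq_single _ (j - s)]
      · simp only [BandMatrix.entry_diag, if_true]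
        by_cases h : i = j - (r + s)
        · rw [if_pos h, if_pos (by omega), map_mul, taylor_apply, aeval_comp]
          congr 2
          simp only [map_add, aeval_X, map_intCast]
          push_cast; ring_nf
        · rw [if_neg h, if_neg (by omega), zero_mul]
      · intro k hk
        simp [BandMatrix.entry_diag, hk]

theorem toMatrix_lie (a b : DiffOp) : toMatrix y ⁅a, b⁆ = ⁅toMatrix y a, toMatrix y b⁆ := by
  rw [lie_eq, BandMatrix.lie_eq, map_sub, toMatrix_mul, toMatrix_mul]

/-- `∑_{-r ≤ m ≤ -1} h(m)` for `r ≥ 0`, and `-∑_{0 ≤ m ≤ -r-1} h(m)` for `r ≤ 0`. -/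
def signedSum {V : Type*} [AddCommGroup V] (r : ℤ) (h : ℤ → V) : V :=
  ∑ m ∈ Finset.Ico (-r) 0, h m - ∑ m ∈ Finset.Ico 0 (-r), h m

theorem finsum_signed {R : Type*} [CommRing R] (r : ℤ) (h : ℤ → R) :
    ∑ᶠ i : ℤ, ((if i ≤ 0 then 1 else 0) - (if i + r ≤ 0 then 1 else 0)) * h (-i - r) =
      signedSum r h := by
  have e : ∀ m : ℤ, ((if -r ≤ m then 1 else 0) - (if 0 ≤ m then 1 else 0)) * h m =
      (if m ∈ Finset.Ico (-r) 0 then h m else 0) - (if m ∈ Finset.Ico 0 (-r) then h m else 0) := by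
    intro m
    simp only [Finset.mem_Ico]
    split_ifs <;> first | omega | simp
  have h1 : ∑ᶠ i : ℤ, ((if i ≤ 0 then 1 else 0) - (if i + r ≤ 0 then 1 else 0)) * h (-i - r) =
      ∑ᶠ m : ℤ, ((if -r ≤ m then 1 else 0) - (if 0 ≤ m then 1 else 0)) * h m := by
    refine finsum_eq_of_bijective (fun i : ℤ => -i - r) ⟨fun a b h => ?_, fun b => ?_⟩ ?_
    · simpa using h
    · exact ⟨-b - r, by ring⟩
    · intro i
      have a1 : (-r ≤ -i - r) = (i ≤ 0) := by rw [eq_iff_iff]; omega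
      have a2 : (0 ≤ -i - r) = (i + r ≤ 0) := by rw [eq_iff_iff]; omega
      simp only [a1, a2]
  rw [h1]
  simp only [e]
  rw [finsum_sub_distrib]
  · rw [signedSum]
    congr 1
    · rw [finsum_eq_sum_of_support_subset (s := Finset.Ico (-r) 0)]
      · exact Finset.sum_congr rfl fun m hm => if_pos hm
      · intro m hm
        by_contra hc
        exact hm (if_neg hc)
    · rw [finsum_eq_sum_of_support_subset (s := Finset.Ico 0 (-r))]
      · exact Finset.sum_congr rfl fun m hm => if_pos hm
      · intro m hm
        by_contra hc
        exact hm (if_neg hc)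
  · refine (Finset.Ico (-r) 0).finite_toSet.subset fun m hm => ?_
    by_contra hc
    exact hm (if_neg hc)
  · refine (Finset.Ico 0 (-r)).finite_toSet.subset fun m hm => ?_
    by_contra hc
    exact hm (if_neg hc)

theorem cocycle_toMatrix (r s : ℤ) (f g : ℂ[X]) :
    BandMatrix.cocycle.toFun (toMatrix y (term r f)) (toMatrix y (term s g)) =
      if r + s = 0 then
        signedSum r fun m => aeval ((m : R) + y) (f * taylor (r : ℂ) g)
      else 0 := by
  change BandMatrix.trace _ = _
  rw [BandMatrix.trace, toMatrix_term, toMatrix_term]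
  have e : ∀ i, (⁅(BandMatrix.J : BandMatrix R), BandMatrix.diag r fun j => aeval (-(j : R) + y) f⁆ *
      BandMatrix.diag s fun j => aeval (-(j : R) + y) g).entry i i =
      if r + s = 0 then ((if i ≤ 0 then 1 else 0) - (if i + r ≤ 0 then 1 else 0)) *
        aeval (((-i - r : ℤ) : R) + y) (f * taylor (r : ℂ) g) else 0 := by
    intro i
    rw [BandMatrix.entry_mul, finsum_eq_single _ (i + r)]
    · rw [BandMatrix.entry_lie_J, BandMatrix.entry_diag, BandMatrix.entry_diag,
        if_pos (by omega : i = i + r - r)]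
      by_cases h : r + s = 0
      · rw [if_pos h, if_pos (by omega : i + r = i - s), map_mul, taylor_apply, aeval_comp,
          mul_assoc]
        congr 3
        · push_cast; ring_nf
        · simp only [map_add, aeval_X, map_intCast]
          push_cast; ring_nf
      · rw [if_neg h, if_neg (by omega : ¬ i + r = i - s), mul_zero]
    · intro k hk
      rw [BandMatrix.entry_lie_J, BandMatrix.entry_diag, if_neg (by omega : ¬ i = k - r),
        mul_zero, zero_mul]
  simp only [e]
  by_cases h : r + s = 0
  · simp only [if_pos h]
    exact finsum_signed r fun m => aeval ((m : R) + y) (f * taylor (r : ℂ) g)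
  · simp [if_neg h]

end toMatrix

/-- The form `Ψ(t^r f(D), t^s g(D))`; it is zero for `r + s ≠ 0` and for `r = s = 0`, it is
`∑_{-r ≤ m ≤ -1} f(m) g(m+r)` for `r = -s > 0`, and it is skew-symmetric, that is, equal to
`-∑_{0 ≤ m ≤ -r-1} f(m) g(m+r)` for `r = -s < 0`. -/
def psiForm : DiffOp →ₗ[ℂ] DiffOp →ₗ[ℂ] ℂ :=
  lift fun r => LinearMap.mk₂ ℂ
    (fun (f : ℂ[X]) (y : DiffOp) =>
      ∑ m ∈ Finset.Ico (-r) 0, f.eval (m : ℂ) * (y.coeff (-r)).eval ((m : ℂ) + r) -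
        ∑ m ∈ Finset.Ico 0 (-r), f.eval (m : ℂ) * (y.coeff (-r)).eval ((m : ℂ) + r))
    (fun f f' y => by simp only [eval_add, add_mul, Finset.sum_add_distrib]; ring)
    (fun c f y => by
      simp only [eval_smul, smul_mul_assoc, ← Finset.smul_sum, ← smul_sub])
    (fun f y y' => by simp only [map_add, eval_add, mul_add, Finset.sum_add_distrib]; ring)
    (fun c f y => by
      simp only [map_smul, eval_smul, mul_smul_comm, ← Finset.smul_sum, ← smul_sub])

theorem psiForm_term (r s : ℤ) (f g : ℂ[X]) :
    psiForm (term r f) (term s g) = if r + s = 0 then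
      signedSum r fun m => (f * taylor (r : ℂ) g).eval (m : ℂ) else 0 := by
  rw [psiForm, lift_term, LinearMap.mk₂_apply, coeff_term]
  by_cases h : r + s = 0
  · rw [if_pos h, if_pos (by omega)]
    simp only [signedSum, eval_mul, taylor_eval]
  · rw [if_neg h, if_neg (by omega)]
    simp

theorem psiForm_eq (x y : DiffOp) :
    psiForm x y = BandMatrix.cocycle.toFun (toMatrix (0 : ℂ) x) (toMatrix (0 : ℂ) y) := by
  induction x using induction_on with
  | h0 => simp
  | hadd x x' h h' => simp only [map_add, LinearMap.add_apply, h, h']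
  | hterm r f =>
    induction y using induction_on with
    | h0 => simp
    | hadd x x' h h' => simp only [map_add, h, h']
    | hterm s g =>
      rw [psiForm_term, cocycle_toMatrix]
      simp [coe_aeval_eq_eval]

/-- The two-cocycle `Ψ`. -/
def psi : LieTwoCocycle DiffOp ℂ where
  toFun := psiForm
  alt x := by rw [psiForm_eq, LieTwoCocycle.alt]
  jacobi x y z := by
    simp only [psiForm_eq, toMatrix_lie]
    exact LieTwoCocycle.jacobi _ _ _ _

/-! ### The anti-involutions and the Lie algebras of their minus fixed points -/

/-- Division by `X` (exact on the multiples of `X`), as a linear map. -/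
def divXHom : ℂ[X] →ₗ[ℂ] ℂ[X] where
  toFun := divX
  map_add' _ _ := divX_add
  map_smul' c p := by simp only [smul_eq_C_mul, divX_C_mul, RingHom.id_apply]

/-- The operators which are multiples `x · D` of `D`, that is, sums of operators `t^k f(D) D`. -/
def IsMulD (x : DiffOp) : Prop := ∀ k, X ∣ x.coeff k

/-- The anti-involutions `σ_ε`, `ε = ±1`, given by `σ_ε(t^k f(D) D) = -(ε t)^k f(-D-k) D`;
only their values on the multiples of `D` are meaningful. -/
def sigma (ε : ℤˣ) : DiffOp →ₗ[ℂ] DiffOp :=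
  lift fun k => term k ∘ₗ ((-(((ε ^ k : ℤˣ) : ℤ) : ℂ)) • (LinearMap.mulRight ℂ X ∘ₗ
    (aeval (-X - C (k : ℂ)) : ℂ[X] →ₐ[ℂ] ℂ[X]).toLinearMap ∘ₗ divXHom))

theorem divX_mul_X' (f : ℂ[X]) : divX (f * X) = f := by
  ext n; rw [coeff_divX, coeff_mul_X]

theorem sigma_term (ε : ℤˣ) (k : ℤ) (f : ℂ[X]) :
    sigma ε (term k (f * X)) =
      (-(((ε ^ k : ℤˣ) : ℤ) : ℂ)) • term k (f.comp (-X - C (k : ℂ)) * X) := by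
  rw [sigma, lift_term, ← map_smul]
  simp [divXHom, divX_mul_X', comp_eq_aeval]

theorem coeff_sigma (ε : ℤˣ) (k : ℤ) (x : DiffOp) : (sigma ε x).coeff k =
    (-(((ε ^ k : ℤˣ) : ℤ) : ℂ)) • ((divX (x.coeff k)).comp (-X - C (k : ℂ)) * X) := by
  induction x using induction_on with
  | h0 => simp
  | hadd x y h h' => simp only [map_add, h, h', divX_add, add_comp, add_mul, smul_add]
  | hterm l f =>
    rw [sigma, lift_term, coeff_term]
    by_cases h : l = k
    · subst h
      simp [divXHom, comp_eq_aeval]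
    · simp [LinearMap.comp_apply, coeff_term, h]

theorem mulD_induction {P : DiffOp → Prop} {x : DiffOp} (hx : IsMulD x) (h0 : P 0)
    (hadd : ∀ x y, P x → P y → P (x + y)) (hterm : ∀ k f, P (term k (f * X))) : P x := by
  have hs : x = ∑ k ∈ Finsupp.support x, term k (x.coeff k) := (Finsupp.sum_single x).symm
  rw [hs]
  refine Finset.sum_induction _ P hadd h0 fun k _ => ?_
  obtain ⟨f, hf⟩ := hx k
  rw [hf, mul_comm]
  exact hterm k f

theorem IsMulD.mul {x y : DiffOp} (hx : IsMulD x) (hy : IsMulD y) : IsMulD (x * y) := by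
  refine mulD_induction (P := fun x => IsMulD (x * y)) hx ?_ (fun a b ha hb => ?_) fun k f => ?_
  · intro k; simp
  · rw [add_mul]; intro k; rw [map_add]; exact dvd_add (ha k) (hb k)
  refine mulD_induction (P := fun y => IsMulD (term k (f * X) * y)) hy ?_ (fun a b ha hb => ?_) fun l g => ?_
  · intro k; simp
  · rw [mul_add]; intro k; rw [map_add]; exact dvd_add (ha k) (hb k)
  intro j
  rw [term_mul_term, coeff_term]
  split_ifs
  · rw [← mul_assoc]; exact dvd_mul_left _ _
  · exact dvd_zero _

theorem sigma_mul (ε : ℤˣ) {x y : DiffOp} (hx : IsMulD x) (hy : IsMulD y) :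
    sigma ε (x * y) = sigma ε y * sigma ε x := by
  refine mulD_induction (P := fun x => sigma ε (x * y) = sigma ε y * sigma ε x) hx ?_ (fun a b ha hb => ?_) fun k f => ?_
  · simp
  · rw [add_mul, map_add, map_add, mul_add, ha, hb]
  refine mulD_induction
    (P := fun y => sigma ε (term k (f * X) * y) = sigma ε y * sigma ε (term k (f * X))) hy ?_ (fun a b ha hb => ?_) fun l g => ?_
  · simp
  · rw [mul_add, map_add, map_add, add_mul, ha, hb]
  rw [term_mul_term, ← mul_assoc, sigma_term, sigma_term, sigma_term, smul_mul_smul_comm,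
    term_mul_term, add_comm l k]
  have e1 : (-(((ε ^ l : ℤˣ) : ℤ) : ℂ)) * (-(((ε ^ k : ℤˣ) : ℤ) : ℂ)) =
      (((ε ^ (k + l) : ℤˣ) : ℤ) : ℂ) := by
    rw [zpow_add]; push_cast; ring
  rw [e1, neg_smul, ← smul_neg, ← map_neg]
  congr 2
  simp only [taylor_apply, mul_comp, add_comp, sub_comp, neg_comp, X_comp, C_comp, comp_assoc]
  have e2 : (-X - C ((k + l : ℤ) : ℂ) + C (l : ℂ) : ℂ[X]) = -X - C (k : ℂ) := by
    push_cast; rw [C_add]; ring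
  have e3 : (-(X + C (k : ℂ)) - C (l : ℂ) : ℂ[X]) = -X - C ((k + l : ℤ) : ℂ) := by
    push_cast; rw [C_add]; ring
  rw [e2, e3]; ring

/-- The Lie algebra `D_x^±` (for `ε = ±1`) of the multiples `d` of `D` with `σ_ε(d) = -d`. -/
def Dx (ε : ℤˣ) : LieSubalgebra ℂ DiffOp where
  carrier := {d | IsMulD d ∧ sigma ε d = -d}
  add_mem' := by
    rintro x y ⟨h1, h2⟩ ⟨h3, h4⟩
    refine ⟨fun k => ?_, ?_⟩
    · rw [map_add]; exact dvd_add (h1 k) (h3 k)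
    · rw [map_add, h2, h4, neg_add]
  zero_mem' := ⟨fun k => by simp, by simp⟩
  smul_mem' := by
    rintro c x ⟨h1, h2⟩
    refine ⟨fun k => ?_, ?_⟩
    · rw [map_smul]; rw [smul_eq_C_mul]; exact (h1 k).mul_left _
    · rw [map_smul, h2, smul_neg]
  lie_mem' := by
    rintro x y ⟨h1, h2⟩ ⟨h3, h4⟩
    refine ⟨fun k => ?_, ?_⟩
    · rw [lie_eq, map_sub]; exact dvd_sub (h1.mul h3 k) (h3.mul h1 k)
    · rw [lie_eq, map_sub, sigma_mul ε h1 h3, sigma_mul ε h3 h1, h2, h4]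
      noncomm_ring

theorem mem_Dx {ε : ℤˣ} {d : DiffOp} : d ∈ Dx ε ↔ IsMulD d ∧ sigma ε d = -d := Iff.rfl

end DiffOp
/-! ### The central extensions and the homomorphism between them -/

/-- The truncated polynomial algebra `R_m = ℂ[u]/(u^(m+1))`. -/
abbrev Rm (m : ℕ) : Type := ℂ[X] ⧸ Ideal.span {(X : ℂ[X]) ^ (m + 1)}

/-- The generator `u` of `R_m`. -/
def uvar (m : ℕ) : Rm m := Ideal.Quotient.mk _ X

theorem uvar_pow_eq_zero {m i : ℕ} (h : m < i) : uvar m ^ i = 0 := by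
  rw [uvar, ← map_pow, Ideal.Quotient.eq_zero_iff_mem, Ideal.mem_span_singleton]
  exact pow_dvd_pow X h

/-- The Lie algebra of infinite matrices over `R_m` with finitely many nonzero diagonals, extended
by the centre `R_m` through the cocycle `tr([J, A] B)`. -/
abbrev GlHat (m : ℕ) : Type := CentralExt (BandMatrix.cocycle (R := Rm m))

/-- The central extension of `D_x^±` by `ℂ C` given by the restriction of `Ψ`. -/
abbrev DxHat (ε : ℤˣ) : Type := CentralExt (DiffOp.psi.comap (DiffOp.Dx ε).incl)

/-- The power series `e^(a x)`. -/
def expS (a : ℂ) : PowerSeries ℂ := PowerSeries.rescale a (PowerSeries.exp ℂ)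

/-- The power series `cosh (a x)`. -/
def coshS (a : ℂ) : PowerSeries ℂ := (2⁻¹ : ℂ) • (expS a + expS (-a))

/-- The power series `sinh (a x)`. -/
def sinhS (a : ℂ) : PowerSeries ℂ := (2⁻¹ : ℂ) • (expS a - expS (-a))

/-- The power series
`η_i(x, s) = (e^((s-1/2) x) + (-1)^i e^(-(s-1/2) x)) / 2 · x^i / i!`. -/
def etaS (i : ℕ) (s : ℂ) : PowerSeries ℂ :=
  ((2 * (i.factorial : ℂ))⁻¹) •
    ((expS (s - 1 / 2) + (-1) ^ i * expS (-(s - 1 / 2))) * PowerSeries.X ^ i)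

/-- The coefficient of `u^i` in
`(1/2) · cosh(x/2) / sinh(x/2) - (1/2) ∑_i (η_i(x, s) / sinh(x/2)) u^i`, a Laurent series in `x`. -/
def corrS (i : ℕ) (s : ℂ) : LaurentSeries ℂ :=
  (((if i = 0 then coshS (1 / 2) else 0) - etaS i s : PowerSeries ℂ) : LaurentSeries ℂ) /
    (((2 : ℂ) • sinhS (1 / 2) : PowerSeries ℂ) : LaurentSeries ℂ)

/-- The linear map on polynomials with prescribed values on the powers of `X`. -/
def onPowers {V : Type*} [AddCommGroup V] [Module ℂ V] (a : ℕ → V) : ℂ[X] →ₗ[ℂ] V :=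
  Polynomial.lsum fun n => LinearMap.toSpanSingleton ℂ V (a n)

theorem onPowers_X_pow {V : Type*} [AddCommGroup V] [Module ℂ V] (a : ℕ → V) (n : ℕ) :
    onPowers a (X ^ n) = a n := by
  simp [onPowers, Polynomial.lsum_apply, X_pow_eq_monomial, sum_monomial_index]

theorem poly_hom_ext {V : Type*} [AddCommGroup V] [Module ℂ V] {F G : ℂ[X] →ₗ[ℂ] V}
    (h : ∀ n, F (X ^ n) = G (X ^ n)) : F = G := by
  refine Polynomial.lhom_ext' fun n => LinearMap.ext_ring ?_
  simpa [← X_pow_eq_monomial] using h n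

/-- The central part of the image of `f(D)`. Applied to `sinh(x D) = ∑_{n odd} x^n D^n / n!` it
gives `(1/2) · cosh(x/2) / sinh(x/2) - (1/2) ∑_{i ≤ m} (η_i(x, s) / sinh(x/2)) u^i`. -/
def corr (m : ℕ) (s : ℂ) : ℂ[X] →ₗ[ℂ] Rm m :=
  onPowers fun n => ∑ i ∈ Finset.range (m + 1),
    ((n.factorial : ℂ) * (corrS i s).coeff (n : ℤ)) • uvar m ^ i

/-- The functional `X^n ↦ n! · (coefficient of x^n)`. -/
def umbral (A : PowerSeries ℂ) : ℂ[X] →ₗ[ℂ] ℂ :=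
  onPowers fun n => (n.factorial : ℂ) * PowerSeries.coeff n A

theorem umbral_X_pow (A : PowerSeries ℂ) (n : ℕ) :
    umbral A (X ^ n) = (n.factorial : ℂ) * PowerSeries.coeff n A := onPowers_X_pow _ n

theorem umbral_add (A B : PowerSeries ℂ) : umbral (A + B) = umbral A + umbral B :=
  poly_hom_ext fun n => by simp [umbral_X_pow, mul_add]

theorem umbral_sub (A B : PowerSeries ℂ) : umbral (A - B) = umbral A - umbral B :=
  poly_hom_ext fun n => by simp [umbral_X_pow, mul_sub]

theorem umbral_smul (c : ℂ) (A : PowerSeries ℂ) : umbral (c • A) = c • umbral A :=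
  poly_hom_ext fun n => by simp [umbral_X_pow]; ring

theorem coeff_expS (a : ℂ) (n : ℕ) :
    PowerSeries.coeff n (expS a) = a ^ n * (n.factorial : ℂ)⁻¹ := by
  simp [expS, PowerSeries.coeff_rescale, PowerSeries.coeff_exp]

theorem umbral_expS (a : ℂ) (G : ℂ[X]) : umbral (expS a) G = G.eval a := by
  have : umbral (expS a) = (aeval a : ℂ[X] →ₐ[ℂ] ℂ).toLinearMap := poly_hom_ext fun n => by
    have := Nat.factorial_ne_zero n
    simp [umbral_X_pow, coeff_expS]
    field_simp
  rw [this]; simp [coe_aeval_eq_eval]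

theorem umbral_expS_mul (a : ℂ) (A : PowerSeries ℂ) (G : ℂ[X]) :
    umbral (expS a * A) G = umbral A (taylor a G) := by
  have : umbral (expS a * A) = umbral A ∘ₗ taylor a := poly_hom_ext fun n => by
    rw [LinearMap.comp_apply, taylor_X_pow, umbral_X_pow, add_pow, map_sum, mul_comm (expS a),
      PowerSeries.coeff_mul, Finset.Nat.sum_antidiagonal_eq_sum_range_succ_mk, Finset.mul_sum]
    refine Finset.sum_congr rfl fun k hk => ?_
    have hk' : k ≤ n := by simpa [Nat.lt_succ_iff] using hk
    rw [show (X ^ k * C a ^ (n - k) * ((n.choose k : ℕ) : ℂ[X]) : ℂ[X]) =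
      (a ^ (n - k) * (n.choose k : ℂ)) • X ^ k by
        rw [smul_eq_C_mul, C_mul, C_pow, map_natCast]; ring, map_smul, umbral_X_pow, coeff_expS,
        Nat.cast_choose ℂ hk', smul_eq_mul]
    have h1 : ((n - k).factorial : ℂ) ≠ 0 := Nat.cast_ne_zero.2 (Nat.factorial_ne_zero _)
    have h2 : (k.factorial : ℂ) ≠ 0 := Nat.cast_ne_zero.2 (Nat.factorial_ne_zero _)
    field_simp
  rw [this]; rfl

theorem umbral_etaS (i : ℕ) (s : ℂ) (G : ℂ[X]) : umbral (etaS i s) G =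
    2⁻¹ * ((hasseDeriv i G).eval (s - 1 / 2) + (hasseDeriv i (G.comp (-X))).eval (s - 1 / 2)) := by
  set b := s - 1 / 2 with hb
  have : umbral (etaS i s) = (2⁻¹ : ℂ) • ((aeval b : ℂ[X] →ₐ[ℂ] ℂ).toLinearMap ∘ₗ hasseDeriv i +
      (aeval b : ℂ[X] →ₐ[ℂ] ℂ).toLinearMap ∘ₗ hasseDeriv i ∘ₗ
        (aeval (-X) : ℂ[X] →ₐ[ℂ] ℂ[X]).toLinearMap) := poly_hom_ext fun n => by
    have e : ((-X : ℂ[X]) ^ n) = ((-1 : ℂ) ^ n) • X ^ n := by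
      rw [neg_pow, smul_eq_C_mul]; simp
    have h0 : PowerSeries.coeff n ((expS b + (-1) ^ i * expS (-b)) * PowerSeries.X ^ i) =
        if i ≤ n then (b ^ (n - i) + (-1) ^ i * (-b) ^ (n - i)) * ((n - i).factorial : ℂ)⁻¹
          else 0 := by
      rw [PowerSeries.coeff_mul_X_pow']
      congr 1
      rw [show ((-1 : PowerSeries ℂ) ^ i) = PowerSeries.C ((-1 : ℂ) ^ i) by simp, map_add,
        PowerSeries.coeff_C_mul, coeff_expS, coeff_expS]
      ring
    rw [umbral_X_pow, etaS, ← hb, PowerSeries.coeff_smul, h0]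
    simp only [LinearMap.smul_apply, LinearMap.add_apply, LinearMap.comp_apply,
      AlgHom.toLinearMap_apply, map_pow, aeval_X, e, map_smul]
    simp only [X_pow_eq_monomial, hasseDeriv_monomial, aeval_monomial]
    by_cases h : i ≤ n
    · rw [if_pos h]
      have e2 : ((-1 : ℂ)) ^ i * (-b) ^ (n - i) = (-1) ^ n * b ^ (n - i) := by
        rw [neg_pow b, ← mul_assoc, ← pow_add, Nat.add_sub_cancel' h]
      rw [e2, Nat.cast_choose ℂ h]
      have h1 : ((n - i).factorial : ℂ) ≠ 0 := Nat.cast_ne_zero.2 (Nat.factorial_ne_zero _)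
      have h2 : (i.factorial : ℂ) ≠ 0 := Nat.cast_ne_zero.2 (Nat.factorial_ne_zero _)
      simp
      field_simp
    · rw [if_neg h, Nat.choose_eq_zero_of_lt (by omega)]
      simp
  rw [this]
  simp [coe_aeval_eq_eval, comp_eq_aeval, mul_add]

theorem coshS_half : umbral (coshS (1 / 2)) = (2⁻¹ : ℂ) • (umbral (expS (1 / 2)) +
    umbral (expS (-(1 / 2)))) := by
  rw [coshS, umbral_smul, umbral_add]

theorem exists_corrS (i : ℕ) (s : ℂ) : ∃ A : PowerSeries ℂ, corrS i s = (A : LaurentSeries ℂ) ∧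
    (expS (1 / 2) - expS (-(1 / 2))) * A = (if i = 0 then coshS (1 / 2) else 0) - etaS i s := by
  set num : PowerSeries ℂ := (if i = 0 then coshS (1 / 2) else 0) - etaS i s with hnum
  set den : PowerSeries ℂ := expS (1 / 2) - expS (-(1 / 2)) with hden
  have hden' : (2 : ℂ) • sinhS (1 / 2) = den := by
    rw [sinhS, smul_smul]; norm_num; rw [hden]
  have c0 : ∀ a, PowerSeries.constantCoeff (expS a) = 1 := fun a => by
    rw [← PowerSeries.coeff_zero_eq_constantCoeff_apply, coeff_expS]; simp
  have h1 : PowerSeries.X ∣ num := by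
    rw [PowerSeries.X_dvd_iff, hnum, map_sub, etaS, coshS]
    rcases Nat.eq_zero_or_pos i with rfl | hi
    · simp [PowerSeries.constantCoeff_smul, c0]
    · rw [if_neg (by omega)]
      simp [PowerSeries.constantCoeff_smul, hi.ne']
  have h2 : PowerSeries.X ∣ den := by
    rw [PowerSeries.X_dvd_iff, hden, map_sub, c0, c0, sub_self]
  obtain ⟨num', hn⟩ := h1
  obtain ⟨den', hd⟩ := h2
  have hdc : PowerSeries.constantCoeff den' ≠ 0 := by
    have : PowerSeries.coeff 1 den = PowerSeries.constantCoeff den' := by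
      rw [hd, show (1 : ℕ) = 0 + 1 from rfl, PowerSeries.coeff_succ_X_mul,
        PowerSeries.coeff_zero_eq_constantCoeff_apply]
    rw [← this, hden, map_sub, coeff_expS, coeff_expS]
    norm_num
  have hdne : den ≠ 0 := by
    rw [hd]
    refine mul_ne_zero PowerSeries.X_ne_zero fun h => hdc (by rw [h, map_zero])
  have hA : den * (num' * den'⁻¹) = num := by
    rw [hd, hn]
    calc _ = PowerSeries.X * num' * (den' * den'⁻¹) := by ring
      _ = _ := by rw [PowerSeries.mul_inv_cancel _ hdc, mul_one]
  refine ⟨num' * den'⁻¹, ?_, hA⟩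
  rw [corrS, hden', ← hnum, div_eq_iff, ← PowerSeries.coe_mul, mul_comm, hA]
  intro h
  exact hdne (by
    have := (HahnSeries.ofPowerSeries_injective (Γ := ℤ) (R := ℂ)) (a₁ := den) (a₂ := 0)
    exact this (by simpa using h))

theorem corr_eq (m : ℕ) (s : ℂ) (G : ℂ[X]) (hG : G.comp (-X) = G) :
    corr m s (taylor (1 / 2) G - taylor (-(1 / 2)) G) =
      algebraMap ℂ _ (G.eval (1 / 2)) -
        aeval (algebraMap ℂ (Rm m) (s - 1 / 2) + uvar m) G := by
  choose A hA hA' using fun i => exists_corrS i s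
  have e1 : corr m s = ∑ i ∈ Finset.range (m + 1),
      (LinearMap.toSpanSingleton ℂ (Rm m) (uvar m ^ i)) ∘ₗ umbral (A i) := poly_hom_ext fun n => by
    rw [corr, onPowers_X_pow, LinearMap.sum_apply]
    refine Finset.sum_congr rfl fun i _ => ?_
    rw [LinearMap.comp_apply, umbral_X_pow, LinearMap.toSpanSingleton_apply, hA]
    congr 2
    rw [PowerSeries.coeff_coe]
    simp
  have e2 : ∀ i, umbral (A i) (taylor (1 / 2) G - taylor (-(1 / 2)) G) =
      (if i = 0 then G.eval (1 / 2) else 0) - (hasseDeriv i G).eval (s - 1 / 2) := by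
    intro i
    have h1 := congrArg (fun B => umbral B G) (hA' i)
    simp only [sub_mul, umbral_sub, LinearMap.sub_apply, umbral_expS_mul, umbral_etaS, hG] at h1
    rw [map_sub, h1]
    have hE : G.eval (-(1 / 2)) = G.eval (1 / 2) := by
      conv_rhs => rw [← hG]
      simp [eval_comp]
    congr 1
    · split_ifs
      · rw [coshS_half, LinearMap.smul_apply, LinearMap.add_apply, umbral_expS, umbral_expS, hE,
          smul_eq_mul]; ring
      · have : umbral 0 = 0 := by simpa using umbral_smul 0 0
        rw [this]; rfl
    · ring
  rw [e1, LinearMap.sum_apply]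
  simp only [LinearMap.comp_apply, e2, LinearMap.toSpanSingleton_apply, sub_smul,
    Finset.sum_sub_distrib]
  congr 1
  · rw [Finset.sum_eq_single 0]
    · simp [Algebra.algebraMap_eq_smul_one]
    · intro i _ hi; simp [hi]
    · simp
  · have e3 : aeval (algebraMap ℂ (Rm m) (s - 1 / 2) + uvar m) G =
        aeval (uvar m) (taylor (s - 1 / 2) G) := by
      rw [taylor_apply, aeval_comp]
      simp only [map_add, aeval_X, aeval_C]
      congr 2
      exact add_comm _ _
    rw [e3, aeval_eq_sum_range' (n := max (m + 1) ((taylor (s - 1 / 2) G).natDegree + 1))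
      (lt_of_lt_of_le (Nat.lt_succ_self _) (le_max_right _ _))]
    rw [← Finset.sum_subset (Finset.range_subset_range.2 (le_max_left (m + 1) _))]
    · simp only [taylor_coeff]
    · intro i _ hi
      rw [uvar_pow_eq_zero, smul_zero]
      simp at hi; omega

theorem const_of_periodic (P : ℂ[X]) (h : taylor 1 P = P) : P = C (P.eval 0) := by
  have h1 : ∀ n : ℕ, P.eval (n : ℂ) = P.eval 0 := by
    intro n
    induction n with
    | zero => simp
    | succ n ih =>
      rw [← ih]
      conv_rhs => rw [← h]
      rw [taylor_eval]; push_cast; rfl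
  refine Polynomial.eq_of_infinite_eval_eq _ _ ?_
  refine Set.Infinite.mono ?_ (Set.infinite_range_of_injective (Nat.cast_injective (R := ℂ)))
  rintro _ ⟨n, rfl⟩
  simp [h1]

theorem corr_diff (m : ℕ) (s : ℂ) (K w : ℂ[X]) (hK : taylor 1 K - K = w)
    (hw : w.comp (-X) = -w) :
    corr m s w = algebraMap ℂ _ (K.eval 0) - aeval (algebraMap ℂ (Rm m) s + uvar m) K := by
  set G := taylor (1 / 2) K with hG
  have hKG : K = taylor (-(1 / 2)) G := by rw [hG, taylor_taylor]; norm_num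
  have hKG1 : taylor 1 K = taylor (1 / 2) G := by rw [hG, taylor_taylor]; norm_num
  have tc : ∀ (a : ℂ) (F : ℂ[X]), taylor a (F.comp (-X)) = (taylor (-a) F).comp (-X) := by
    intro a F
    simp only [taylor_apply, comp_assoc]
    congr 1
    simp; ring
  have hw' : w = taylor (1 / 2) G - taylor (-(1 / 2)) G := by rw [← hK, hKG1, ← hKG]
  have heven : G.comp (-X) = G := by
    set P := G - G.comp (-X) with hP
    have h0 : taylor (1 / 2) P = taylor (-(1 / 2)) P := by
      rw [← sub_eq_zero, hP, map_sub, map_sub, tc, tc, neg_neg]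
      rw [hw', sub_comp] at hw
      linear_combination hw
    have h1 : taylor 1 P = P := by
      have := congrArg (taylor (1 / 2)) h0
      rw [taylor_taylor, taylor_taylor] at this
      norm_num at this
      exact this
    have h2 := const_of_periodic P h1
    have h3 : P.comp (-X) = -P := by
      rw [hP, sub_comp, comp_assoc]; simp
    have h4 : P.eval 0 = 0 := by
      have := congrArg (eval 0) h3
      simp [eval_comp] at this
      have h5 : (2 : ℂ) * P.eval 0 = 0 := by linear_combination this
      simpa using h5
    rw [h4, C_0] at h2
    rw [hP, sub_eq_zero] at h2
    exact h2.symm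
  rw [hw', corr_eq m s G heven]
  congr 1
  · congr 1
    have h5 : G.eval (1 / 2) = G.eval (-(1 / 2)) := by
      conv_lhs => rw [← heven]
      simp [eval_comp]
    rw [h5, hKG, taylor_eval (-(1 / 2)) G, zero_add]
  · rw [hKG, taylor_apply, aeval_comp]
    congr 2
    simp only [map_add, aeval_X, aeval_C, map_sub, map_neg]
    ring

namespace DiffOp

theorem signedSum_succ {V : Type*} [AddCommGroup V] (r : ℤ) (h : ℤ → V) :
    signedSum (r + 1) h = signedSum r h + h (-r - 1) := by
  rw [signedSum, signedSum]
  rcases le_or_gt 0 r with hr | hr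
  · have e1 : Finset.Ico (-(r + 1)) 0 = insert (-r - 1) (Finset.Ico (-r) 0) := by
      ext x; simp; omega
    rw [e1, Finset.sum_insert (by simp), Finset.Ico_eq_empty (by omega : ¬ (0 : ℤ) < -(r + 1)),
      Finset.Ico_eq_empty (by omega : ¬ (0 : ℤ) < -r)]
    simp [add_comm]
  · have e1 : Finset.Ico 0 (-r) = insert (-r - 1) (Finset.Ico 0 (-(r + 1))) := by
      ext x; simp; omega
    rw [e1, Finset.sum_insert (by simp; omega),
      Finset.Ico_eq_empty (by omega : ¬ -(r + 1) < (0 : ℤ)),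
      Finset.Ico_eq_empty (by omega : ¬ -r < (0 : ℤ))]
    simp

theorem signedSum_telescope {V : Type*} [AddCommGroup V] (r : ℤ) (h : ℤ → V) :
    signedSum r (fun m => h (m + 1) - h m) = h 0 - h (-r) := by
  induction r using Int.induction_on with
  | zero => simp [signedSum]
  | succ n ih =>
    rw [signedSum_succ, ih, show -(n : ℤ) - 1 + 1 = -n by ring,
      show -((n : ℤ) + 1) = -n - 1 by ring]
    abel
  | pred n ih =>
    have := signedSum_succ (-(n : ℤ) - 1) (fun m => h (m + 1) - h m)
    rw [show -(n : ℤ) - 1 + 1 = -n by ring, ih, ← sub_eq_iff_eq_add,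
      show -(-(n : ℤ) - 1) - 1 = n by ring] at this
    rw [← this, show -(-(n : ℤ) - 1) = n + 1 by ring, neg_neg]
    abel

theorem map_signedSum {V W : Type*} [AddCommGroup V] [AddCommGroup W] (F : V →+ W) (r : ℤ)
    (h : ℤ → V) : F (signedSum r h) = signedSum r fun m => F (h m) := by
  simp [signedSum]

theorem exists_antidifference {R : Type*} [CommRing R] [Algebra ℂ R] (y : R) (a b : DiffOp) :
    ∃ K : ℂ[X], taylor 1 K - K = (⁅a, b⁆).coeff 0 ∧
      BandMatrix.cocycle.toFun (toMatrix y a) (toMatrix y b) =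
        algebraMap ℂ R (psiForm a b) + (algebraMap ℂ R (K.eval 0) - aeval y K) := by
  induction a using induction_on with
  | h0 => exact ⟨0, by simp⟩
  | hadd a a' h h' =>
    obtain ⟨K, h1, h2⟩ := h
    obtain ⟨K', h3, h4⟩ := h'
    refine ⟨K + K', ?_, ?_⟩
    · rw [add_lie, map_add, map_add, ← h1, ← h3]; ring
    · simp only [map_add, LinearMap.add_apply, h2, h4, eval_add]; ring
  | hterm r f =>
    induction b using induction_on with
    | h0 => exact ⟨0, by simp⟩
    | hadd b b' h h' =>
      obtain ⟨K, h1, h2⟩ := h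
      obtain ⟨K', h3, h4⟩ := h'
      refine ⟨K + K', ?_, ?_⟩
      · rw [lie_add, map_add, map_add, ← h1, ← h3]; ring
      · simp only [map_add, h2, h4, eval_add]; ring
    | hterm q g =>
      rw [lie_eq, term_mul_term, term_mul_term, cocycle_toMatrix, psiForm_term, map_sub,
        coeff_term, coeff_term]
      by_cases h : r + q = 0
      · obtain rfl : q = -r := by omega
        simp only [add_neg_cancel, neg_add_cancel, if_true]
        set H := f * taylor (r : ℂ) g with hH
        refine ⟨-signedSum r fun m => taylor (m : ℂ) H, ?_, ?_⟩
        · rw [map_neg, sub_neg_eq_add, ← LinearMap.toAddMonoidHom_coe, map_signedSum]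
          have := signedSum_telescope r fun m => taylor (m : ℂ) H
          have e : (signedSum r fun m : ℤ => taylor ((m + 1 : ℤ) : ℂ) H - taylor (m : ℂ) H) =
              (signedSum r fun m : ℤ => taylor 1 (taylor (m : ℂ) H)) -
                signedSum r fun m : ℤ => taylor (m : ℂ) H := by
            simp only [signedSum, Finset.sum_sub_distrib, taylor_taylor]
            push_cast
            simp only [add_comm (1 : ℂ)]
            abel
          rw [e] at this
          have h2 : taylor (((-r : ℤ)) : ℂ) H = taylor (((-r : ℤ)) : ℂ) f * g := by
            rw [hH, taylor_mul, taylor_taylor]; push_cast; simp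
          rw [h2] at this
          simp only [LinearMap.toAddMonoidHom_coe]
          simp only [Int.cast_zero, taylor_zero] at this
          rw [mul_comm (taylor (r : ℂ) g) f, ← hH]
          linear_combination -this
        · have e1 : aeval y (signedSum r fun m : ℤ => taylor (m : ℂ) H) =
              signedSum r fun m : ℤ => aeval ((m : R) + y) H := by
            have := map_signedSum ((aeval y : ℂ[X] →ₐ[ℂ] R) : ℂ[X] →+ R) r
              fun m : ℤ => taylor (m : ℂ) H
            refine this.trans ?_
            congr 1; funext m
            change aeval y _ = _
            rw [taylor_apply, aeval_comp]
            simp only [map_add, aeval_X, map_intCast]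
            rw [add_comm]
          have e2 : eval 0 (signedSum r fun m : ℤ => taylor (m : ℂ) H) =
              signedSum r fun m : ℤ => H.eval (m : ℂ) := by
            have := map_signedSum (evalRingHom (0 : ℂ) : ℂ[X] →+ ℂ) r
              fun m : ℤ => taylor (m : ℂ) H
            refine this.trans ?_
            congr 1; funext m
            change eval 0 _ = _
            rw [taylor_eval, zero_add]
          rw [map_neg, eval_neg, e1, e2, map_neg]
          ring
      · refine ⟨0, ?_, ?_⟩
        · rw [if_neg h, if_neg (by omega)]; simp
        · rw [if_neg h, if_neg h]; simp

theorem coeff_zero_odd {ε : ℤˣ} {d : DiffOp} (hd : d ∈ Dx ε) :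
    (d.coeff 0).comp (-X) = -d.coeff 0 := by
  obtain ⟨h1, h2⟩ := hd
  have h3 := congrArg (coeff 0) h2
  rw [coeff_sigma] at h3
  obtain ⟨f, hf⟩ := h1 0
  rw [map_neg, hf, mul_comm X f, divX_mul_X'] at h3
  simp only [zpow_zero, Units.val_one, Int.cast_one, Int.cast_zero, C_0, sub_zero, neg_smul,
    one_smul, neg_inj] at h3
  rw [hf, mul_comm X f, mul_comp, X_comp, mul_neg, h3]

end DiffOp

/-- The homomorphism from the central extension of `D_x^±` to the central extension of the matrix
algebra: it sends `t^k f(D)` to `∑ⱼ f(-j+s+u) E_{j-k,j}`, plus the central term `corr m s f` if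
`k = 0`, and it sends the central element `C` to `1 ∈ R_m`. -/
def phiHat (ε : ℤˣ) (m : ℕ) (s : ℂ) : DxHat ε →ₗ⁅ℂ⁆ GlHat m where
  toFun x := ⟨DiffOp.toMatrix (algebraMap ℂ (Rm m) s + uvar m) x.base,
    corr m s ((x.base : DiffOp).coeff 0) + algebraMap ℂ (Rm m) x.central⟩
  map_add' x y := by
    refine CentralExt.ext ?_ ?_
    · simp
    · simp only [CentralExt.base_add, CentralExt.central_add, AddMemClass.coe_add, map_add]
      ring
  map_smul' c x := by
    refine CentralExt.ext ?_ ?_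
    · simp only [CentralExt.base_smul, SetLike.val_smul, map_smul, RingHom.id_apply]
    · simp only [CentralExt.base_smul, CentralExt.central_smul, SetLike.val_smul, map_smul,
        RingHom.id_apply, smul_add, Algebra.algebraMap_eq_smul_one, smul_eq_mul, mul_smul]
  map_lie' {x y} := by
    refine CentralExt.ext ?_ ?_
    · simp only [CentralExt.base_lie, LieSubalgebra.coe_bracket, DiffOp.toMatrix_lie]
    · obtain ⟨K, h1, h2⟩ := DiffOp.exists_antidifference (algebraMap ℂ (Rm m) s + uvar m)
        (x.base : DiffOp) y.base
      simp only [CentralExt.base_lie, CentralExt.central_lie]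
      rw [h2, corr_diff m s K (((⁅x.base, y.base⁆ : DiffOp.Dx ε) : DiffOp).coeff 0) h1
        (DiffOp.coeff_zero_odd ⁅x.base, y.base⁆.2)]
      exact add_comm _ _

/-! ### Gradations -/

/-- The component of degree `k` in the principal gradation of the central extension of the matrix
algebra: `E_{ij}` has degree `j - i` and the centre has degree `0`. -/
def glGrading (m : ℕ) (k : ℤ) : Submodule ℂ (GlHat m) where
  carrier := {x | (∀ i j, j - i ≠ k → x.base.entry i j = 0) ∧ (k ≠ 0 → x.central = 0)}
  add_mem' := by
    rintro x y ⟨h1, h2⟩ ⟨h3, h4⟩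
    exact ⟨fun i j h => by simp [h1 i j h, h3 i j h], fun h => by simp [h2 h, h4 h]⟩
  zero_mem' := ⟨fun i j _ => by simp, fun _ => by simp⟩
  smul_mem' := by
    rintro c x ⟨h1, h2⟩
    exact ⟨fun i j h => by simp [h1 i j h], fun h => by simp [h2 h]⟩

/-- The component of degree `k` in the principal gradation of the central extension of `D_x^±`:
`t^k f(D)` has degree `k` and `C` has degree `0`. -/
def dxGrading (ε : ℤˣ) (k : ℤ) : Submodule ℂ (DxHat ε) where
  carrier := {x | (∀ l, l ≠ k → (x.base : DiffOp).coeff l = 0) ∧ (k ≠ 0 → x.central = 0)}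
  add_mem' := by
    rintro x y ⟨h1, h2⟩ ⟨h3, h4⟩
    exact ⟨fun l h => by simp [h1 l h, h3 l h], fun h => by simp [h2 h, h4 h]⟩
  zero_mem' := ⟨fun l _ => by simp, fun _ => by simp⟩
  smul_mem' := by
    rintro c x ⟨h1, h2⟩
    exact ⟨fun l h => by simp [h1 l h], fun h => by simp [h2 h]⟩

/-! ### Irreducible highest weight modules -/

section HighestWeight

variable {g : Type*} [LieRing g] [LieAlgebra ℂ g]

/-- The left ideal of `U(g)` generated by `g_+` and by the elements `h - Λ(h)` with `h ∈ g_0`. -/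
def vermaIdeal (gr : ℤ → Submodule ℂ g) (Λ : Module.Dual ℂ (gr 0)) :
    Submodule (UniversalEnvelopingAlgebra ℂ g) (UniversalEnvelopingAlgebra ℂ g) :=
  Submodule.span (UniversalEnvelopingAlgebra ℂ g)
    ({a | ∃ k : ℤ, 0 < k ∧ ∃ x ∈ gr k, a = UniversalEnvelopingAlgebra.ι ℂ x} ∪
     {a | ∃ h : gr 0, a = UniversalEnvelopingAlgebra.ι ℂ (h : g) -
        algebraMap ℂ (UniversalEnvelopingAlgebra ℂ g) (Λ h)})

/-- The Verma module `M(g, Λ) = U(g) ⊗_{U(g_0 ⊕ g_+)} ℂ_Λ`, as a cyclic module. -/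
abbrev Verma (gr : ℤ → Submodule ℂ g) (Λ : Module.Dual ℂ (gr 0)) : Type _ :=
  (UniversalEnvelopingAlgebra ℂ g) ⧸ vermaIdeal gr Λ

/-- The component of degree `j` of the Verma module, spanned by the vectors `y_1 ⋯ y_n v_Λ` with
homogeneous `y_i` whose degrees add up to `j`. -/
def Verma.degree (gr : ℤ → Submodule ℂ g) (Λ : Module.Dual ℂ (gr 0)) (j : ℤ) :
    Submodule ℂ (Verma gr Λ) :=
  Submodule.span ℂ {v | ∃ l : List (ℤ × g), (∀ p ∈ l, p.2 ∈ gr p.1) ∧ (l.map Prod.fst).sum = j ∧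
    v = Submodule.Quotient.mk ((l.map fun p => UniversalEnvelopingAlgebra.ι ℂ p.2).prod)}

/-- A submodule is graded if each of its elements is a sum of homogeneous elements of it. -/
def Verma.IsGraded {gr : ℤ → Submodule ℂ g} {Λ : Module.Dual ℂ (gr 0)}
    (N : Submodule (UniversalEnvelopingAlgebra ℂ g) (Verma gr Λ)) : Prop :=
  N.restrictScalars ℂ ≤ ⨆ j, N.restrictScalars ℂ ⊓ Verma.degree gr Λ j

/-- The maximal proper graded submodule of the Verma module (the sum of all of them). -/
def Verma.maxSubmodule (gr : ℤ → Submodule ℂ g) (Λ : Module.Dual ℂ (gr 0)) :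
    Submodule (UniversalEnvelopingAlgebra ℂ g) (Verma gr Λ) :=
  sSup {N | N ≠ ⊤ ∧ Verma.IsGraded N}

/-- The irreducible highest weight module `L(g, Λ)`. -/
def IrrHW (gr : ℤ → Submodule ℂ g) (Λ : Module.Dual ℂ (gr 0)) : Type _ :=
  Verma gr Λ ⧸ Verma.maxSubmodule gr Λ

namespace IrrHW

variable (gr : ℤ → Submodule ℂ g) (Λ : Module.Dual ℂ (gr 0))

instance : AddCommGroup (IrrHW gr Λ) :=
  inferInstanceAs (AddCommGroup (Verma gr Λ ⧸ Verma.maxSubmodule gr Λ))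
instance : Module (UniversalEnvelopingAlgebra ℂ g) (IrrHW gr Λ) :=
  inferInstanceAs (Module (UniversalEnvelopingAlgebra ℂ g) (Verma gr Λ ⧸ Verma.maxSubmodule gr Λ))
instance : Module ℂ (IrrHW gr Λ) :=
  inferInstanceAs (Module ℂ (Verma gr Λ ⧸ Verma.maxSubmodule gr Λ))
instance : IsScalarTower ℂ (UniversalEnvelopingAlgebra ℂ g) (IrrHW gr Λ) :=
  inferInstanceAs (IsScalarTower ℂ (UniversalEnvelopingAlgebra ℂ g) (Verma gr Λ ⧸ Verma.maxSubmodule gr Λ))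

/-- The action of the Lie algebra. -/
instance : LieRingModule g (IrrHW gr Λ) where
  bracket x v := UniversalEnvelopingAlgebra.ι ℂ x • v
  add_lie x y v := by simp only [map_add, add_smul]
  lie_add x v w := smul_add _ v w
  leibniz_lie x y v := by
    simp only [LieHom.map_lie, LieRing.of_associative_ring_bracket, sub_smul, mul_smul]
    abel

theorem lie_def (x : g) (v : IrrHW gr Λ) : ⁅x, v⁆ = UniversalEnvelopingAlgebra.ι ℂ x • v := rfl

instance : LieModule ℂ g (IrrHW gr Λ) where
  smul_lie c x v := by rw [lie_def, lie_def, map_smul, smul_assoc]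
  lie_smul c x v := by
    rw [lie_def, lie_def, ← algebraMap_smul (UniversalEnvelopingAlgebra ℂ g) c v, ← algebraMap_smul (UniversalEnvelopingAlgebra ℂ g) c, ← mul_smul,
      ← mul_smul, Algebra.commutes]

/-- The component of degree `j` of `L(g, Λ)`. -/
def degree (j : ℤ) : Submodule ℂ (IrrHW gr Λ) :=
  (Verma.degree gr Λ j).map ((Verma.maxSubmodule gr Λ).mkQ.restrictScalars ℂ)

/-- `L(g, Λ)` is quasifinite if all its homogeneous components are finite-dimensional. -/
def IsQuasifinite : Prop := ∀ j, FiniteDimensional ℂ (degree gr Λ j)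

end IrrHW

end HighestWeight

/-! ### Labels, exponents and multiplicities -/

/-- The element `u^i E_{jj}`. -/
def diagElt (m i : ℕ) (j : ℤ) : glGrading m 0 :=
  ⟨⟨BandMatrix.diag 0 (Pi.single j (uvar m ^ i)), 0⟩, fun a b h => by
    simp [BandMatrix.entry_diag, sub_ne_zero.1 h |>.symm], fun h => absurd rfl h⟩

/-- The element `u^i` of the centre `R_m`. -/
def centralElt (m i : ℕ) : glGrading m 0 :=
  ⟨⟨0, uvar m ^ i⟩, fun _ _ _ => rfl, fun h => absurd rfl h⟩

/-- The number `ᵃh_j^(i) = ᵃλ_j^(i) - ᵃλ_{j+1}^(i) + δ_{j,0} c_i`, where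
`ᵃλ_j^(i) = Λ(u^i E_{jj})` and `c_i = Λ(u^i)`. -/
def hLabel {m : ℕ} (Λ : Module.Dual ℂ (glGrading m 0)) (j : ℤ) (i : ℕ) : ℂ :=
  Λ (diagElt m i j) - Λ (diagElt m i (j + 1)) + if j = 0 then Λ (centralElt m i) else 0

/-- The element `D^l D` of degree zero, where `l = 2k` is even. -/
def dPower (ε : ℤˣ) (k : ℕ) : dxGrading ε 0 :=
  ⟨⟨⟨DiffOp.term 0 (X ^ (2 * k) * X), by
    refine ⟨fun l => ?_, ?_⟩
    · rw [DiffOp.coeff_term]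
      split_ifs
      · exact dvd_mul_left _ _
      · exact dvd_zero _
    · rw [DiffOp.sigma_term]
      simp [pow_mul]⟩, 0⟩,
    fun l h => by simp [DiffOp.coeff_term, h.symm], fun h => absurd rfl h⟩

/-- The central element `C`. -/
def dCentral (ε : ℤˣ) : dxGrading ε 0 :=
  ⟨⟨0, 1⟩, fun l _ => by simp, fun h => absurd rfl h⟩

/-- The generating series `Δ_μ(x) = ∑_{l even} Δ_l x^l / l!`, where `Δ_l = -μ(D^l D)`. -/
def deltaSeries {ε : ℤˣ} (μ : Module.Dual ℂ (dxGrading ε 0)) : PowerSeries ℂ :=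
  PowerSeries.mk fun l => if Even l then -μ (dPower ε (l / 2)) / (l.factorial : ℂ) else 0

/-- Quasipolynomials: linear combinations of `q(x) e^(a x)` with `q` a polynomial, `a ∈ ℂ`. -/
def quasipolynomials : Submodule ℂ (PowerSeries ℂ) :=
  Submodule.span ℂ {F | ∃ (q : ℂ[X]) (a : ℂ), F = (q : PowerSeries ℂ) * expS a}

/-- The functions `ep, em : ℂ → ℂ[X]` describe a set of even type exponents and a set of odd type
exponents with multiplicities: `e` is an even (odd) type exponent iff `ep e ≠ 0` (`em e ≠ 0`), and
this polynomial is its multiplicity. There are finitely many exponents, multiplicities are even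
resp. odd polynomials, and only one of `e`, `-e` is used, since exponents are defined up to sign
(and `sinh(0 x) = 0`). -/
structure IsExponentData (ep em : ℂ → ℂ[X]) : Prop where
  finite_even : (Function.support ep).Finite
  finite_odd : (Function.support em).Finite
  even : ∀ e, (ep e).comp (-X) = ep e
  odd : ∀ e, (em e).comp (-X) = -em e
  even_unique : ∀ e, e ≠ 0 → ep e ≠ 0 → ep (-e) = 0
  odd_unique : ∀ e, em e ≠ 0 → em (-e) = 0

/-- `L(D̂_x^±, μ)` has the even type exponents `e` with multiplicities `ep e` and the odd type
exponents `e` with multiplicities `em e`: we have `Δ_μ(x) = d/dx (φ(x) / (2 sinh(x/2)))` with an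
even quasipolynomial `φ` such that `φ(0) = 0` and
`φ(x) + μ(C) cosh(x/2) = ∑_e ep_e(x) cosh(e x) + ∑_e em_e(x) sinh(e x)`. -/
def HasExponents {ε : ℤˣ} (μ : Module.Dual ℂ (dxGrading ε 0)) (ep em : ℂ → ℂ[X]) : Prop :=
  IsExponentData ep em ∧
  ∃ φ Γ : PowerSeries ℂ,
    φ ∈ quasipolynomials ∧ PowerSeries.evalNegHom φ = φ ∧ PowerSeries.constantCoeff φ = 0 ∧
    ((2 : ℂ) • sinhS (1 / 2)) * Γ = φ ∧
    deltaSeries μ = PowerSeries.derivative ℂ Γ ∧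
    φ + μ (dCentral ε) • coshS (1 / 2) =
      (∑ᶠ e, (ep e : PowerSeries ℂ) * coshS e) + ∑ᶠ e, (em e : PowerSeries ℂ) * sinhS e

/-- The polynomial `∑ ᵃh_j^(i) x^i / i!`, the sum over the even `0 ≤ i ≤ m`. -/
def evenMult {m : ℕ} (Λ : Module.Dual ℂ (glGrading m 0)) (j : ℤ) : ℂ[X] :=
  ∑ i ∈ Finset.range (m + 1) with Even i, C (hLabel Λ j i / (i.factorial : ℂ)) * X ^ i

/-- The polynomial `∑ ᵃh_j^(i) x^i / i!`, the sum over the odd `0 ≤ i ≤ m`. -/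
def oddMult {m : ℕ} (Λ : Module.Dual ℂ (glGrading m 0)) (j : ℤ) : ℂ[X] :=
  ∑ i ∈ Finset.range (m + 1) with Odd i, C (hLabel Λ j i / (i.factorial : ℂ)) * X ^ i

/-- The family attaching to the exponent `s - j - 1/2`, for each `j ∈ ℤ`, the multiplicity `q j`
(and `0` to all other complex numbers). -/
def atExponents (s : ℂ) (q : ℤ → ℂ[X]) : ℂ → ℂ[X] :=
  Function.extend (fun j : ℤ => s - (j : ℂ) - 1 / 2) q 0

end DiffOpRep

end

open DiffOpRep

noncomputable section

namespace DiffOpRep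

attribute [local instance 100] LieRing.ofAssociativeRing

/-! Restrict L = L(gl, Λ) along φ = `phiHat`. The result is graded, and its highest weight vector
has weight Λ∘φ (`pullbackWeight`). By `IrrHW.exists_equiv` it is the irreducible highest weight
module of that weight once it has no nontrivial graded submodule over the smaller algebra. Two facts
give this.

First, fix degrees d and k ≠ 0. The matrices with a polynomial sequence p(j) on the k-th diagonal
form an infinite-dimensional space mapping to the finite-dimensional Hom(L_d, L_{d+k}), so some p ≠
0 acts by zero. Brackets with diagonal matrices turn p into every multiple of p, hence the k-th
diagonal acts on L_d only through its entries at the finitely many integer roots of p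
(`exists_finset_glDiag_smul`).

Second, since 2s is not an integer, the points s - j and their reflections -s + j - k are distinct.
Hermite interpolation followed by symmetrization then shows that the image of φ in degree k attains
any finite set of prescribed entries (`exists_phiHat_eq_glDiag`).

Together, a graded subspace stable under φ is stable under all of gl in degrees k ≠ 0. Degree zero
follows because its elements are brackets of degrees 1 and -1 (`ι_smul_mem_of_phiHat`).

For the weight, write degree zero in coordinates c_j (`glCoroot`), in which the labels are the
values of Λ on unit sequences. By telescoping, the j-th coordinate of φ(f(D)) is the central
correction of f at the parameter s - j (`phiHat_eq_glCoroot`). Quasifiniteness makes Λ depend on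
finitely many coordinates (`exists_coroot_eq_sum`), so the generating series of the weight is a
finite combination of the series η_i(x, s - j) / (2 sinh(x/2)), up to the cosh(x/2) term; this
exhibits the exponents s - j - 1/2 (`hasExponents_pullbackWeight`). Conversely exponents determine
the weight (`HasExponents.unique`).

The abstract input is that L is nonzero and graded-irreducible. The Verma module is nonzero because
an explicit functional on words behaves like the coefficient of the highest weight vector (`hwWord`,
`Verma.hwv_ne_zero`). Its degrees are independent as eigenspaces (`Verma.iSupIndep_degree`), and its
degree zero component is at most a line (`Verma.degree_zero_le`). -/

/-! ### The universal highest weight functional on words -/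

section Words

variable {g : Type*} [LieRing g]

/-- The derivation of a function on words given by the adjoint action of `z` on the letters. -/
def adWord (z : g) : (List g → ℂ) → List g → ℂ
  | _, [] => 0
  | f, y :: w => f (⁅z, y⁆ :: w) + adWord z (fun w' => f (y :: w')) w

theorem adWord_congr (z : g) {f f' : List g → ℂ} (w : List g)
    (h : ∀ w', w'.length = w.length → f w' = f' w') : adWord z f w = adWord z f' w := by
  induction w generalizing f f' with
  | nil => rfl
  | cons y w ih =>
    rw [adWord, adWord, h (⁅z, y⁆ :: w) rfl, ih fun w' hw' => h _ (by simp [hw'])]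

theorem adWord_add (z : g) (f f' : List g → ℂ) (w : List g) :
    adWord z (fun w => f w + f' w) w = adWord z f w + adWord z f' w := by
  induction w generalizing f f' with
  | nil => simp [adWord]
  | cons y w ih => rw [adWord, adWord, adWord, ih]; ring

theorem adWord_smul (z : g) (c : ℂ) (f : List g → ℂ) (w : List g) :
    adWord z (fun w => c * f w) w = c * adWord z f w := by
  induction w generalizing f with
  | nil => simp [adWord]
  | cons y w ih => rw [adWord, adWord, ih]; ring

theorem adWord_sub (z : g) (f f' : List g → ℂ) (w : List g) :
    adWord z (fun w => f w - f' w) w = adWord z f w - adWord z f' w := by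
  induction w generalizing f f' with
  | nil => simp [adWord]
  | cons y w ih => rw [adWord, adWord, adWord, ih]; ring

theorem adWord_append (z : g) (f : List g → ℂ) (u w : List g) :
    adWord z f (u ++ w) = adWord z (fun u' => f (u' ++ w)) u + adWord z (fun w' => f (u ++ w')) w := by
  induction u generalizing f with
  | nil => simp [adWord]
  | cons y u ih =>
    rw [List.cons_append, adWord, adWord, ih]
    simp only [List.cons_append]; ring

variable [LieAlgebra ℂ g]

/-- The function `f` on words of length `n` is linear in every letter. -/
def LetterLinear (n : ℕ) (f : List g → ℂ) : Prop :=
  ∀ u w : List g, u.length + 1 + w.length = n → IsLinearMap ℂ fun x => f (u ++ x :: w)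

theorem LetterLinear.cons {n : ℕ} {f : List g → ℂ} (hf : LetterLinear (n + 1) f) (y : g) :
    LetterLinear n fun w => f (y :: w) := fun u w h => hf (y :: u) w (by simp; omega)

theorem LetterLinear.adWord_left {n : ℕ} {f : List g → ℂ} (hf : LetterLinear n f)
    (w : List g) (hw : w.length = n) : IsLinearMap ℂ fun z => adWord z f w := by
  induction w generalizing f n with
  | nil => exact ⟨fun _ _ => by simp [adWord], fun _ _ => by simp [adWord]⟩
  | cons y w ih =>
    subst hw
    have h1 := hf [] w (by simp; omega)
    have h2 := ih (hf.cons y) rfl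
    refine ⟨fun a b => ?_, fun c a => ?_⟩
    · have := h1.map_add ⁅a, y⁆ ⁅b, y⁆
      simp only [List.nil_append] at this
      simp only [adWord, add_lie, this, h2.map_add]; ring
    · have := h1.map_smul c ⁅a, y⁆
      simp only [List.nil_append] at this
      simp only [adWord, smul_lie, this, h2.map_smul, smul_eq_mul]; ring

theorem LetterLinear.adWord {n : ℕ} {f : List g → ℂ} (hf : LetterLinear n f) (z : g) :
    LetterLinear n (adWord z f) := by
  intro u w h
  have h1 := hf u w h
  have e : ∀ x, DiffOpRep.adWord z f (u ++ x :: w) =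
      DiffOpRep.adWord z (fun u' => f (u' ++ x :: w)) u + (f (u ++ ⁅z, x⁆ :: w) +
        DiffOpRep.adWord z (fun w' => f (u ++ x :: w')) w) := fun x => by
    rw [adWord_append]; rfl
  refine ⟨fun a b => ?_, fun c a => ?_⟩
  · have h2 := h1.map_add ⁅z, a⁆ ⁅z, b⁆
    simp only [e]
    rw [lie_add, h2, adWord_congr z u (f' := fun u' => f (u' ++ a :: w) + f (u' ++ b :: w)),
      adWord_congr z w (f' := fun w' => f (u ++ a :: w') + f (u ++ b :: w')), adWord_add, adWord_add]
    · ring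
    · exact fun w' hw' => (hf u w' (by omega)).map_add a b
    · exact fun u' hu' => (hf u' w (by omega)).map_add a b
  · have h2 := h1.map_smul c ⁅z, a⁆
    simp only [e]
    rw [lie_smul, h2, adWord_congr z u (f' := fun u' => c * f (u' ++ a :: w)),
      adWord_congr z w (f' := fun w' => c * f (u ++ a :: w')), adWord_smul, adWord_smul]
    · simp only [smul_eq_mul]; ring
    · exact fun w' hw' => (hf u w' (by omega)).map_smul c a
    · exact fun u' hu' => (hf u' w (by omega)).map_smul c a

/-- Terms in which x and y hit different letters cancel; on a common letter the Jacobi identity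
applies. Functions are acted on contragrediently, whence the order ⁅y, x⁆. -/
theorem adWord_comm {n : ℕ} {f : List g → ℂ} (hf : LetterLinear n f) (x y : g) (w : List g)
    (hw : w.length = n) :
    adWord x (adWord y f) w - adWord y (adWord x f) w = adWord ⁅y, x⁆ f w := by
  induction w generalizing f n with
  | nil => simp [adWord]
  | cons a w ih =>
    subst hw
    have h1 := hf [] w (by simp; omega)
    have h2 := ih (hf.cons a) rfl
    have h3 := h1.map_sub ⁅y, ⁅x, a⁆⁆ ⁅x, ⁅y, a⁆⁆
    have h4 : ⁅y, ⁅x, a⁆⁆ - ⁅x, ⁅y, a⁆⁆ = ⁅⁅y, x⁆, a⁆ := by rw [lie_lie]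
    rw [h4] at h3
    simp only [List.nil_append] at h3
    simp only [adWord, adWord_add] at h2 ⊢
    rw [h3]
    linear_combination h2

variable (p : g →ₗ[ℂ] ℂ) (q : g →ₗ[ℂ] g)

/-- Auxiliary function for `hwWord`, with a bound for the length of the word. -/
def hwWordAux : ℕ → List g → ℂ
  | 0, _ => 1
  | _ + 1, [] => 1
  | n + 1, y :: w => p y * hwWordAux n w + adWord (q y) (hwWordAux n) w

/-- The functional on words with `F(∅) = 1` and `F(y w) = p(y) F(w) + F(q(y) · w)`, where `q(y)`
acts by the adjoint action on the letters. -/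
def hwWord (w : List g) : ℂ := hwWordAux p q w.length w

theorem hwWord_nil : hwWord p q [] = 1 := rfl

/-- The recursion imitates the coefficient of a highest weight vector v in y w v: the negative part
of y contributes nothing, its degree zero part contributes the scalar p(y), and its positive part
q(y), which kills v, acts on w as a derivation. -/
theorem hwWord_cons (y : g) (w : List g) :
    hwWord p q (y :: w) = p y * hwWord p q w + adWord (q y) (hwWord p q) w := by
  rw [hwWord, List.length_cons, hwWordAux]
  congr 1
  exact adWord_congr _ _ fun w' hw' => by rw [hwWord, hw']

theorem letterLinear_hwWord (n : ℕ) : LetterLinear n (hwWord p q) := by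
  induction n with
  | zero => intro u w h; omega
  | succ n ih =>
    intro u w h
    rcases u with _ | ⟨z, u⟩
    · have h1 := ih.adWord_left w (by simpa [add_comm] using h)
      refine ⟨fun a b => ?_, fun c a => ?_⟩
      · simp only [List.nil_append, hwWord_cons, map_add, h1.map_add]; ring
      · simp only [List.nil_append, hwWord_cons, map_smul, h1.map_smul, smul_eq_mul]; ring
    · have hl : u.length + 1 + w.length = n := by simp at h; omega
      have h1 := ih u w hl
      have h2 := ih.adWord (q z) u w hl
      refine ⟨fun a b => ?_, fun c a => ?_⟩
      · simp only [List.cons_append, hwWord_cons, h1.map_add, h2.map_add]; ring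
      · simp only [List.cons_append, hwWord_cons, h1.map_smul, h2.map_smul, smul_eq_mul]; ring

/-- This makes the functional descend to the enveloping algebra. Induction on the prefix: for the
empty prefix, expanding the recursion twice leaves exactly `h0`, `hq` and `adWord_comm`; for a
longer prefix the derivation ad (q z) is spread over all letters, and the terms hitting x and y
recombine by the Leibniz rule. For the projection q onto a subalgebra along a complementary
subalgebra, `hq` holds automatically. -/
theorem hwWord_swap (h0 : ∀ x y, p ⁅q y, x⁆ - p ⁅q x, y⁆ = p ⁅y, x⁆)
    (hq : ∀ x y, q ⁅q y, x⁆ - q ⁅q x, y⁆ - ⁅q y, q x⁆ = q ⁅y, x⁆) (u : List g) (x y : g)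
    (w : List g) :
    hwWord p q (u ++ x :: y :: w) - hwWord p q (u ++ y :: x :: w) =
      hwWord p q (u ++ ⁅x, y⁆ :: w) := by
  set F := hwWord p q with hF
  have hlin := letterLinear_hwWord p q
  rw [← hF] at hlin
  induction hn : u.length generalizing u x y w with
  | zero =>
    obtain rfl := List.length_eq_zero_iff.1 hn
    have c := adWord_comm (hlin _) (q x) (q y) w rfl
    have l := (hlin _).adWord_left w rfl
    have c1 := hq y x
    have c2 : adWord (q ⁅q x, y⁆) F w - adWord (q ⁅q y, x⁆) F w - adWord ⁅q x, q y⁆ F w =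
        adWord (q ⁅x, y⁆) F w := by rw [← c1, l.map_sub, l.map_sub]
    have c3 : adWord ⁅q y, q x⁆ F w = - adWord ⁅q x, q y⁆ F w := by
      rw [← lie_skew, l.map_neg]
    have c4 := h0 y x
    have e : ∀ x y, F (x :: y :: w) = p x * (p y * F w + adWord (q y) F w) +
        (p ⁅q x, y⁆ * F w + adWord (q ⁅q x, y⁆) F w + (p y * adWord (q x) F w +
          adWord (q x) (adWord (q y) F) w)) := fun x y => by
      rw [hF, hwWord_cons, adWord, hwWord_cons, hwWord_cons, ← hF]
      congr 2
      rw [← adWord_smul, ← adWord_add]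
      exact adWord_congr _ _ fun w' _ => hwWord_cons p q y w'
    simp only [List.nil_append]
    rw [e, e, hF, hwWord_cons, ← hF, ← c2, ← c4]
    linear_combination c + c3
  | succ n ih =>
    rcases u with _ | ⟨z, u⟩
    · simp at hn
    have hu : u.length = n := by simpa using hn
    have e : ∀ x y w, adWord (q z) F (u ++ x :: y :: w) =
        adWord (q z) (fun u' => F (u' ++ x :: y :: w)) u + (F (u ++ ⁅q z, x⁆ :: y :: w) +
          (F (u ++ x :: ⁅q z, y⁆ :: w) + adWord (q z) (fun w' => F (u ++ x :: y :: w')) w)) :=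
      fun x y w => by rw [adWord_append]; rfl
    have e' : ∀ x w, adWord (q z) F (u ++ x :: w) =
        adWord (q z) (fun u' => F (u' ++ x :: w)) u + (F (u ++ ⁅q z, x⁆ :: w) +
          adWord (q z) (fun w' => F (u ++ x :: w')) w) :=
      fun x w => by rw [adWord_append]; rfl
    simp only [List.cons_append]
    rw [hF, hwWord_cons, hwWord_cons, hwWord_cons, ← hF, e, e, e']
    have a1 := ih u x y w hu
    have a2 : adWord (q z) (fun u' => F (u' ++ x :: y :: w)) u -
        adWord (q z) (fun u' => F (u' ++ y :: x :: w)) u =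
        adWord (q z) (fun u' => F (u' ++ ⁅x, y⁆ :: w)) u := by
      rw [← adWord_sub]
      exact adWord_congr _ _ fun u' hu' => ih u' x y w (hu'.trans hu)
    have a3 : adWord (q z) (fun w' => F (u ++ x :: y :: w')) w -
        adWord (q z) (fun w' => F (u ++ y :: x :: w')) w =
        adWord (q z) (fun w' => F (u ++ ⁅x, y⁆ :: w')) w := by
      rw [← adWord_sub]
      exact adWord_congr _ _ fun w' _ => ih u x y w' hu
    have a4 := ih u ⁅q z, x⁆ y w hu
    have a5 := ih u x ⁅q z, y⁆ w hu
    have a6 := (hlin _ u w rfl).map_add ⁅⁅q z, x⁆, y⁆ ⁅x, ⁅q z, y⁆⁆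
    rw [← leibniz_lie] at a6
    linear_combination p z * a1 + a2 + a3 + a4 + a5 - a6

/-- Each derivation met in the recursion sends the last letter to an element of b on which p
vanishes, so by induction these terms drop out and the last letter only contributes its own value
p(x). -/
theorem hwWord_append_singleton {b : Set g} (hb : ∀ z, ∀ x ∈ b, ⁅q z, x⁆ ∈ b ∧ p ⁅q z, x⁆ = 0)
    (u : List g) {x : g} (hx : x ∈ b) :
    hwWord p q (u ++ [x]) = p x * hwWord p q u := by
  induction hn : u.length generalizing u x with
  | zero =>
    obtain rfl := List.length_eq_zero_iff.1 hn
    simp [hwWord_cons, hwWord_nil, adWord]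
  | succ n ih =>
    rcases u with _ | ⟨z, u⟩
    · simp at hn
    have hu : u.length = n := by simpa using hn
    obtain ⟨h1, h2⟩ := hb z x hx
    rw [List.cons_append, hwWord_cons, ih u hx hu, adWord_append, adWord,
      ih u h1 hu, h2, adWord, zero_mul, zero_add, add_zero, hwWord_cons,
      adWord_congr _ _ (fun u' hu' => ih u' hx (hu'.trans hu)), adWord_smul]
    ring

end Words

/-! ### The dual of the enveloping algebra, realized on words -/

section WordModule

variable (g : Type*) [LieRing g] [LieAlgebra ℂ g]

/-- The functions on words which are linear in every letter and which are compatible with the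
bracket, that is, the linear functionals on the universal enveloping algebra. -/
def wordDual : Submodule ℂ (List g → ℂ) where
  carrier := {f | (∀ u w, IsLinearMap ℂ fun x => f (u ++ x :: w)) ∧
    ∀ u x y w, f (u ++ x :: y :: w) - f (u ++ y :: x :: w) = f (u ++ ⁅x, y⁆ :: w)}
  add_mem' := by
    rintro f f' ⟨h1, h2⟩ ⟨h3, h4⟩
    refine ⟨fun u w => ⟨fun a b => ?_, fun c a => ?_⟩, fun u x y w => ?_⟩
    · simp only [Pi.add_apply, (h1 u w).map_add, (h3 u w).map_add]; ring
    · simp only [Pi.add_apply, (h1 u w).map_smul, (h3 u w).map_smul, smul_add]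
    · simp only [Pi.add_apply, ← h2, ← h4]; ring
  zero_mem' := ⟨fun _ _ => ⟨fun _ _ => by simp, fun _ _ => by simp⟩, fun _ _ _ _ => by simp⟩
  smul_mem' := by
    rintro c f ⟨h1, h2⟩
    refine ⟨fun u w => ⟨fun a b => ?_, fun d a => ?_⟩, fun u x y w => ?_⟩
    · simp only [Pi.smul_apply, (h1 u w).map_add, smul_add]
    · simp only [Pi.smul_apply, (h1 u w).map_smul, smul_comm c d]
    · simp only [Pi.smul_apply, ← h2, smul_sub]

variable {g}

/-- Right translation by a letter. -/
def wordShift (x : g) : Module.End ℂ (wordDual g) where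
  toFun f := ⟨fun w => f.1 (w ++ [x]), by
    refine ⟨fun u w => ?_, fun u a b w => ?_⟩
    · simpa using f.2.1 u (w ++ [x])
    · simpa using f.2.2 u a b (w ++ [x])⟩
  map_add' _ _ := rfl
  map_smul' _ _ := rfl

theorem wordShift_apply (x : g) (f : wordDual g) (w : List g) :
    (wordShift x f).1 w = f.1 (w ++ [x]) := rfl

/-- The representation on functionals by right translations. -/
def wordRep : g →ₗ⁅ℂ⁆ Module.End ℂ (wordDual g) where
  toFun := wordShift
  map_add' x y := LinearMap.ext fun f => Subtype.ext <| funext fun w => (f.2.1 w []).map_add x y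
  map_smul' c x := LinearMap.ext fun f => Subtype.ext <| funext fun w => (f.2.1 w []).map_smul c x
  map_lie' {x y} := LinearMap.ext fun f => Subtype.ext <| funext fun w => by
    rw [wordShift_apply, ← f.2.2 w x y [], LieRing.of_associative_ring_bracket,
      LinearMap.sub_apply, Module.End.mul_apply, Module.End.mul_apply]
    change _ = (wordShift x (wordShift y f)).1 w - (wordShift y (wordShift x f)).1 w
    simp only [wordShift_apply, List.append_assoc, List.cons_append, List.nil_append]

/-- If `p : g → ℂ` and `q : g → g` behave like a character of `g_0` and the projection to `g_+`,
then there is a representation of `g` with a nonzero highest weight vector. -/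
theorem exists_highestWeightVector (p : g →ₗ[ℂ] ℂ) (q : g →ₗ[ℂ] g) (b : Set g)
    (h0 : ∀ x y, p ⁅q y, x⁆ - p ⁅q x, y⁆ = p ⁅y, x⁆)
    (hq : ∀ x y, q ⁅q y, x⁆ - q ⁅q x, y⁆ - ⁅q y, q x⁆ = q ⁅y, x⁆)
    (hb : ∀ z, ∀ x ∈ b, ⁅q z, x⁆ ∈ b ∧ p ⁅q z, x⁆ = 0) :
    ∃ F : wordDual g, F ≠ 0 ∧ ∀ x ∈ b, wordRep x F = p x • F := by
  refine ⟨⟨hwWord p q, fun u w => letterLinear_hwWord p q _ u w rfl, hwWord_swap p q h0 hq⟩,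
    fun h => ?_, fun x hx => Subtype.ext <| funext fun w => ?_⟩
  · have := congrFun (congrArg Subtype.val h) []
    simp [hwWord_nil] at this
  · exact hwWord_append_singleton p q hb w hx

end WordModule

/-! ### Graded subspaces -/

section Graded

variable {M M' : Type*} [AddCommGroup M] [Module ℂ M] [AddCommGroup M'] [Module ℂ M']

/-- The sum also decomposes inside P; independence forces the two decompositions to agree. -/
theorem mem_of_sum_mem_graded {V : ℤ → Submodule ℂ M} (hV : iSupIndep V) {P : Submodule ℂ M}
    (hP : P ≤ ⨆ j, P ⊓ V j) {s : Finset ℤ} {w : ℤ → M} (hw : ∀ i ∈ s, w i ∈ V i)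
    (hs : ∑ i ∈ s, w i ∈ P) : ∀ i ∈ s, w i ∈ P := by
  classical
  obtain ⟨f, hf, hfs⟩ := (Submodule.mem_iSup_iff_exists_finsupp _ _).1 (hP hs)
  have h1 : ∑ i ∈ s ∪ f.support, (if i ∈ s then w i else 0) = ∑ i ∈ s ∪ f.support, f i := by
    rw [← Finset.sum_subset (Finset.subset_union_right (s₁ := s) (s₂ := f.support))
      (fun i _ hi => Finsupp.notMem_support_iff.1 hi), show ∑ i ∈ f.support, f i = _ from hfs,
      Finset.sum_ite_mem, Finset.inter_eq_right.2 Finset.subset_union_left]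
  have h2 := (iSupIndep_iff_finsetSum_eq_imp_eq V).1 hV _ _ _ (fun i _ => ⟨?_, (hf i).2⟩) h1
  · intro i hi
    have := h2 i (Finset.mem_union_left _ hi)
    rw [if_pos hi] at this
    rw [this]; exact (hf i).1
  · split_ifs with h
    · exact hw i h
    · exact zero_mem _

theorem comap_graded {V : ℤ → Submodule ℂ M} {V' : ℤ → Submodule ℂ M'} (hV : ⨆ j, V j = ⊤)
    (hV' : iSupIndep V') (f : M →ₗ[ℂ] M') (hf : ∀ j, ∀ x ∈ V j, f x ∈ V' j)
    {P : Submodule ℂ M'} (hP : P ≤ ⨆ j, P ⊓ V' j) : P.comap f ≤ ⨆ j, P.comap f ⊓ V j := by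
  intro x hx
  obtain ⟨c, hc, rfl⟩ := (Submodule.mem_iSup_iff_exists_finsupp V x).1 (hV ▸ Submodule.mem_top)
  rw [Submodule.mem_comap, Finsupp.sum, map_sum] at hx
  have h1 := mem_of_sum_mem_graded hV' hP (fun i _ => hf i _ (hc i)) hx
  exact Submodule.sum_mem _ fun i hi => Submodule.mem_iSup_of_mem i ⟨h1 i hi, hc i⟩

end Graded

/-! ### Verma modules, their degrees, and recognition of the irreducible quotient -/

section HighestWeightTheory

variable {g : Type*} [LieRing g] [LieAlgebra ℂ g]

/-- A gradation of a Lie algebra: a spanning family of subspaces compatible with the bracket. -/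
structure IsLieGrading (gr : ℤ → Submodule ℂ g) : Prop where
  lie_mem : ∀ {i j : ℤ} {x y : g}, x ∈ gr i → y ∈ gr j → ⁅x, y⁆ ∈ gr (i + j)
  iSup_eq_top : ⨆ i, gr i = ⊤

local notation "ιU" => UniversalEnvelopingAlgebra.ι ℂ

/-- The elements of U(g) preserving P form a subalgebra A containing g. The universal property gives
a map U(g) → A whose composite with the inclusion is the identity on generators, so A is everything.
-/
theorem smul_mem_of_ι_smul_mem {M : Type*} [AddCommGroup M] [Module ℂ M]
    [Module (UniversalEnvelopingAlgebra ℂ g) M]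
    [IsScalarTower ℂ (UniversalEnvelopingAlgebra ℂ g) M] {P : Submodule ℂ M}
    (hP : ∀ x : g, ∀ w ∈ P, ιU x • w ∈ P) (u : UniversalEnvelopingAlgebra ℂ g) {w : M}
    (hw : w ∈ P) : u • w ∈ P := by
  let A : Subalgebra ℂ (UniversalEnvelopingAlgebra ℂ g) :=
    { carrier := {u | ∀ w ∈ P, u • w ∈ P}
      mul_mem' := fun ha hb w hw => by rw [mul_smul]; exact ha _ (hb _ hw)
      add_mem' := fun ha hb w hw => by rw [add_smul]; exact add_mem (ha _ hw) (hb _ hw)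
      algebraMap_mem' := fun c w hw => by rw [algebraMap_smul]; exact P.smul_mem c hw }
  let f : g →ₗ⁅ℂ⁆ A :=
    { toFun := fun x => ⟨ιU x, hP x⟩
      map_add' := fun x y => Subtype.ext (map_add _ x y)
      map_smul' := fun c x => Subtype.ext (map_smul _ c x)
      map_lie' := fun {x y} => Subtype.ext (LieHom.map_lie _ x y) }
  have h : A.val.comp (UniversalEnvelopingAlgebra.lift ℂ f) = AlgHom.id ℂ _ := by
    apply UniversalEnvelopingAlgebra.hom_ext
    ext x
    change ((UniversalEnvelopingAlgebra.lift ℂ f (ιU x) : A) : UniversalEnvelopingAlgebra ℂ g) = _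
    rw [UniversalEnvelopingAlgebra.lift_ι_apply]
    rfl
  have h2 := (UniversalEnvelopingAlgebra.lift ℂ f u).2 w hw
  rwa [show ((UniversalEnvelopingAlgebra.lift ℂ f u : A) : UniversalEnvelopingAlgebra ℂ g) = u
    from DFunLike.congr_fun h u] at h2

theorem ι_lie_smul {M : Type*} [AddCommGroup M]
    [Module (UniversalEnvelopingAlgebra ℂ g) M] (x y : g) (w : M) :
    ιU ⁅x, y⁆ • w = ιU x • ιU y • w - ιU y • ιU x • w := by
  rw [LieHom.map_lie, LieRing.of_associative_ring_bracket, sub_smul, mul_smul, mul_smul]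

theorem IsLieGrading.ι_smul_mem {gr : ℤ → Submodule ℂ g} (hg : IsLieGrading gr)
    {M : Type*} [AddCommGroup M] [Module ℂ M]
    [Module (UniversalEnvelopingAlgebra ℂ g) M]
    [IsScalarTower ℂ (UniversalEnvelopingAlgebra ℂ g) M] {P : Submodule ℂ M} {w : M}
    (h : ∀ k, ∀ x ∈ gr k, ιU x • w ∈ P) (x : g) : ιU x • w ∈ P := by
  have hx : x ∈ ⨆ i, gr i := hg.iSup_eq_top ▸ Submodule.mem_top
  refine Submodule.iSup_induction _ (motive := fun x => ιU x • w ∈ P) hx h ?_ ?_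
  · simp
  · intro a b ha hb
    rw [map_add, add_smul]; exact add_mem ha hb

variable (gr : ℤ → Submodule ℂ g) (Λ : Module.Dual ℂ (gr 0))

/-- The highest weight vector of the Verma module. -/
def Verma.hwv : Verma gr Λ := Submodule.Quotient.mk 1

variable {gr Λ}

namespace Verma

theorem mk_eq_smul_hwv (u : UniversalEnvelopingAlgebra ℂ g) :
    (Submodule.Quotient.mk u : Verma gr Λ) = u • hwv gr Λ := by
  rw [hwv, ← Submodule.Quotient.mk_smul, smul_eq_mul, mul_one]

theorem ι_smul_hwv_pos {k : ℤ} (hk : 0 < k) {x : g} (hx : x ∈ gr k) : ιU x • hwv gr Λ = 0 := by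
  rw [← mk_eq_smul_hwv, Submodule.Quotient.mk_eq_zero]
  exact Submodule.subset_span (Or.inl ⟨k, hk, x, hx, rfl⟩)

theorem ι_smul_hwv_zero (h : gr 0) : ιU (h : g) • hwv gr Λ = Λ h • hwv gr Λ := by
  rw [← sub_eq_zero, ← algebraMap_smul (UniversalEnvelopingAlgebra ℂ g) (Λ h), ← sub_smul,
    ← mk_eq_smul_hwv, Submodule.Quotient.mk_eq_zero]
  exact Submodule.subset_span (Or.inr ⟨h, rfl⟩)

theorem hwv_mem_degree : hwv gr Λ ∈ degree gr Λ 0 :=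
  Submodule.subset_span ⟨[], by simp, by simp, by simp [hwv]⟩

theorem ι_smul_mem_degree {k j : ℤ} {x : g} (hx : x ∈ gr k) {w : Verma gr Λ}
    (hw : w ∈ degree gr Λ j) : ιU x • w ∈ degree gr Λ (j + k) := by
  induction hw using Submodule.span_induction with
  | mem w h =>
    obtain ⟨l, h1, h2, rfl⟩ := h
    refine Submodule.subset_span ⟨(k, x) :: l, ?_, ?_, ?_⟩
    · intro p hp
      rcases List.mem_cons.1 hp with rfl | hp
      · exact hx
      · exact h1 p hp
    · simp [h2, add_comm]
    · rw [← Submodule.Quotient.mk_smul, smul_eq_mul]; simp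
  | zero => simp
  | add a b _ _ ha hb => rw [smul_add]; exact add_mem ha hb
  | smul c a _ ha => rw [smul_comm]; exact Submodule.smul_mem _ c ha

theorem iSup_degree (hg : IsLieGrading gr) : ⨆ j, degree gr Λ j = ⊤ := by
  rw [eq_top_iff]
  rintro w -
  obtain ⟨u, rfl⟩ := Submodule.Quotient.mk_surjective _ w
  rw [mk_eq_smul_hwv]
  refine smul_mem_of_ι_smul_mem (fun x w hw => ?_) u (Submodule.mem_iSup_of_mem 0 hwv_mem_degree)
  refine hg.ι_smul_mem (fun k x hx => ?_) x
  refine Submodule.iSup_induction _ (motive := fun w => ιU x • w ∈ ⨆ j, degree gr Λ j) hw ?_ ?_ ?_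
  · intro j w hw
    exact Submodule.mem_iSup_of_mem _ (ι_smul_mem_degree hx hw)
  · simp
  · intro a b ha hb
    rw [smul_add]; exact add_mem ha hb

variable (gr Λ) in
/-- The span of the vectors of degree `j` obtained by applying elements of negative degree. -/
def negSpan (j : ℤ) : Submodule ℂ (Verma gr Λ) :=
  Submodule.span ℂ {v | ∃ l : List (ℤ × g), (∀ p ∈ l, p.1 < 0 ∧ p.2 ∈ gr p.1) ∧
    (l.map Prod.fst).sum = j ∧
    v = Submodule.Quotient.mk ((l.map fun p => UniversalEnvelopingAlgebra.ι ℂ p.2).prod)}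

theorem ι_smul_mem_negSpan_of_neg {k j : ℤ} (hk : k < 0) {x : g} (hx : x ∈ gr k) {w : Verma gr Λ}
    (hw : w ∈ negSpan gr Λ j) : ιU x • w ∈ negSpan gr Λ (j + k) := by
  induction hw using Submodule.span_induction with
  | mem w h =>
    obtain ⟨l, h1, h2, rfl⟩ := h
    refine Submodule.subset_span ⟨(k, x) :: l, ?_, ?_, ?_⟩
    · intro p hp
      rcases List.mem_cons.1 hp with rfl | hp
      · exact ⟨hk, hx⟩
      · exact h1 p hp
    · simp [h2, add_comm]
    · rw [← Submodule.Quotient.mk_smul, smul_eq_mul]; simp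
  | zero => simp
  | add a b _ _ ha hb => rw [smul_add]; exact add_mem ha hb
  | smul c a _ ha => rw [smul_comm]; exact Submodule.smul_mem _ c ha

theorem hwv_mem_negSpan : hwv gr Λ ∈ negSpan gr Λ 0 :=
  Submodule.subset_span ⟨[], by simp, by simp, by simp [hwv]⟩

/-- Straightening: the letter x is commuted to the right past the negative letters until it reaches
the highest weight vector, where degree zero acts by a scalar and positive degree by zero. The
commutators have new degrees, so the induction runs over all k and x. -/
theorem ι_smul_word_mem_negSpan (hg : IsLieGrading gr) (l : List (ℤ × g))
    (hl : ∀ p ∈ l, p.1 < 0 ∧ p.2 ∈ gr p.1) {k : ℤ} {x : g} (hx : x ∈ gr k) :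
    ιU x • (Submodule.Quotient.mk ((l.map fun p => UniversalEnvelopingAlgebra.ι ℂ p.2).prod) :
      Verma gr Λ) ∈ negSpan gr Λ ((l.map Prod.fst).sum + k) := by
  induction l generalizing k x with
  | nil =>
    rw [mk_eq_smul_hwv]
    simp only [List.map_nil, List.prod_nil, one_smul, List.sum_nil, zero_add]
    rcases lt_trichotomy k 0 with h | rfl | h
    · simpa using ι_smul_mem_negSpan_of_neg h hx (hwv_mem_negSpan (gr := gr) (Λ := Λ))
    · rw [ι_smul_hwv_zero ⟨x, hx⟩]
      exact Submodule.smul_mem _ _ hwv_mem_negSpan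
    · rw [ι_smul_hwv_pos h hx]; exact zero_mem _
  | cons p l ih =>
    have hl' : ∀ p ∈ l, p.1 < 0 ∧ p.2 ∈ gr p.1 := fun q hq => hl q (List.mem_cons_of_mem _ hq)
    obtain ⟨hp1, hp2⟩ := hl p List.mem_cons_self
    simp only [List.map_cons, List.prod_cons, List.sum_cons]
    rw [← smul_eq_mul, Submodule.Quotient.mk_smul]
    rw [← sub_add_cancel (ιU x • ιU p.2 • _) (ιU p.2 • ιU x • _), ← ι_lie_smul]
    refine add_mem ?_ ?_
    · have := ih hl' (hg.lie_mem hx hp2)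
      rwa [show p.1 + (l.map Prod.fst).sum + k = (l.map Prod.fst).sum + (k + p.1) by ring]
    · have := ι_smul_mem_negSpan_of_neg hp1 hp2 (ih hl' hx)
      rwa [show p.1 + (l.map Prod.fst).sum + k = (l.map Prod.fst).sum + k + p.1 by ring]

theorem degree_le_negSpan (hg : IsLieGrading gr) (j : ℤ) : degree gr Λ j ≤ negSpan gr Λ j := by
  refine Submodule.span_le.2 ?_
  rintro _ ⟨l, hl, rfl, rfl⟩
  induction l with
  | nil => exact hwv_mem_negSpan
  | cons p l ih =>
    have h1 := ih fun q hq => hl q (List.mem_cons_of_mem _ hq)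
    have hp := hl p List.mem_cons_self
    simp only [List.map_cons, List.prod_cons, List.sum_cons]
    rw [← smul_eq_mul, Submodule.Quotient.mk_smul, add_comm]
    generalize (Submodule.Quotient.mk _ : Verma gr Λ) = w at h1
    generalize (l.map Prod.fst).sum = j at h1
    induction h1 using Submodule.span_induction with
    | mem w h =>
      obtain ⟨l', h1, rfl, rfl⟩ := h
      exact ι_smul_word_mem_negSpan hg l' h1 hp
    | zero => simp
    | add a b _ _ ha hb =>
      simp only [smul_add]; exact add_mem ha hb
    | smul c a _ ha => 
      have : ιU p.2 • c • a = c • ιU p.2 • a := smul_comm _ _ _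
      simp only [this]
      exact Submodule.smul_mem _ c ha

/-- After straightening, only the empty word has degree zero, since all letters have negative
degree. -/
theorem degree_zero_le (hg : IsLieGrading gr) : degree gr Λ 0 ≤ Submodule.span ℂ {hwv gr Λ} := by
  refine (degree_le_negSpan hg 0).trans (Submodule.span_le.2 ?_)
  rintro _ ⟨l, hl, h0, rfl⟩
  rcases l with _ | ⟨p, l⟩
  · exact Submodule.subset_span rfl
  · exfalso
    have h1 : ∀ l : List (ℤ × g), (∀ q ∈ l, q.1 < 0 ∧ q.2 ∈ gr q.1) → (l.map Prod.fst).sum ≤ 0 := by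
      intro l
      induction l with
      | nil => simp
      | cons q l ih =>
        intro h
        have := ih fun r hr => h r (List.mem_cons_of_mem _ hr)
        have := (h q List.mem_cons_self).1
        simp only [List.map_cons, List.sum_cons]; omega
    replace h1 := h1 l fun q hq => hl q (List.mem_cons_of_mem _ hq)
    have h2 := (hl p List.mem_cons_self).1
    simp at h0
    omega

theorem eq_top_of_hwv_mem {N : Submodule (UniversalEnvelopingAlgebra ℂ g) (Verma gr Λ)}
    (h : hwv gr Λ ∈ N) : N = ⊤ := by
  rw [eq_top_iff]
  rintro w -
  obtain ⟨u, rfl⟩ := Submodule.Quotient.mk_surjective _ w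
  rw [mk_eq_smul_hwv]
  exact N.smul_mem u h

/-- A nonzero element of degree zero is a multiple of the generator, hence cannot lie in a proper
submodule. The bound passes to sums, so it also controls the maximal graded submodule. -/
theorem IsGraded.le_of_ne_top (hg : IsLieGrading gr)
    {N : Submodule (UniversalEnvelopingAlgebra ℂ g) (Verma gr Λ)} (hN : IsGraded N) (h : N ≠ ⊤) :
    N.restrictScalars ℂ ≤ ⨆ (j) (_ : j ≠ 0), degree gr Λ j := by
  refine hN.trans (iSup_le fun j => ?_)
  by_cases hj : j = 0
  · subst hj
    rintro w ⟨hw, hw0⟩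
    obtain ⟨c, rfl⟩ := Submodule.mem_span_singleton.1 (degree_zero_le hg hw0)
    by_cases hc : c = 0
    · simp [hc]
    · exfalso
      apply h
      apply eq_top_of_hwv_mem
      have := (N.restrictScalars ℂ).smul_mem c⁻¹ hw
      rwa [smul_smul, inv_mul_cancel₀ hc, one_smul] at this
  · exact inf_le_right.trans (le_iSup₂_of_le j hj le_rfl)

theorem isGraded_maxSubmodule : IsGraded (maxSubmodule gr Λ) := by
  rw [IsGraded, maxSubmodule, Submodule.restrictScalars_sSup, sSup_le_iff]
  rintro _ ⟨N, hN, rfl⟩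
  refine hN.2.trans (iSup_mono fun j => inf_le_inf_right _ ?_)
  rw [← Submodule.restrictScalars_sSup]
  exact fun w hw => (le_sSup hN : N ≤ _) hw

theorem maxSubmodule_le (hg : IsLieGrading gr) :
    (maxSubmodule gr Λ).restrictScalars ℂ ≤ ⨆ (j) (_ : j ≠ 0), degree gr Λ j := by
  rw [maxSubmodule, Submodule.restrictScalars_sSup, sSup_le_iff]
  rintro _ ⟨N, hN, rfl⟩
  exact hN.2.le_of_ne_top hg hN.1

theorem hom_mem_of_mem_degree {M : Type*} [AddCommGroup M] [Module ℂ M]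
    [Module (UniversalEnvelopingAlgebra ℂ g) M]
    [IsScalarTower ℂ (UniversalEnvelopingAlgebra ℂ g) M] {V : ℤ → Submodule ℂ M}
    (hV : ∀ {k j : ℤ} {x : g} {w : M}, x ∈ gr k → w ∈ V j → ιU x • w ∈ V (j + k))
    (f : Verma gr Λ →ₗ[UniversalEnvelopingAlgebra ℂ g] M) (h0 : f (hwv gr Λ) ∈ V 0) {j : ℤ}
    {w : Verma gr Λ} (hw : w ∈ degree gr Λ j) : f w ∈ V j := by
  have : degree gr Λ j ≤ (V j).comap (f.restrictScalars ℂ) := by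
    refine Submodule.span_le.2 ?_
    rintro _ ⟨l, hl, rfl, rfl⟩
    clear hw
    change f _ ∈ V _
    induction l with
    | nil => exact h0
    | cons p l ih =>
      simp only [List.map_cons, List.prod_cons, List.sum_cons]
      rw [← smul_eq_mul, Submodule.Quotient.mk_smul, add_comm, map_smul]
      exact hV (hl p List.mem_cons_self) (ih fun q hq => hl q (List.mem_cons_of_mem _ hq))
  exact this hw

end Verma

/-- A graded module which has no nontrivial graded submodules and a highest weight vector of weight
`Λ` is isomorphic to `L(g, Λ)`. -/
theorem IrrHW.exists_equiv (hg : IsLieGrading gr) {M : Type*} [AddCommGroup M] [Module ℂ M]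
    [Module (UniversalEnvelopingAlgebra ℂ g) M]
    [IsScalarTower ℂ (UniversalEnvelopingAlgebra ℂ g) M] {V : ℤ → Submodule ℂ M}
    (hind : iSupIndep V) (hV : ∀ {k j : ℤ} {x : g} {w : M}, x ∈ gr k → w ∈ V j → ιU x • w ∈ V (j + k))
    {v : M} (hv : v ∈ V 0) (hv0 : v ≠ 0)
    (hpos : ∀ {k : ℤ} {x : g}, 0 < k → x ∈ gr k → ιU x • v = 0)
    (hzero : ∀ h : gr 0, ιU (h : g) • v = Λ h • v)
    (hirr : ∀ P : Submodule (UniversalEnvelopingAlgebra ℂ g) M,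
      P.restrictScalars ℂ ≤ ⨆ j, P.restrictScalars ℂ ⊓ V j → P = ⊥ ∨ P = ⊤) :
    ∃ e : M ≃ₗ[UniversalEnvelopingAlgebra ℂ g] IrrHW gr Λ,
      ∀ j, IrrHW.degree gr Λ j ≤ (V j).map (e.toLinearMap.restrictScalars ℂ) := by
  let f : Verma gr Λ →ₗ[UniversalEnvelopingAlgebra ℂ g] M :=
    (vermaIdeal gr Λ).liftQ (LinearMap.toSpanSingleton _ M v) (by
      refine Submodule.span_le.2 ?_
      rintro _ (⟨k, hk, x, hx, rfl⟩ | ⟨h, rfl⟩)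
      · exact hpos hk hx
      · change (_ - _ : UniversalEnvelopingAlgebra ℂ g) • v = 0
        rw [sub_smul, hzero, algebraMap_smul, sub_self])
  have hf : ∀ u, f (u • Verma.hwv gr Λ) = u • v := fun u => by
    rw [← Verma.mk_eq_smul_hwv]; rfl
  have hf1 : f (Verma.hwv gr Λ) = v := by simpa using hf 1
  have hfV : ∀ j, ∀ w ∈ Verma.degree gr Λ j, f w ∈ V j := fun j w hw =>
    Verma.hom_mem_of_mem_degree hV f (hf1 ▸ hv) hw
  have hmap : ∀ {N : Submodule (UniversalEnvelopingAlgebra ℂ g) (Verma gr Λ)}, Verma.IsGraded N →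
      (N.map f).restrictScalars ℂ ≤ ⨆ j, (N.map f).restrictScalars ℂ ⊓ V j := by
    rintro N hN _ ⟨w, hw, rfl⟩
    refine Submodule.iSup_induction _
      (motive := fun w => f w ∈ ⨆ j, (N.map f).restrictScalars ℂ ⊓ V j) (hN hw) ?_ ?_ ?_
    · rintro j w ⟨h1, h2⟩
      exact Submodule.mem_iSup_of_mem j ⟨⟨w, h1, rfl⟩, hfV j w h2⟩
    · simp
    · intro a b ha hb
      rw [map_add]; exact add_mem ha hb
  -- The image is a graded submodule containing v ≠ 0.
  have hsurj : LinearMap.range f = ⊤ := by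
    have hgr : Verma.IsGraded (⊤ : Submodule (UniversalEnvelopingAlgebra ℂ g) (Verma gr Λ)) := by
      rw [Verma.IsGraded]
      simp [Verma.iSup_degree hg]
    rw [← Submodule.map_top]
    refine (hirr _ (hmap hgr)).resolve_left fun h => hv0 ?_
    have : v ∈ Submodule.map f ⊤ := ⟨_, trivial, hf1⟩
    rwa [h, Submodule.mem_bot] at this
  have hker : LinearMap.ker f = Verma.maxSubmodule gr Λ := by
    apply le_antisymm
    -- The kernel is proper because v ≠ 0, and graded as the preimage of zero under a
    -- degree-preserving map.
    · refine le_sSup ⟨fun h => hv0 ?_, ?_⟩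
      · rw [← hf1, ← LinearMap.mem_ker, h]; trivial
      · have := comap_graded (Verma.iSup_degree (Λ := Λ) hg) hind (f.restrictScalars ℂ) hfV
          (P := ⊥) bot_le
        exact this
    -- If a proper graded N had nonzero image, the image would be all of M, and v would be the image
    -- of a sum of elements of nonzero degree; independence of the V j forbids this.
    · refine sSup_le ?_
      rintro N ⟨hN, hN'⟩
      suffices N.map f = ⊥ by
        intro w hw
        have h : f w ∈ N.map f := ⟨w, hw, rfl⟩
        rwa [this, Submodule.mem_bot] at h
      refine (hirr _ (hmap hN')).resolve_right fun h => ?_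
      obtain ⟨w, hw, hwv⟩ : v ∈ N.map f := h ▸ Submodule.mem_top
      have h1 := hN'.le_of_ne_top hg hN hw
      have h2 : f w ∈ ⨆ (j) (_ : j ≠ 0), V j := by
        have : (⨆ (j) (_ : j ≠ 0), Verma.degree gr Λ j) ≤
            (⨆ (j) (_ : j ≠ 0), V j).comap (f.restrictScalars ℂ) :=
          iSup₂_le fun j hj w hw => Submodule.mem_iSup_of_mem j
            (Submodule.mem_iSup_of_mem hj (hfV j w hw))
        exact this h1
      rw [hwv] at h2
      exact hv0 ((Submodule.disjoint_def.1 (hind 0)) v hv h2)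
  let e : IrrHW gr Λ ≃ₗ[UniversalEnvelopingAlgebra ℂ g] M :=
    (Submodule.quotEquivOfEq _ _ hker.symm).trans
      ((f.quotKerEquivRange).trans (LinearEquiv.ofTop _ hsurj))
  refine ⟨e.symm, fun j => ?_⟩
  rintro _ ⟨w, hw, rfl⟩
  refine ⟨f w, hfV j w hw, ?_⟩
  change e.symm (f w) = _
  rw [LinearEquiv.symm_apply_eq]
  rfl

end HighestWeightTheory

/-! ### Nonvanishing, independence of degrees and graded irreducibility -/

section Irreducible

variable {g : Type*} [LieRing g] [LieAlgebra ℂ g]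

local notation "ιU" => UniversalEnvelopingAlgebra.ι ℂ

variable {gr : ℤ → Submodule ℂ g} {Λ : Module.Dual ℂ (gr 0)}

/-- The Verma module is nonzero, if `p` extends `Λ` by zero, and `q` is the projection to the
components of positive degree. -/
theorem Verma.hwv_ne_zero (hg : IsLieGrading gr) {p : g →ₗ[ℂ] ℂ} {q : g →ₗ[ℂ] g}
    (hp0 : ∀ h : gr 0, p h = Λ h) (hp : ∀ {k : ℤ} {x : g}, k ≠ 0 → x ∈ gr k → p x = 0)
    (hpp : ∀ {x y : g}, x ∈ gr 0 → y ∈ gr 0 → p ⁅x, y⁆ = 0)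
    (hq : ∀ {k : ℤ} {x : g}, 0 < k → x ∈ gr k → q x = x)
    (hq0 : ∀ {k : ℤ} {x : g}, k ≤ 0 → x ∈ gr k → q x = 0) : hwv gr Λ ≠ 0 := by
  have ind : ∀ {P : g → Prop}, (∀ k, ∀ x ∈ gr k, P x) → P 0 →
      (∀ a b, P a → P b → P (a + b)) → ∀ x, P x := fun {P} h1 h2 h3 x =>
    Submodule.iSup_induction _ (motive := P) (hg.iSup_eq_top ▸ Submodule.mem_top : x ∈ ⨆ i, gr i) h1 h2 h3
  -- Both bilinear identities are checked on homogeneous elements according to the signs of the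
  -- degrees. The vanishing of p on brackets within degree zero enters only when both degrees are
  -- zero.
  have e0 : ∀ x y, p ⁅q y, x⁆ - p ⁅q x, y⁆ = p ⁅y, x⁆ := by
    refine ind (fun k x hx => ?_) (by simp) fun a b ha hb y => ?_
    · refine ind (fun l y hy => ?_) (by simp) fun a b ha hb => ?_
      · have h1 := hg.lie_mem hx hy
        have h2 := hg.lie_mem hy hx
        have h3 : p ⁅x, y⁆ = - p ⁅y, x⁆ := by rw [← lie_skew, map_neg]
        rcases le_or_gt k 0 with hk | hk <;> rcases le_or_gt l 0 with hl | hl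
        · rw [hq0 hk hx, hq0 hl hy]
          simp only [zero_lie, map_zero, sub_zero]
          by_cases h : l + k = 0
          · obtain rfl : k = 0 := by omega
            obtain rfl : l = 0 := by omega
            rw [hpp hy hx]
          · rw [hp h h2]
        · rw [hq0 hk hx, hq hl hy]; simp
        · rw [hq hk hx, hq0 hl hy]; simp [h3]
        · rw [hq hk hx, hq hl hy, h3, hp (by omega) h2]; simp
      · simp only [map_add, add_lie, lie_add]
        linear_combination ha + hb
    · simp only [map_add, add_lie, lie_add]
      linear_combination ha y + hb y
  have e1 : ∀ x y, q ⁅q y, x⁆ - q ⁅q x, y⁆ - ⁅q y, q x⁆ = q ⁅y, x⁆ := by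
    refine ind (fun k x hx => ?_) (by simp) fun a b ha hb y => ?_
    · refine ind (fun l y hy => ?_) (by simp) fun a b ha hb => ?_
      · have h1 := hg.lie_mem hx hy
        have h2 := hg.lie_mem hy hx
        have h3 : q ⁅x, y⁆ = - q ⁅y, x⁆ := by rw [← lie_skew, map_neg]
        rcases le_or_gt k 0 with hk | hk <;> rcases le_or_gt l 0 with hl | hl
        · rw [hq0 hk hx, hq0 hl hy, hq0 (by omega) h2]; simp
        · rw [hq0 hk hx, hq hl hy]; simp
        · rw [hq hk hx, hq0 hl hy]; simp [h3]
        · rw [hq hk hx, hq hl hy, h3, hq (by omega) h2]; simp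
      · simp only [map_add, add_lie, lie_add]
        refine Eq.trans ?_ (congrArg₂ (· + ·) ha hb)
        abel
    · simp only [map_add, add_lie, lie_add]
      refine Eq.trans ?_ (congrArg₂ (· + ·) (ha y) (hb y))
      abel
  obtain ⟨F, hF, hF'⟩ := exists_highestWeightVector p q
    ((⨆ (k) (_ : 0 ≤ k), gr k : Submodule ℂ g) : Set g) e0 e1 (by
      intro z x hx
      refine ind (P := fun z => ⁅q z, x⁆ ∈ ((⨆ (k) (_ : 0 ≤ k), gr k : Submodule ℂ g) : Set g) ∧
        p ⁅q z, x⁆ = 0) (fun k z hz => ?_) (by simp) (fun a b ha hb => ?_) z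
      · rcases le_or_gt k 0 with hk | hk
        · rw [hq0 hk hz]; simp
        rw [hq hk hz]
        refine Submodule.iSup_induction _ (motive := fun x => ⁅z, x⁆ ∈
          ((⨆ (k) (_ : 0 ≤ k), gr k : Submodule ℂ g) : Set g) ∧ p ⁅z, x⁆ = 0) hx
          (fun l x hx => ?_) (by simp) (fun a b ha hb => ?_)
        · by_cases hl : 0 ≤ l
          · have hx' : x ∈ gr l := by simpa [hl] using hx
            have h1 := hg.lie_mem hz hx'
            exact ⟨Submodule.mem_iSup_of_mem _ (Submodule.mem_iSup_of_mem (by omega) h1),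
              hp (by omega) h1⟩
          · obtain rfl : x = 0 := by simpa [hl] using hx
            simp
        · rw [lie_add, map_add, ha.2, hb.2]
          exact ⟨add_mem ha.1 hb.1, add_zero 0⟩
      · rw [map_add, add_lie, map_add, ha.2, hb.2]
        exact ⟨add_mem ha.1 hb.1, add_zero 0⟩)
  have hb : ∀ {k : ℤ} {x : g}, 0 ≤ k → x ∈ gr k → wordRep x F = p x • F := fun hk hx =>
    hF' _ (Submodule.mem_iSup_of_mem _ (Submodule.mem_iSup_of_mem hk hx))
  let _ : Module (UniversalEnvelopingAlgebra ℂ g) (wordDual g) :=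
    Module.compHom _ (UniversalEnvelopingAlgebra.lift ℂ (wordRep (g := g))).toRingHom
  have hsm : ∀ (u : UniversalEnvelopingAlgebra ℂ g) (f : wordDual g),
      u • f = UniversalEnvelopingAlgebra.lift ℂ (wordRep (g := g)) u f := fun _ _ => rfl
  -- The functional F satisfies the defining relations of the Verma module, so the left ideal
  -- annihilates F. If the generator were zero, then 1 would annihilate F.
  have hle : vermaIdeal gr Λ ≤
      LinearMap.ker (LinearMap.toSpanSingleton (UniversalEnvelopingAlgebra ℂ g) (wordDual g) F) := by
    refine Submodule.span_le.2 ?_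
    rintro _ (⟨k, hk, x, hx, rfl⟩ | ⟨h, rfl⟩)
    · change ιU x • F = 0
      rw [hsm, UniversalEnvelopingAlgebra.lift_ι_apply, hb hk.le hx, hp hk.ne' hx, zero_smul]
    · change (_ - _ : UniversalEnvelopingAlgebra ℂ g) • F = 0
      rw [sub_smul, hsm, hsm, UniversalEnvelopingAlgebra.lift_ι_apply, hb le_rfl h.2, AlgHom.commutes,
        hp0]
      exact sub_self _
  intro h
  have h1 := hle ((Submodule.Quotient.mk_eq_zero _).1 h)
  apply hF
  simpa using h1

/-- The degrees of the Verma module are independent, if `θ` is an endomorphism of the Lie algebra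
which multiplies the elements of degree `k` by `2 ^ k`. -/
theorem Verma.iSupIndep_degree (θ : g →ₗ⁅ℂ⁆ g)
    (hθ : ∀ {k : ℤ} {x : g}, x ∈ gr k → θ x = (2 : ℂ) ^ k • x) : iSupIndep (degree gr Λ) := by
  let T : UniversalEnvelopingAlgebra ℂ g →ₐ[ℂ] UniversalEnvelopingAlgebra ℂ g :=
    UniversalEnvelopingAlgebra.lift ℂ ((UniversalEnvelopingAlgebra.ι ℂ).comp θ)
  have hT : ∀ {k : ℤ} {x : g}, x ∈ gr k → T (ιU x) = (2 : ℂ) ^ k • ιU x := fun {k x} hx => by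
    rw [UniversalEnvelopingAlgebra.lift_ι_apply, LieHom.comp_apply, hθ hx, map_smul]
  have hI : (vermaIdeal gr Λ).restrictScalars ℂ ≤
      ((vermaIdeal gr Λ).restrictScalars ℂ).comap T.toLinearMap := by
    intro a ha
    change T a ∈ vermaIdeal gr Λ
    induction ha using Submodule.span_induction with
    | mem a h =>
      rcases h with ⟨k, hk, x, hx, rfl⟩ | ⟨h, rfl⟩
      · rw [hT hx]
        exact ((vermaIdeal gr Λ).restrictScalars ℂ).smul_mem _
          (Submodule.subset_span (Or.inl ⟨k, hk, x, hx, rfl⟩))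
      · rw [map_sub, hT h.2, zpow_zero, one_smul, AlgHom.commutes]
        exact Submodule.subset_span (Or.inr ⟨h, rfl⟩)
    | zero => simp
    | add a b _ _ ha hb => rw [map_add]; exact add_mem ha hb
    | smul c a _ ha => rw [smul_eq_mul, map_mul]; exact (vermaIdeal gr Λ).smul_mem _ ha
  let E := Submodule.Quotient.restrictScalarsEquiv ℂ (vermaIdeal gr Λ)
  let S : Module.End ℂ (Verma gr Λ) :=
    E.toLinearMap ∘ₗ (Submodule.mapQ _ _ T.toLinearMap hI) ∘ₗ E.symm.toLinearMap
  have hS : ∀ u, S (Submodule.Quotient.mk u) = Submodule.Quotient.mk (T u) := fun u => rfl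
  -- The endomorphism θ extends to U(g) and descends to the Verma module, where a word of total
  -- degree j is an eigenvector for 2^j. These eigenvalues are distinct since 2 is not a root of
  -- unity.
  have hle : degree gr Λ ≤ fun j => S.eigenspace ((2 : ℂ) ^ j) := by
    intro j
    refine Submodule.span_le.2 ?_
    rintro _ ⟨l, hl, rfl, rfl⟩
    rw [SetLike.mem_coe, Module.End.mem_eigenspace_iff, hS, ← Submodule.Quotient.mk_smul]
    congr 1
    induction l with
    | nil => simp
    | cons p l ih =>
      simp only [List.map_cons, List.prod_cons, List.sum_cons]
      rw [map_mul, hT (hl p List.mem_cons_self), ih fun q hq => hl q (List.mem_cons_of_mem _ hq),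
        smul_mul_smul_comm, zpow_add₀ two_ne_zero]
  refine iSupIndep.mono ((Module.End.eigenspaces_iSupIndep S).comp ?_) hle
  intro a b h
  have h1 : ((2 : ℝ) ^ a) = 2 ^ b := by
    have := congrArg norm h
    simpa using this
  exact zpow_right_injective₀ (by norm_num) (by norm_num) h1

namespace IrrHW

variable (gr Λ) in
/-- The highest weight vector. -/
def hwv : IrrHW gr Λ := (Verma.maxSubmodule gr Λ).mkQ (Verma.hwv gr Λ)

variable (gr Λ) in
/-- The projection from the Verma module. -/
def proj : Verma gr Λ →ₗ[UniversalEnvelopingAlgebra ℂ g] IrrHW gr Λ :=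
  (Verma.maxSubmodule gr Λ).mkQ

theorem proj_surjective : Function.Surjective (proj gr Λ) := Submodule.mkQ_surjective _

theorem proj_eq_zero {w : Verma gr Λ} : proj gr Λ w = 0 ↔ w ∈ Verma.maxSubmodule gr Λ :=
  Submodule.Quotient.mk_eq_zero _

theorem proj_mem_degree {j : ℤ} {w : Verma gr Λ} (hw : w ∈ Verma.degree gr Λ j) :
    proj gr Λ w ∈ degree gr Λ j := ⟨w, hw, rfl⟩

theorem hwv_mem_degree : hwv gr Λ ∈ degree gr Λ 0 := proj_mem_degree Verma.hwv_mem_degree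

theorem ι_smul_hwv_pos {k : ℤ} (hk : 0 < k) {x : g} (hx : x ∈ gr k) : ιU x • hwv gr Λ = 0 := by
  change ιU x • proj gr Λ _ = 0
  rw [← map_smul, Verma.ι_smul_hwv_pos hk hx, map_zero]

theorem ι_smul_hwv_zero (h : gr 0) : ιU (h : g) • hwv gr Λ = Λ h • hwv gr Λ := by
  change ιU (h : g) • proj gr Λ _ = Λ h • (proj gr Λ).restrictScalars ℂ _
  rw [← map_smul, Verma.ι_smul_hwv_zero, ← map_smul]
  rfl

theorem ι_smul_mem_degree {k j : ℤ} {x : g} (hx : x ∈ gr k) {w : IrrHW gr Λ}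
    (hw : w ∈ degree gr Λ j) : ιU x • w ∈ degree gr Λ (j + k) := by
  obtain ⟨w, hw, rfl⟩ := hw
  exact ⟨ιU x • w, Verma.ι_smul_mem_degree hx hw, (proj gr Λ).map_smul _ _⟩

/-- A relation between homogeneous vectors lifts to the Verma module as an element of the maximal
submodule; that submodule is graded, so it contains each component. -/
theorem iSupIndep_degree (hind : iSupIndep (Verma.degree gr Λ)) : iSupIndep (degree gr Λ) := by
  rw [iSupIndep_iff_finsetSum_eq_zero_imp_eq_zero]
  intro s v hv h0
  choose! w hw hwv using hv
  have h1 : ∑ i ∈ s, w i ∈ Verma.maxSubmodule gr Λ := by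
    rw [← proj_eq_zero, map_sum, ← h0]
    exact Finset.sum_congr rfl hwv
  intro i hi
  rw [← hwv i hi]
  exact proj_eq_zero.2 (mem_of_sum_mem_graded hind Verma.isGraded_maxSubmodule hw h1 i hi)

/-- The maximal graded submodule lies in the sum of the nonzero degrees, which meets degree zero
trivially. -/
theorem hwv_ne_zero (hg : IsLieGrading gr) (hind : iSupIndep (Verma.degree gr Λ))
    (hv : Verma.hwv gr Λ ≠ 0) : hwv gr Λ ≠ 0 := by
  intro h
  have h1 := Verma.maxSubmodule_le hg (proj_eq_zero.1 h)
  exact hv (Submodule.disjoint_def.1 (hind 0) _ Verma.hwv_mem_degree h1)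

/-- The module `L(g, Λ)` has no nontrivial graded submodules. -/
theorem eq_bot_or_eq_top (hg : IsLieGrading gr) (hind : iSupIndep (Verma.degree gr Λ))
    {P : Submodule ℂ (IrrHW gr Λ)} (hP : ∀ x : g, ∀ w ∈ P, ιU x • w ∈ P)
    (hgr : P ≤ ⨆ j, P ⊓ degree gr Λ j) : P = ⊥ ∨ P = ⊤ := by
  let N : Submodule (UniversalEnvelopingAlgebra ℂ g) (Verma gr Λ) :=
    { P.comap ((proj gr Λ).restrictScalars ℂ) with
      smul_mem' := fun u w hw => by
        change proj gr Λ (u • w) ∈ P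
        rw [map_smul]
        exact smul_mem_of_ι_smul_mem hP u hw }
  have hN : Verma.IsGraded N := comap_graded (Verma.iSup_degree hg) (iSupIndep_degree hind)
    ((proj gr Λ).restrictScalars ℂ) (fun j w hw => proj_mem_degree hw) hgr
  by_cases h : N = ⊤
  · right
    rw [eq_top_iff]
    rintro w -
    obtain ⟨w, rfl⟩ := proj_surjective w
    have : w ∈ N := h ▸ Submodule.mem_top
    exact this
  · left
    rw [eq_bot_iff]
    intro w hw
    obtain ⟨w, rfl⟩ := proj_surjective w
    exact proj_eq_zero.2 (le_sSup (show N ∈ {N | N ≠ ⊤ ∧ Verma.IsGraded N} from ⟨h, hN⟩) hw)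

end IrrHW

end Irreducible

/-! ### The matrix algebra -/

namespace BandMatrix

variable {R : Type*} [CommRing R] [Algebra ℂ R]

theorem diag_mul_diag (k l : ℤ) (a b : ℤ → R) :
    diag k a * diag l b = diag (k + l) fun j => a (j - l) * b j := by
  ext i j
  rw [entry_mul, finsum_eq_single _ (j - l)]
  · simp only [entry_diag, if_true]
    by_cases h : i = j - l - k
    · rw [if_pos h, if_pos (by omega)]
    · rw [if_neg h, if_neg (by omega), zero_mul]
  · intro n hn
    simp [entry_diag, hn]

theorem diag_sub (k : ℤ) (a b : ℤ → R) : diag k a - diag k b = diag k (a - b) := by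
  ext i j
  simp only [entry_sub, entry_diag, Pi.sub_apply]
  split_ifs <;> simp

theorem lie_diag_diag (k l : ℤ) (a b : ℤ → R) :
    ⁅diag k a, diag l b⁆ = diag (k + l) fun j => a (j - l) * b j - b (j - k) * a j := by
  rw [lie_eq, diag_mul_diag, diag_mul_diag, add_comm l k, diag_sub]
  rfl

theorem cocycle_diag_zero (a : ℤ → R) (B : BandMatrix R) :
    cocycle.toFun (diag 0 a) B = 0 := by
  change trace _ = 0
  have : ⁅(J : BandMatrix R), diag 0 a⁆ = 0 := by
    ext i j
    rw [entry_lie_J, entry_diag]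
    by_cases h : i = j
    · subst h; simp
    · rw [if_neg (by omega : ¬ i = j - 0)]; simp
  rw [this, zero_mul]
  simp [trace]

/-- On the first superdiagonal, the commutator with J survives only at the entry (0, 1), where J
jumps, so the trace has a single term. -/
theorem cocycle_diag_one (a b : ℤ → R) :
    cocycle.toFun (diag 1 a) (diag (-1) b) = a 1 * b 0 := by
  change trace _ = _
  have e : ∀ i, (⁅(J : BandMatrix R), diag 1 a⁆ * diag (-1) b).entry i i =
      ((if i ≤ 0 then 1 else 0) - (if i + 1 ≤ 0 then 1 else 0)) * a (i + 1) * b i := fun i => by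
    rw [entry_mul, finsum_eq_single _ (i + 1)]
    · rw [entry_lie_J, entry_diag, entry_diag, if_pos (by omega : i = i + 1 - 1),
        if_pos (by omega : i + 1 = i - -1)]
    · intro n hn
      rw [entry_diag (-1), if_neg (by omega), mul_zero]
  rw [trace, finsum_eq_single _ 0]
  · rw [e]; simp
  · intro i hi
    rw [e]
    by_cases h : i ≤ 0
    · rw [if_pos h, if_pos (by omega)]; simp
    · rw [if_neg h, if_neg (by omega)]; simp

variable (R) in
/-- The automorphism `E_{ij} ↦ 2^(j-i) E_{ij}`. -/
def scale : BandMatrix R →ₗ[ℂ] BandMatrix R where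
  toFun A := ofEntries (fun i j => (2 : ℂ) ^ (j - i) • A.entry i j) (by
    obtain ⟨N, hN⟩ := A.exists_band
    exact ⟨N, fun i j h => by rw [hN i j h, smul_zero]⟩)
  map_add' A B := by ext i j; simp
  map_smul' c A := by ext i j; simp [smul_comm c]

theorem entry_scale (A : BandMatrix R) (i j : ℤ) :
    (scale R A).entry i j = (2 : ℂ) ^ (j - i) • A.entry i j := rfl

theorem scale_mul (A B : BandMatrix R) : scale R (A * B) = scale R A * scale R B := by
  obtain ⟨N, hN⟩ := A.exists_band
  have hN' : ∀ i j, N < |i - j| → (scale R A).entry i j = 0 := fun i j h => by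
    rw [entry_scale, hN i j h, smul_zero]
  ext i j
  rw [entry_scale, entry_mul, entry_mul, finsum_row hN i _ _ subset_rfl,
    finsum_row hN' i _ _ subset_rfl, Finset.smul_sum]
  refine Finset.sum_congr rfl fun k _ => ?_
  rw [entry_scale, entry_scale, smul_mul_smul_comm, ← zpow_add₀ two_ne_zero]
  congr 2; ring

theorem cocycle_scale (A B : BandMatrix R) :
    cocycle.toFun (scale R A) (scale R B) = cocycle.toFun A B := by
  change trace _ = trace _
  have h : ⁅(J : BandMatrix R), scale R A⁆ = scale R ⁅(J : BandMatrix R), A⁆ := by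
    ext i j
    rw [entry_lie_J, entry_scale, entry_scale, entry_lie_J, mul_smul_comm]
  rw [h, ← scale_mul]
  refine finsum_congr fun i => ?_
  rw [entry_scale]; simp

variable (R) in
/-- The projection to the strictly upper triangular matrices. -/
def upper : BandMatrix R →ₗ[ℂ] BandMatrix R where
  toFun A := ofEntries (fun i j => if i < j then A.entry i j else 0) (by
    obtain ⟨N, hN⟩ := A.exists_band
    exact ⟨N, fun i j h => by rw [hN i j h, ite_self]⟩)
  map_add' A B := by
    ext i j
    simp only [entry_ofEntries, entry_add]
    split_ifs <;> simp
  map_smul' c A := by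
    ext i j
    simp only [entry_ofEntries, entry_smul, RingHom.id_apply]
    split_ifs <;> simp

theorem entry_sum {α : Type*} (s : Finset α) (A : α → BandMatrix R) (i j : ℤ) :
    (∑ x ∈ s, A x).entry i j = ∑ x ∈ s, (A x).entry i j := by
  classical
  induction s using Finset.induction_on with
  | empty => simp
  | insert x s hx ih => rw [Finset.sum_insert hx, Finset.sum_insert hx, entry_add, ih]

end BandMatrix

/-- For step one the solution is a signed partial sum; for general k this is done separately on each
residue class modulo k, with j / k as the new variable. Bracketing with a diagonal matrix h
multiplies the k-th diagonal by h(j - k) - h(j), so every multiplier can be obtained in this way. -/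
theorem exists_sub_eq {V : Type*} [AddCommGroup V] {k : ℤ} (hk : k ≠ 0) (b : ℤ → V) :
    ∃ h : ℤ → V, ∀ j, h (j - k) - h j = b j := by
  have key : ∀ β : ℤ → V, ∃ H : ℤ → V, ∀ n, H (n - 1) - H n = β n := fun β => by
    refine ⟨fun n => - DiffOp.signedSum n fun l => β (-l), fun n => ?_⟩
    have := DiffOp.signedSum_succ (n - 1) fun l => β (-l)
    rw [show n - 1 + 1 = n by ring, show -(-(n - 1) - 1) = n by ring] at this
    beta_reduce
    rw [this]; abel
  choose H hH using key
  refine ⟨fun j => H (fun n => b (k * n + j % k)) (j / k), fun j => ?_⟩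
  have h1 : (j - k) / k = j / k - 1 := by
    rw [Int.sub_ediv_of_dvd _ dvd_rfl, Int.ediv_self hk]
  have h2 : (j - k) % k = j % k := by simp
  beta_reduce
  rw [h1, h2, hH, Int.mul_ediv_add_emod]

/-! ### The gradation of the extended matrix algebra and its Verma modules -/

section GlHat

variable (m : ℕ)

theorem CentralExt.base_sum {g V : Type*} [LieRing g] [LieAlgebra ℂ g] [AddCommGroup V]
    [Module ℂ V] (ω : LieTwoCocycle g V) {α : Type*} (s : Finset α) (x : α → CentralExt ω) :
    (∑ a ∈ s, x a).base = ∑ a ∈ s, (x a).base := by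
  classical
  induction s using Finset.induction_on with
  | empty => simp
  | insert a s ha ih => rw [Finset.sum_insert ha, Finset.sum_insert ha, CentralExt.base_add, ih]

theorem CentralExt.central_sum {g V : Type*} [LieRing g] [LieAlgebra ℂ g] [AddCommGroup V]
    [Module ℂ V] (ω : LieTwoCocycle g V) {α : Type*} (s : Finset α) (x : α → CentralExt ω) :
    (∑ a ∈ s, x a).central = ∑ a ∈ s, (x a).central := by
  classical
  induction s using Finset.induction_on with
  | empty => simp
  | insert a s ha ih => rw [Finset.sum_insert ha, Finset.sum_insert ha, CentralExt.central_add, ih]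

/-- The element `∑ⱼ a j E_{j-k,j}`. -/
def glDiag (k : ℤ) : (ℤ → Rm m) →ₗ[ℂ] GlHat m where
  toFun a := ⟨BandMatrix.diag k a, 0⟩
  map_add' a b := by
    refine CentralExt.ext ?_ (by simp)
    ext i j
    simp only [CentralExt.base_add, BandMatrix.entry_add, BandMatrix.entry_diag, Pi.add_apply]
    split_ifs <;> simp
  map_smul' c a := by
    refine CentralExt.ext ?_ (by simp)
    ext i j
    simp only [CentralExt.base_smul, BandMatrix.entry_smul, BandMatrix.entry_diag, Pi.smul_apply,
      RingHom.id_apply]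
    split_ifs <;> simp

variable {m}

theorem glDiag_mem (k : ℤ) (a : ℤ → Rm m) : glDiag m k a ∈ glGrading m k := by
  refine ⟨fun i j h => ?_, fun _ => rfl⟩
  change (BandMatrix.diag k a).entry i j = 0
  rw [BandMatrix.entry_diag, if_neg (by omega)]

theorem base_eq_diag {k : ℤ} {x : GlHat m} (hx : x ∈ glGrading m k) :
    x.base = BandMatrix.diag k fun j => x.base.entry (j - k) j := by
  ext i j
  rw [BandMatrix.entry_diag]
  by_cases h : i = j - k
  · rw [if_pos h, h]
  · rw [if_neg h, hx.1 i j (by omega)]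

theorem exists_eq_glDiag {k : ℤ} (hk : k ≠ 0) {x : GlHat m} (hx : x ∈ glGrading m k) :
    ∃ a, x = glDiag m k a :=
  ⟨_, CentralExt.ext (base_eq_diag hx) (hx.2 hk)⟩

theorem cocycle_eq_zero {k l : ℤ} (h : k + l ≠ 0) (a b : ℤ → Rm m) :
    BandMatrix.cocycle.toFun (BandMatrix.diag k a) (BandMatrix.diag l b) = 0 := by
  change BandMatrix.trace _ = 0
  refine finsum_eq_zero_of_forall_eq_zero fun i => ?_
  rw [BandMatrix.entry_mul]
  refine finsum_eq_zero_of_forall_eq_zero fun n => ?_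
  rw [BandMatrix.entry_lie_J, BandMatrix.entry_diag, BandMatrix.entry_diag]
  by_cases h1 : i = n - k
  · rw [if_neg (by omega : ¬ n = i - l), mul_zero]
  · rw [if_neg h1, mul_zero, zero_mul]

variable (m) in
theorem isLieGrading_gl : IsLieGrading (glGrading m) where
  lie_mem := fun {k l x y} hx hy => by
    have h1 := base_eq_diag hx
    have h2 := base_eq_diag hy
    refine ⟨fun i j h => ?_, fun h => ?_⟩
    · rw [CentralExt.base_lie, h1, h2, BandMatrix.lie_diag_diag, BandMatrix.entry_diag,
        if_neg (by omega)]
    · rw [CentralExt.central_lie, h1, h2, cocycle_eq_zero h]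
  iSup_eq_top := by
    rw [eq_top_iff]
    rintro x -
    obtain ⟨N, hN⟩ := x.base.exists_band
    have hx : x = ∑ k ∈ Finset.Icc (-N) N, glDiag m k (fun j => x.base.entry (j - k) j) +
        ⟨0, x.central⟩ := by
      refine CentralExt.ext ?_ ?_
      · ext i j
        rw [CentralExt.base_add, CentralExt.base_sum, BandMatrix.entry_add, BandMatrix.entry_sum]
        change _ = ∑ k ∈ _, (BandMatrix.diag k _).entry i j + 0
        simp only [BandMatrix.entry_diag, add_zero]
        by_cases h : N < |i - j|
        · rw [hN i j h, Finset.sum_eq_zero]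
          intro k hk
          rw [Finset.mem_Icc, ← abs_le] at hk
          rw [if_neg]
          rintro rfl
          rw [sub_sub_cancel_left, abs_neg] at h
          omega
        · rw [Finset.sum_eq_single (j - i)]
          · rw [if_pos (by omega)]; simp
          · intro k _ hk
            rw [if_neg (by omega)]
          · intro hc
            exfalso; apply hc
            rw [Finset.mem_Icc, ← abs_le, abs_sub_comm]; omega
      · rw [CentralExt.central_add, CentralExt.central_sum]
        exact (zero_add _).symm.trans
          (congrArg (· + x.central) (Finset.sum_eq_zero fun _ _ => rfl).symm)
    rw [hx]
    refine add_mem (Submodule.sum_mem _ fun k _ => Submodule.mem_iSup_of_mem k (glDiag_mem k _)) ?_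
    exact Submodule.mem_iSup_of_mem 0 ⟨fun _ _ _ => rfl, fun h => absurd rfl h⟩

variable (m) in
/-- The automorphism which multiplies the elements of degree `k` by `2 ^ k`. -/
def glScale : GlHat m →ₗ⁅ℂ⁆ GlHat m where
  toFun x := ⟨BandMatrix.scale _ x.base, x.central⟩
  map_add' x y := CentralExt.ext (by simp) rfl
  map_smul' c x := CentralExt.ext (by simp) rfl
  map_lie' {x y} := by
    refine CentralExt.ext ?_ ?_
    · simp only [CentralExt.base_lie, BandMatrix.lie_eq, map_sub, BandMatrix.scale_mul]
    · simp only [CentralExt.central_lie, BandMatrix.cocycle_scale]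

theorem glScale_apply {k : ℤ} {x : GlHat m} (hx : x ∈ glGrading m k) :
    glScale m x = (2 : ℂ) ^ k • x := by
  refine CentralExt.ext ?_ ?_
  · ext i j
    change (2 : ℂ) ^ (j - i) • x.base.entry i j = (2 : ℂ) ^ k • x.base.entry i j
    by_cases h : j - i = k
    · rw [h]
    · rw [hx.1 i j h, smul_zero, smul_zero]
  · change x.central = (2 : ℂ) ^ k • x.central
    by_cases h : k = 0
    · rw [h, zpow_zero, one_smul]
    · rw [hx.2 h, smul_zero]

variable (m) in
/-- The projection to the part of positive degree. -/
def glUpper : GlHat m →ₗ[ℂ] GlHat m where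
  toFun x := ⟨BandMatrix.upper _ x.base, 0⟩
  map_add' x y := CentralExt.ext (by simp) (by simp)
  map_smul' c x := CentralExt.ext (by simp) (by simp)

variable (m) in
/-- The projection to the part of degree zero. -/
def glZero : GlHat m →ₗ[ℂ] glGrading m 0 where
  toFun x := ⟨⟨BandMatrix.diag 0 fun j => x.base.entry j j, x.central⟩, fun i j h => by
    rw [BandMatrix.entry_diag, if_neg (by omega)], fun h => absurd rfl h⟩
  map_add' x y := by
    refine Subtype.ext (CentralExt.ext ?_ rfl)
    ext i j
    simp only [Submodule.coe_add, CentralExt.base_add, BandMatrix.entry_add, BandMatrix.entry_diag]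
    split_ifs <;> simp
  map_smul' c x := by
    refine Subtype.ext (CentralExt.ext ?_ rfl)
    ext i j
    simp only [Submodule.coe_smul, CentralExt.base_smul, BandMatrix.entry_smul,
      BandMatrix.entry_diag, RingHom.id_apply]
    split_ifs <;> simp

variable (Λ : Module.Dual ℂ (glGrading m 0))

/-- Diagonal matrices commute and the cocycle vanishes on them, so the degree zero part is abelian
even after the central extension; hence every Λ is a character of it. -/
theorem verma_hwv_ne_zero_gl : Verma.hwv (glGrading m) Λ ≠ 0 := by
  refine Verma.hwv_ne_zero (isLieGrading_gl m) (p := Λ ∘ₗ glZero m) (q := glUpper m)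
    (fun h => ?_) (fun {k x} hk hx => ?_) (fun {x y} hx hy => ?_) (fun {k x} hk hx => ?_)
    fun {k x} hk hx => ?_
  · rw [LinearMap.comp_apply]
    congr 1
    refine Subtype.ext (CentralExt.ext ?_ rfl)
    have := base_eq_diag h.2
    simp only [sub_zero] at this
    exact this.symm
  · rw [LinearMap.comp_apply, show glZero m x = 0 from ?_, map_zero]
    refine Subtype.ext (CentralExt.ext ?_ (hx.2 hk))
    ext i j
    change (BandMatrix.diag 0 _).entry i j = 0
    rw [BandMatrix.entry_diag, hx.1 j j (by omega), ite_self]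
  · rw [show ⁅x, y⁆ = 0 from ?_, map_zero]
    have h1 := base_eq_diag hx
    have h2 := base_eq_diag hy
    refine CentralExt.ext ?_ ?_
    · rw [CentralExt.base_lie, h1, h2, BandMatrix.lie_diag_diag]
      ext i j
      simp [BandMatrix.entry_diag, mul_comm]
    · rw [CentralExt.central_lie, h1, BandMatrix.cocycle_diag_zero]; rfl
  · refine CentralExt.ext ?_ (hx.2 hk.ne').symm
    ext i j
    change (if i < j then x.base.entry i j else 0) = _
    split_ifs with h
    · rfl
    · rw [hx.1 i j (by omega)]
  · refine CentralExt.ext ?_ rfl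
    ext i j
    change (if i < j then x.base.entry i j else 0) = 0
    split_ifs with h
    · rw [hx.1 i j (by omega)]
    · rfl

theorem verma_iSupIndep_gl : iSupIndep (Verma.degree (glGrading m) Λ) :=
  Verma.iSupIndep_degree (glScale m) glScale_apply

theorem irrHW_hwv_ne_zero_gl : IrrHW.hwv (glGrading m) Λ ≠ 0 :=
  IrrHW.hwv_ne_zero (isLieGrading_gl m) (verma_iSupIndep_gl Λ) (verma_hwv_ne_zero_gl Λ)

end GlHat

/-! ### Consequences of quasifiniteness for the action and for the weight -/

section Quasifinite

local notation "ιU" => UniversalEnvelopingAlgebra.ι ℂ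

variable {m : ℕ} 

theorem lie_glDiag_zero (k : ℤ) (h a : ℤ → Rm m) :
    ⁅glDiag m 0 h, glDiag m k a⁆ = glDiag m k fun j => (h (j - k) - h j) * a j := by
  refine CentralExt.ext ?_ (BandMatrix.cocycle_diag_zero _ _)
  rw [CentralExt.base_lie]
  change ⁅BandMatrix.diag 0 h, BandMatrix.diag k a⁆ = BandMatrix.diag k _
  rw [BandMatrix.lie_diag_diag, zero_add]
  congr 1
  funext j
  rw [sub_zero]; ring

variable (m) in
/-- The isomorphism of the space of sequences with the subspace of degree zero, which sends
`(c_j)` to `(∑ⱼ (c_j - c_{j-1}) E_{jj}, c_0)`. -/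
def glCoroot : (ℤ → Rm m) →ₗ[ℂ] glGrading m 0 where
  toFun c := ⟨⟨BandMatrix.diag 0 fun j => c j - c (j - 1), c 0⟩, fun i j h => by
    rw [BandMatrix.entry_diag, if_neg (by omega)], fun h => absurd rfl h⟩
  map_add' a b := by
    refine Subtype.ext (CentralExt.ext ?_ rfl)
    ext i j
    simp only [Submodule.coe_add, CentralExt.base_add, BandMatrix.entry_add, BandMatrix.entry_diag,
      Pi.add_apply]
    split_ifs
    · ring
    · simp
  map_smul' c a := by
    refine Subtype.ext (CentralExt.ext ?_ rfl)
    ext i j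
    simp only [Submodule.coe_smul, CentralExt.base_smul, BandMatrix.entry_smul,
      BandMatrix.entry_diag, RingHom.id_apply, Pi.smul_apply]
    split_ifs
    · rw [smul_sub]
    · simp

/-- In these coordinates the bracket of degrees 1 and -1 is a termwise product: the commutator is
the difference of consecutive terms, and the cocycle value a(1) b(0) is the zeroth term, which is
why the central component of `glCoroot` is c 0. Taking a = 1 makes every degree zero element a
bracket. -/
theorem glCoroot_mul (a b : ℤ → Rm m) :
    (glCoroot m (fun j => a (j + 1) * b j) : GlHat m) = ⁅glDiag m 1 a, glDiag m (-1) b⁆ := by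
  refine CentralExt.ext ?_ (BandMatrix.cocycle_diag_one a b).symm
  rw [CentralExt.base_lie]
  change BandMatrix.diag 0 _ = ⁅BandMatrix.diag 1 a, BandMatrix.diag (-1) b⁆
  rw [BandMatrix.lie_diag_diag]
  congr 1
  funext j
  beta_reduce
  rw [sub_neg_eq_add, sub_add_cancel]; ring

/-- The diagonal entries are summed to a sequence h, and the constant of summation is fixed by the
central component. -/
theorem exists_eq_glCoroot (x : glGrading m 0) : ∃ c, x = glCoroot m c := by
  obtain ⟨h, hh⟩ := exists_sub_eq (one_ne_zero (α := ℤ)) fun j => - x.1.base.entry j j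
  refine ⟨fun j => h j + (x.1.central - h 0), Subtype.ext (CentralExt.ext ?_ ?_)⟩
  · have h1 := base_eq_diag x.2
    rw [h1]
    change _ = BandMatrix.diag 0 _
    congr 1
    funext j
    have := hh j
    simp only [sub_zero]
    linear_combination this
  · change _ = h 0 + (x.1.central - h 0)
    ring

/-- The Kronecker delta in the label is the zeroth coordinate of the unit sequence at j. -/
theorem hLabel_eq (Λ : Module.Dual ℂ (glGrading m 0)) (j : ℤ) (i : ℕ) :
    hLabel Λ j i = Λ (glCoroot m (Pi.single j (uvar m ^ i))) := by
  have h : glCoroot m (Pi.single j (uvar m ^ i)) + diagElt m i (j + 1) = diagElt m i j +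
      if j = 0 then centralElt m i else 0 := by
    refine Subtype.ext (CentralExt.ext ?_ ?_)
    · ext a b
      have e : (if j = 0 then centralElt m i else 0 : glGrading m 0).1.base = 0 := by
        split_ifs <;> rfl
      rw [Submodule.coe_add, Submodule.coe_add, CentralExt.base_add, CentralExt.base_add, e,
        add_zero]
      change (BandMatrix.diag (R := Rm m) 0 _).entry a b +
        (BandMatrix.diag (R := Rm m) 0 _).entry a b = (BandMatrix.diag (R := Rm m) 0 _).entry a b
      simp only [BandMatrix.entry_diag, sub_zero]
      split_ifs
      · simp only [Pi.single_apply, sub_eq_iff_eq_add, sub_add_cancel]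
      · simp
    · change (Pi.single j (uvar m ^ i) : ℤ → Rm m) 0 + 0 = _
      by_cases h : j = 0
      · subst h
        rw [if_pos rfl, Pi.single_eq_same]
        change _ = 0 + uvar m ^ i
        rw [zero_add, add_zero]
      · rw [if_neg h, Pi.single_eq_of_ne (Ne.symm h)]
        rfl
  have h' := congrArg Λ h
  rw [map_add, map_add] at h'
  have h0 : Λ (if j = 0 then centralElt m i else 0) = if j = 0 then Λ (centralElt m i) else 0 := by
    split_ifs <;> simp
  rw [h0] at h'
  rw [hLabel]
  linear_combination -h'

variable {Λ : Module.Dual ℂ (glGrading m 0)}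

/-- Polynomial sequences p(j) on the k-th diagonal give a linear map from ℂ[X] to a
finite-dimensional Hom space, so it has a nonzero element p in its kernel. Brackets with degree zero
elements, which preserve the component of degree d, extend the vanishing to all multiples of p; S is
the set of integer roots of p. -/
theorem exists_finset_glDiag_smul (hΛ : IrrHW.IsQuasifinite (glGrading m) Λ) {k : ℤ} (hk : k ≠ 0)
    (d : ℤ) : ∃ S : Finset ℤ, ∀ a : ℤ → Rm m, (∀ j ∈ S, a j = 0) →
      ∀ w ∈ IrrHW.degree (glGrading m) Λ d, ιU (glDiag m k a) • w = 0 := by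
  let T : ℂ[X] →ₗ[ℂ] IrrHW.degree (glGrading m) Λ d →ₗ[ℂ]
      IrrHW.degree (glGrading m) Λ (d + k) := LinearMap.mk₂ ℂ
    (fun p w => ⟨ιU (glDiag m k fun j => algebraMap ℂ (Rm m) (p.eval (j : ℂ))) • w.1,
      IrrHW.ι_smul_mem_degree (glDiag_mem k _) w.2⟩)
    (fun p q w => Subtype.ext (by
      simp only [Submodule.coe_add, ← add_smul, ← map_add]
      congr 3; funext j; simp))
    (fun c p w => Subtype.ext (by
      simp only [Submodule.coe_smul]
      rw [← smul_assoc, ← map_smul, ← map_smul]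
      congr 3; funext j
      rw [eval_smul, smul_eq_mul, map_mul, Pi.smul_apply, ← Algebra.smul_def]))
    (fun p w w' => Subtype.ext (by simp))
    (fun c p w => Subtype.ext (by simp only [Submodule.coe_smul]; rw [smul_comm]))
  have := hΛ d
  have := hΛ (d + k)
  have hT : ¬ Function.Injective T := fun h =>
    Polynomial.not_finite (R := ℂ) (Module.Finite.of_injective T h)
  obtain ⟨p, hp, hp0⟩ : ∃ p, T p = 0 ∧ p ≠ 0 := by
    rw [injective_iff_map_eq_zero] at hT
    push Not at hT
    exact hT
  have hp' : ∀ w ∈ IrrHW.degree (glGrading m) Λ d,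
      ιU (glDiag m k fun j => algebraMap ℂ (Rm m) (p.eval (j : ℂ))) • w = 0 := fun w hw =>
    congrArg Subtype.val (LinearMap.congr_fun hp ⟨w, hw⟩)
  have hfin : {j : ℤ | p.eval (j : ℂ) = 0}.Finite :=
    Set.Finite.preimage (Int.cast_injective.injOn) (Polynomial.finite_setOfPred_isRoot hp0)
  refine ⟨hfin.toFinset, fun a ha w hw => ?_⟩
  -- The multiplier needed is a(j) / p(j). At the roots of p the inverse has the default value 0,
  -- which is harmless because a vanishes there.
  obtain ⟨h, hh⟩ := exists_sub_eq hk fun j => algebraMap ℂ (Rm m) (p.eval (j : ℂ))⁻¹ * a j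
  have e : glDiag m k a =
      ⁅glDiag m 0 h, glDiag m k fun j => algebraMap ℂ (Rm m) (p.eval (j : ℂ))⁆ := by
    rw [lie_glDiag_zero]
    congr 1
    funext j
    rw [hh]
    by_cases hj : p.eval (j : ℂ) = 0
    · rw [ha j (by simpa using hj)]; simp
    · rw [mul_right_comm, ← map_mul, inv_mul_cancel₀ hj, map_one, one_mul]
  have hw' : ιU (glDiag m 0 h) • w ∈ IrrHW.degree (glGrading m) Λ d := by
    simpa using IrrHW.ι_smul_mem_degree (glDiag_mem 0 h) hw
  rw [e, ι_lie_smul, hp' w hw, hp' _ hw', smul_zero, sub_zero]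

/-- On the highest weight vector v the element `glCoroot m c` is the bracket of a degree 1 element,
which kills v, and the degree -1 element with entries c, which kills v once c vanishes on S. -/
theorem exists_finset_coroot (hΛ : IrrHW.IsQuasifinite (glGrading m) Λ) :
    ∃ S : Finset ℤ, ∀ c : ℤ → Rm m, (∀ j ∈ S, c j = 0) → Λ (glCoroot m c) = 0 := by
  obtain ⟨S, hS⟩ := exists_finset_glDiag_smul hΛ (k := -1) (by norm_num) 0
  refine ⟨S, fun c hc => ?_⟩
  have h1 := IrrHW.ι_smul_hwv_zero (Λ := Λ) (glCoroot m c)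
  have h2 := glCoroot_mul (fun _ => 1) c
  simp only [one_mul] at h2
  rw [h2, ι_lie_smul, hS c hc _ IrrHW.hwv_mem_degree,
    IrrHW.ι_smul_hwv_pos one_pos (glDiag_mem 1 _), smul_zero, smul_zero, sub_zero] at h1
  exact (smul_eq_zero.1 h1.symm).resolve_right (irrHW_hwv_ne_zero_gl Λ)

/-- Degree zero contains arbitrary sequences, so a general functional is not determined by its
values on unit sequences. Here Λ kills the difference of c and its truncation to S, so it is. -/
theorem exists_coroot_eq_sum (hΛ : IrrHW.IsQuasifinite (glGrading m) Λ) :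
    ∃ S : Finset ℤ, (∀ c : ℤ → Rm m, Λ (glCoroot m c) =
      ∑ j ∈ S, Λ (glCoroot m (Pi.single j (c j)))) ∧ ∀ j ∉ S, ∀ i, hLabel Λ j i = 0 := by
  obtain ⟨S, hS⟩ := exists_finset_coroot hΛ
  refine ⟨S, fun c => ?_, fun j hj i => ?_⟩
  · rw [← map_sum, ← map_sum, ← sub_eq_zero, ← map_sub, ← map_sub]
    apply hS
    intro j hj
    rw [Pi.sub_apply, Finset.sum_apply, Finset.sum_eq_single j]
    · simp
    · intro i _ hi
      rw [Pi.single_eq_of_ne hi.symm]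
    · exact fun h => absurd hj h
  · rw [hLabel_eq]
    apply hS
    intro l hl
    rw [Pi.single_eq_of_ne]
    rintro rfl
    exact hj hl

end Quasifinite

/-! ### Truncated polynomials and interpolation of jets -/

section Rm

variable {m : ℕ}

theorem uvar_pow_succ : uvar m ^ (m + 1) = 0 := uvar_pow_eq_zero (Nat.lt_succ_self m)

theorem isUnit_algebraMap_add_uvar {c : ℂ} (hc : c ≠ 0) :
    IsUnit (algebraMap ℂ (Rm m) c + uvar m) := by
  have h1 : IsUnit (algebraMap ℂ (Rm m) c) := (isUnit_iff_ne_zero.2 hc).map _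
  exact IsNilpotent.isUnit_add_left_of_commute ⟨m + 1, uvar_pow_succ⟩ h1 (Commute.all _ _)

variable (m) in
/-- Evaluation at `u = 0`. -/
def Rm.evalZero : Rm m →ₐ[ℂ] ℂ :=
  Ideal.Quotient.liftₐ _ (aeval (0 : ℂ)) fun a ha => by
    obtain ⟨b, rfl⟩ := Ideal.mem_span_singleton.1 ha
    simp

theorem Rm.evalZero_uvar : Rm.evalZero m (uvar m) = 0 := by
  change aeval (0 : ℂ) (X : ℂ[X]) = 0
  simp

/-- At c + n the polynomial (X - c)^(m+1) takes the value n^(m+1) = 0. -/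
theorem aeval_eq_of_sub_mem {c : ℂ} {n : Rm m} (hn : n ^ (m + 1) = 0) {p q : ℂ[X]}
    (h : p - q ∈ Ideal.span {(X - C c) ^ (m + 1)}) :
    aeval (algebraMap ℂ (Rm m) c + n) p = aeval (algebraMap ℂ (Rm m) c + n) q := by
  obtain ⟨b, hb⟩ := Ideal.mem_span_singleton.1 h
  rw [← sub_eq_zero, ← map_sub, hb]
  simp [hn]

/-- There are polynomials with prescribed jets of order `m` at finitely many points. -/
theorem exists_poly_jets {ι : Type*} [Finite ι] {c : ι → ℂ} (hc : Function.Injective c)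
    (b : ι → ℂ[X]) : ∃ p : ℂ[X], ∀ i, ∀ n : Rm m, n ^ (m + 1) = 0 →
      aeval (algebraMap ℂ (Rm m) (c i) + n) p = aeval n (b i) := by
  -- The Chinese remainder theorem is applied to the powers (X - c_i)^(m+1), pairwise coprime
  -- because the points are distinct.
  have hI : Pairwise (Function.onFun IsCoprime
      fun i => Ideal.span {((X : ℂ[X]) - C (c i)) ^ (m + 1)}) := fun i j hij => by
    rw [Function.onFun, Ideal.isCoprime_span_singleton_iff]
    exact (Polynomial.pairwise_coprime_X_sub_C hc hij).pow
  obtain ⟨p, hp⟩ := Ideal.exists_forall_sub_mem_ideal hI fun i => (b i).comp (X - C (c i))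
  refine ⟨p, fun i n hn => ?_⟩
  rw [aeval_eq_of_sub_mem hn (hp i), aeval_comp]
  simp

end Rm

/-! ### The gradation of the extended differential operators and the image of the homomorphism -/

section DxHat

variable {ε : ℤˣ}

theorem coeff_term_eq {k : ℤ} {x : DxHat ε} (hx : x ∈ dxGrading ε k) :
    (x.base : DiffOp) = DiffOp.term k ((x.base : DiffOp).coeff k) := by
  ext1 l
  rw [DiffOp.coeff_term]
  split_ifs with h
  · rw [h]
  · exact hx.1 l (Ne.symm h)

/-- The anti-involution preserves each power of t, so both defining conditions can be tested on
components. -/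
theorem term_coeff_mem_Dx {d : DiffOp} (hd : d ∈ DiffOp.Dx ε) (k : ℤ) :
    DiffOp.term k (d.coeff k) ∈ DiffOp.Dx ε := by
  refine ⟨fun l => ?_, ?_⟩
  · rw [DiffOp.coeff_term]
    split_ifs
    · exact hd.1 k
    · exact dvd_zero _
  · have h := congrArg (DiffOp.coeff k) hd.2
    ext1 l
    rw [DiffOp.coeff_sigma, map_neg, DiffOp.coeff_term]
    split_ifs with hl
    · subst hl
      rw [DiffOp.coeff_sigma, map_neg] at h
      exact h
    · simp

/-- The homogeneous components of an element. -/
def dxComponent (x : DxHat ε) (k : ℤ) : DxHat ε :=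
  ⟨⟨DiffOp.term k ((x.base : DiffOp).coeff k), term_coeff_mem_Dx x.base.2 k⟩, 0⟩

theorem dxComponent_mem (x : DxHat ε) (k : ℤ) : dxComponent x k ∈ dxGrading ε k := by
  refine ⟨fun l h => ?_, fun _ => rfl⟩
  change (DiffOp.term k _).coeff l = 0
  rw [DiffOp.coeff_term, if_neg h.symm]

variable (ε) in
theorem isLieGrading_dx : IsLieGrading (dxGrading ε) where
  lie_mem := fun {k l x y} hx hy => by
    have h1 := coeff_term_eq hx
    have h2 := coeff_term_eq hy
    refine ⟨fun i h => ?_, fun h => ?_⟩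
    · rw [CentralExt.base_lie, LieSubalgebra.coe_bracket, h1, h2, DiffOp.lie_eq,
        DiffOp.term_mul_term, DiffOp.term_mul_term, map_sub, DiffOp.coeff_term, DiffOp.coeff_term,
        if_neg h.symm, if_neg (by omega), sub_zero]
    · change DiffOp.psiForm (x.base : DiffOp) (y.base : DiffOp) = 0
      rw [h1, h2, DiffOp.psiForm_term, if_neg h]
  iSup_eq_top := by
    rw [eq_top_iff]
    rintro x -
    have hx : x = ∑ k ∈ Finsupp.support (x.base : DiffOp), dxComponent x k + ⟨0, x.central⟩ := by
      refine CentralExt.ext (Subtype.ext ?_) ?_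
      · rw [CentralExt.base_add, CentralExt.base_sum]
        refine Eq.trans ?_ (congrArg Subtype.val (add_zero _).symm)
        have := (Finsupp.sum_single (x.base : DiffOp)).symm
        refine this.trans ?_
        have h : ∀ s : Finset ℤ, ((∑ k ∈ s, (dxComponent x k).base : DiffOp.Dx ε) : DiffOp) =
          ∑ k ∈ s, ((dxComponent x k).base : DiffOp) := fun s =>
            map_sum (DiffOp.Dx ε).toSubmodule.subtype _ _
        exact (h _).symm
      · rw [CentralExt.central_add, CentralExt.central_sum]
        exact (zero_add _).symm.trans
          (congrArg (· + x.central) (Finset.sum_eq_zero fun _ _ => rfl).symm)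
    rw [hx]
    refine add_mem (Submodule.sum_mem _ fun k _ =>
      Submodule.mem_iSup_of_mem k (dxComponent_mem x k)) ?_
    exact Submodule.mem_iSup_of_mem 0 ⟨fun _ _ => rfl, fun h => absurd rfl h⟩

theorem phiHat_mem (m : ℕ) (s : ℂ) {k : ℤ} {x : DxHat ε} (hx : x ∈ dxGrading ε k) :
    phiHat ε m s x ∈ glGrading m k := by
  refine ⟨fun i j h => ?_, fun h => ?_⟩
  · change aeval _ ((x.base : DiffOp).coeff (j - i)) = 0
    rw [hx.1 _ h, map_zero]
  · change corr m s ((x.base : DiffOp).coeff 0) + algebraMap ℂ (Rm m) x.central = 0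
    rw [hx.1 0 h.symm, hx.2 h, map_zero, map_zero, add_zero]

/-- At u = 0 the entries on the k-th diagonal are the values of the k-th coefficient polynomial at s
- j for all integers j, so a kernel element has zero coefficients. The correction term then vanishes
too, and the centre is embedded by ℂ → R_m. -/
theorem phiHat_injective (ε : ℤˣ) (m : ℕ) (s : ℂ) : Function.Injective (phiHat ε m s) := by
  rw [injective_iff_map_eq_zero]
  intro x hx
  have h1 : ∀ k, (x.base : DiffOp).coeff k = 0 := fun k => by
    refine Polynomial.eq_zero_of_infinite_isRoot _ ((Set.infinite_range_of_injective
      (f := fun j : ℤ => s - j) fun a b h => by simpa using h).mono ?_)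
    rintro _ ⟨j, rfl⟩
    have h2 := congrArg (fun y : GlHat m => Rm.evalZero m (y.base.entry (j - k) j)) hx
    change Rm.evalZero m (aeval (-(j : Rm m) + (algebraMap ℂ (Rm m) s + uvar m))
      ((x.base : DiffOp).coeff (j - (j - k)))) = Rm.evalZero m 0 at h2
    rw [← aeval_algHom_apply, sub_sub_cancel, map_zero] at h2
    simp only [map_add, map_neg, map_intCast, AlgHom.commutes, Rm.evalZero_uvar] at h2
    rw [coe_aeval_eq_eval] at h2
    rw [Set.mem_ofPred_eq, IsRoot, ← h2]
    congr 1
    simp; ring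
  have h3 := congrArg (fun y : GlHat m => Rm.evalZero m y.central) hx
  change Rm.evalZero m (corr m s ((x.base : DiffOp).coeff 0) +
    algebraMap ℂ (Rm m) x.central) = Rm.evalZero m 0 at h3
  rw [h1, map_zero, zero_add, AlgHom.commutes, map_zero] at h3
  exact CentralExt.ext (Subtype.ext (DiffOp.ext h1)) h3

/-- In degree `k ≠ 0`, finitely many entries of the image of `phiHat` can be prescribed. -/
theorem exists_phiHat_eq_glDiag {m : ℕ} {s : ℂ} (hs : ∀ n : ℤ, s ≠ (n : ℂ) / 2) {k : ℤ}
    (hk : k ≠ 0) (S : Finset ℤ) (a : ℤ → Rm m) :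
    ∃ y ∈ dxGrading ε k, ∃ a', phiHat ε m s y = glDiag m k a' ∧ ∀ j ∈ S, a' j = a j := by
  have hs2 : ∀ n : ℤ, 2 * s ≠ n := fun n h => hs n (by rw [← h]; ring)
  have hz : ∀ j : ℤ, s - j ≠ 0 := fun j h => hs2 (2 * j) (by
    push_cast; linear_combination 2 * h)
  -- Only multiples of D are available, so the target entries must be divided by the value s - j + u
  -- of D; it is a unit because s is not an integer.
  have hb : ∀ j : ℤ, ∃ p : ℂ[X], Ideal.Quotient.mk _ p * (algebraMap ℂ (Rm m) (s - j) + uvar m) =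
      a j := fun j => by
    obtain ⟨v, hv⟩ := (isUnit_algebraMap_add_uvar (m := m) (hz j)).exists_left_inv
    obtain ⟨p, hp⟩ := Ideal.Quotient.mk_surjective (a j * v)
    exact ⟨p, by rw [hp, mul_assoc, hv, mul_one]⟩
  choose b hb using hb
  -- The nodes s - j together with their images under X ↦ -X - k. A coincidence between the two
  -- kinds would make 2s an integer.
  let c : S ⊕ S → ℂ := Sum.elim (fun j => s - (j : ℤ)) fun j => -s + (j : ℤ) - k
  have hc : Function.Injective c := by
    rintro (i | i) (j | j) h
    · have : (i : ℤ) = j := by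
        have h' : s - ((i : ℤ) : ℂ) = s - ((j : ℤ) : ℂ) := h
        simpa using h'
      rw [Subtype.ext this]
    · exfalso
      have h' : s - ((i : ℤ) : ℂ) = -s + ((j : ℤ) : ℂ) - k := h
      exact hs2 (i + j - k) (by push_cast; linear_combination h')
    · exfalso
      have h' : -s + ((i : ℤ) : ℂ) - k = s - ((j : ℤ) : ℂ) := h
      exact hs2 (i + j - k) (by push_cast; linear_combination -h')
    · have : (i : ℤ) = j := by
        have h' : -s + ((i : ℤ) : ℂ) - k = -s + ((j : ℤ) : ℂ) - k := h
        simpa using h'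
      rw [Subtype.ext this]
  obtain ⟨h, hh⟩ := exists_poly_jets (m := m) hc (Sum.elim (fun j => b j) fun _ => 0)
  set e : ℂ := (((ε ^ k : ℤˣ) : ℤ) : ℂ) with he
  have hee : e * e = 1 := by
    rw [he, ← Int.cast_mul, ← Units.val_mul, ← mul_zpow, Int.units_mul_self]
    simp
  -- Symmetrization puts p(D) D on the k-th power of t into D_x^±. The jets of h at the reflected
  -- nodes are zero, so the added term does not change the prescribed values.
  set p : ℂ[X] := h + C e * h.comp (-X - C (k : ℂ)) with hp
  have hpe : p.comp (-X - C (k : ℂ)) = C e * p := by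
    rw [hp, add_comp, mul_comp, C_comp, comp_assoc, mul_add, ← mul_assoc, ← C_mul, hee, C_1, one_mul]
    have : (-X - C (k : ℂ) : ℂ[X]).comp (-X - C (k : ℂ)) = X := by
      simp
    rw [this, comp_X, add_comm]
  have hmem : DiffOp.term k (p * X) ∈ DiffOp.Dx ε := by
    refine ⟨fun l => ?_, ?_⟩
    · rw [DiffOp.coeff_term]
      split_ifs
      · exact dvd_mul_left _ _
      · exact dvd_zero _
    · rw [DiffOp.sigma_term, hpe, ← he, ← map_smul, ← map_neg]
      congr 1
      rw [smul_eq_C_mul, ← mul_assoc, ← mul_assoc, ← C_mul, neg_mul, hee]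
      simp
  have hy : (⟨⟨DiffOp.term k (p * X), hmem⟩, 0⟩ : DxHat ε) ∈ dxGrading ε k := by
    refine ⟨fun l hl => ?_, fun _ => rfl⟩
    change (DiffOp.term k _).coeff l = 0
    rw [DiffOp.coeff_term, if_neg hl.symm]
  refine ⟨_, hy, fun j => aeval (-(j : Rm m) + (algebraMap ℂ (Rm m) s + uvar m)) (p * X),
    CentralExt.ext ?_ ((phiHat_mem m s hy).2 hk), fun j hj => ?_⟩
  · exact DiffOp.toMatrix_term _ k (p * X)
  · have e1 : -(j : Rm m) + (algebraMap ℂ (Rm m) s + uvar m) =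
        algebraMap ℂ (Rm m) (s - j) + uvar m := by
      rw [map_sub, map_intCast]; ring
    have h1 : aeval (algebraMap ℂ (Rm m) (s - j) + uvar m) h = Ideal.Quotient.mk _ (b j) := by
      have := hh (Sum.inl ⟨j, hj⟩) (uvar m) uvar_pow_succ
      change _ = aeval (uvar m) (b j) at this
      refine this.trans ?_
      have h2 := aeval_algHom_apply (Ideal.Quotient.mkₐ ℂ (Ideal.span {(X : ℂ[X]) ^ (m + 1)}))
        X (b j)
      rw [aeval_X_left_apply] at h2
      exact h2
    -- Reflection sends s - j + u to the reflected node perturbed by -u, so the jet condition is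
    -- used with the nilpotent -u.
    have h2 : aeval (algebraMap ℂ (Rm m) (s - j) + uvar m) (h.comp (-X - C (k : ℂ))) = 0 := by
      have := hh (Sum.inr ⟨j, hj⟩) (-uvar m) (by
        have h := neg_pow (uvar m) (m + 1)
        rw [uvar_pow_succ, mul_zero] at h
        exact h)
      change aeval (algebraMap ℂ (Rm m) (-s + (j : ℂ) - k) + -uvar m) h = aeval _ 0 at this
      rw [map_zero] at this
      rw [aeval_comp, ← this]
      congr 2
      simp only [map_sub, map_neg, map_add, aeval_X, aeval_C]
      ring
    beta_reduce
    rw [e1, map_mul, aeval_X, hp, map_add, map_mul, h1, h2, mul_zero, add_zero, hb]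

end DxHat

/-! ### Irreducibility of the restriction -/

section Restriction

local notation "ιU" => UniversalEnvelopingAlgebra.ι ℂ

variable {ε : ℤˣ} {m : ℕ} {s : ℂ} {Λ : Module.Dual ℂ (glGrading m 0)}

/-- A graded subspace of `L(g, Λ)` which is stable under the image of `phiHat` is a submodule. -/
theorem ι_smul_mem_of_phiHat (hs : ∀ n : ℤ, s ≠ (n : ℂ) / 2)
    (hΛ : IrrHW.IsQuasifinite (glGrading m) Λ) {P : Submodule ℂ (IrrHW (glGrading m) Λ)}
    (hP : ∀ y : DxHat ε, ∀ w ∈ P, ιU (phiHat ε m s y) • w ∈ P)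
    (hgr : P ≤ ⨆ j, P ⊓ IrrHW.degree (glGrading m) Λ j) (x : GlHat m)
    {w : IrrHW (glGrading m) Λ} (hw : w ∈ P) : ιU x • w ∈ P := by
  have key : ∀ k, k ≠ 0 → ∀ a d, ∀ w ∈ P ⊓ IrrHW.degree (glGrading m) Λ d,
      ιU (glDiag m k a) • w ∈ P ⊓ IrrHW.degree (glGrading m) Λ (d + k) := by
    rintro k hk a d w ⟨hw, hwd⟩
    refine ⟨?_, IrrHW.ι_smul_mem_degree (glDiag_mem k a) hwd⟩
    obtain ⟨S, hS⟩ := exists_finset_glDiag_smul hΛ hk d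
    -- On degree d only the entries in S matter, and y has the same entries there; so the matrix
    -- acts on w exactly as the image of y does.
    obtain ⟨y, -, a', hy, ha'⟩ := exists_phiHat_eq_glDiag (ε := ε) hs hk S a
    have h1 := hS (a - a') (fun j hj => by rw [Pi.sub_apply, ha' j hj, sub_self]) w hwd
    rw [map_sub, map_sub, sub_smul, sub_eq_zero, ← hy] at h1
    rw [h1]
    exact hP y w hw
  refine Submodule.iSup_induction _ (motive := fun w => ιU x • w ∈ P) (hgr hw) (fun d w hw => ?_)
    (by simp) fun a b ha hb => by rw [smul_add]; exact add_mem ha hb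
  refine (isLieGrading_gl m).ι_smul_mem (fun k x hx => ?_) x
  by_cases hk : k = 0
  · subst hk
    -- Interpolation is available only in nonzero degrees; a degree zero element is written as a
    -- bracket of degrees 1 and -1.
    obtain ⟨c, hc⟩ := exists_eq_glCoroot ⟨x, hx⟩
    have h2 := glCoroot_mul (fun _ => 1) c
    simp only [one_mul] at h2
    rw [← hc] at h2
    change x = _ at h2
    rw [h2, ι_lie_smul]
    exact sub_mem (key 1 one_ne_zero _ _ _ (key (-1) (by norm_num) _ _ _ hw)).1
      (key (-1) (by norm_num) _ _ _ (key 1 one_ne_zero _ _ _ hw)).1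
  · obtain ⟨a, rfl⟩ := exists_eq_glDiag hk hx
    exact (key k hk a d w hw).1

variable (ε s Λ) in
/-- The pullback of a weight along `phiHat`. -/
def pullbackWeight : Module.Dual ℂ (dxGrading ε 0) where
  toFun x := Λ ⟨phiHat ε m s x, phiHat_mem m s x.2⟩
  map_add' x y := by
    rw [← map_add]; congr 1; exact Subtype.ext (map_add (phiHat ε m s) (x : DxHat ε) y)
  map_smul' c x := by
    rw [RingHom.id_apply, ← map_smul]; congr 1
    exact Subtype.ext (map_smul (phiHat ε m s) c (x : DxHat ε))

variable (ε) in
theorem exists_equiv_pullbackWeight (hs : ∀ n : ℤ, s ≠ (n : ℂ) / 2)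
    (hΛ : IrrHW.IsQuasifinite (glGrading m) Λ) :
    IrrHW.IsQuasifinite (dxGrading ε) (pullbackWeight ε s Λ) ∧
      ∃ e : IrrHW (glGrading m) Λ ≃ₗ[ℂ] IrrHW (dxGrading ε) (pullbackWeight ε s Λ),
        ∀ (x : DxHat ε) (v : IrrHW (glGrading m) Λ), e ⁅phiHat ε m s x, v⁆ = ⁅x, e v⁆ := by
  let ρ : DxHat ε →ₗ⁅ℂ⁆ Module.End ℂ (IrrHW (glGrading m) Λ) :=
    (LieModule.toEnd ℂ (GlHat m) (IrrHW (glGrading m) Λ)).comp (phiHat ε m s)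
  let _ : Module (UniversalEnvelopingAlgebra ℂ (DxHat ε)) (IrrHW (glGrading m) Λ) :=
    Module.compHom _ (UniversalEnvelopingAlgebra.lift ℂ ρ).toRingHom
  have hsm : ∀ (x : DxHat ε) (w : IrrHW (glGrading m) Λ), ιU x • w = ιU (phiHat ε m s x) • w :=
    fun x w => by
      change UniversalEnvelopingAlgebra.lift ℂ ρ (ιU x) w = _
      rw [UniversalEnvelopingAlgebra.lift_ι_apply]
      rfl
  have _ : IsScalarTower ℂ (UniversalEnvelopingAlgebra ℂ (DxHat ε)) (IrrHW (glGrading m) Λ) :=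
    ⟨fun c u w => by
      change UniversalEnvelopingAlgebra.lift ℂ ρ (c • u) w =
        c • UniversalEnvelopingAlgebra.lift ℂ ρ u w
      rw [map_smul]; rfl⟩
  have hind := verma_iSupIndep_gl Λ
  obtain ⟨e, he⟩ := IrrHW.exists_equiv (isLieGrading_dx ε) (Λ := pullbackWeight ε s Λ)
    (V := IrrHW.degree (glGrading m) Λ) (IrrHW.iSupIndep_degree hind)
    (fun hx hw => by rw [hsm]; exact IrrHW.ι_smul_mem_degree (phiHat_mem m s hx) hw)
    IrrHW.hwv_mem_degree (irrHW_hwv_ne_zero_gl Λ)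
    (fun hk hx => by rw [hsm]; exact IrrHW.ι_smul_hwv_pos hk (phiHat_mem m s hx))
    (fun h => by
      rw [hsm]
      exact IrrHW.ι_smul_hwv_zero (Λ := Λ) ⟨phiHat ε m s h, phiHat_mem m s h.2⟩)
    (fun P hP => by
      -- A graded submodule over the differential operators is already stable under the matrix
      -- algebra, so irreducibility is inherited.
      have hst : ∀ x : GlHat m, ∀ w ∈ P.restrictScalars ℂ, ιU x • w ∈ P.restrictScalars ℂ :=
        fun x w hw => ι_smul_mem_of_phiHat (ε := ε) hs hΛ (fun y w hw => by
          rw [← hsm]; exact P.smul_mem _ hw) hP x hw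
      refine (IrrHW.eq_bot_or_eq_top (isLieGrading_gl m) hind hst hP).imp (fun h => ?_) fun h => ?_
      · exact (Submodule.restrictScalars_eq_bot_iff _ _ _).1 h
      · exact (Submodule.restrictScalars_eq_top_iff _ _ _).1 h)
  refine ⟨fun j => ?_, e.restrictScalars ℂ, fun x v => ?_⟩
  · have := hΛ j
    exact Submodule.finiteDimensional_of_le (he j)
  · have h1 : ⁅phiHat ε m s x, v⁆ = ιU x • v := (hsm x v).symm
    rw [h1]
    exact e.map_smul _ _

end Restriction

/-! ### The pulled back weight and its exponents -/

section Exponents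

/-- For f = X^n the polynomial K is B_{n+1} / (n + 1), with B the Bernoulli polynomials. -/
theorem exists_taylor_one_sub (f : ℂ[X]) : ∃ K : ℂ[X], taylor 1 K - K = f := by
  suffices h : ∀ n : ℕ, (X : ℂ[X]) ^ n ∈ LinearMap.range (taylor (1 : ℂ) - LinearMap.id) by
    have h2 : LinearMap.range (taylor (1 : ℂ) - LinearMap.id) = ⊤ := by
      rw [eq_top_iff]
      rintro f -
      rw [f.as_sum_range_C_mul_X_pow]
      refine Submodule.sum_mem _ fun n _ => ?_
      rw [← smul_eq_C_mul]
      exact Submodule.smul_mem _ _ (h n)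
    exact (h2 ▸ Submodule.mem_top : f ∈ LinearMap.range (taylor (1 : ℂ) - LinearMap.id))
  intro n
  refine ⟨C ((n + 1 : ℂ)⁻¹) * (Polynomial.bernoulli (n + 1)).map (algebraMap ℚ ℂ), ?_⟩
  have h1 := congrArg (Polynomial.map (algebraMap ℚ ℂ)) (bernoulli_comp_one_add_X (n + 1))
  rw [nsmul_eq_mul, Polynomial.map_comp, Polynomial.map_add, Polynomial.map_add, Polynomial.map_mul,
    Polynomial.map_natCast, Polynomial.map_pow, Polynomial.map_one, map_X, add_tsub_cancel_right] at h1
  rw [LinearMap.sub_apply, LinearMap.id_apply, taylor_apply, mul_comp, C_comp, C_1, add_comm X, h1]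
  have h2 : (C ((n + 1 : ℂ)⁻¹) : ℂ[X]) * ((n + 1 : ℕ) : ℂ[X]) = 1 := by
    rw [← C_eq_natCast, ← C_mul]
    have : ((n : ℂ) + 1) ≠ 0 := Nat.cast_add_one_ne_zero n
    push_cast
    rw [inv_mul_cancel₀ this, C_1]
  linear_combination X ^ n * h2

/-- The power series with Laurent series `corrS i s`. -/
def corrP (i : ℕ) (s : ℂ) : PowerSeries ℂ := (exists_corrS i s).choose

theorem mul_corrP (i : ℕ) (s : ℂ) : (expS (1 / 2) - expS (-(1 / 2))) * corrP i s =
    (if i = 0 then coshS (1 / 2) else 0) - etaS i s := (exists_corrS i s).choose_spec.2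

theorem corr_apply (m : ℕ) (s : ℂ) (f : ℂ[X]) :
    corr m s f = ∑ i ∈ Finset.range (m + 1), umbral (corrP i s) f • uvar m ^ i := by
  have : corr m s = ∑ i ∈ Finset.range (m + 1),
      (LinearMap.toSpanSingleton ℂ (Rm m) (uvar m ^ i)) ∘ₗ umbral (corrP i s) :=
    poly_hom_ext fun n => by
      rw [corr, onPowers_X_pow, LinearMap.sum_apply]
      refine Finset.sum_congr rfl fun i _ => ?_
      rw [LinearMap.comp_apply, umbral_X_pow, LinearMap.toSpanSingleton_apply,
        (exists_corrS i s).choose_spec.1]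
      congr 2
      rw [PowerSeries.coeff_coe]
      simp [corrP]
  rw [this, LinearMap.sum_apply]
  rfl

variable {ε : ℤˣ} {m : ℕ} {s : ℂ} {Λ : Module.Dual ℂ (glGrading m 0)}

/-- If f(X) = K(X + 1) - K(X), the correction of f at s - j is K(0) - K(s - j + u) by `corr_diff`,
which needs f odd. Consecutive corrections therefore differ by f(s - j + u), the j-th diagonal
entry, and the zeroth one is the central term. -/
theorem phiHat_eq_glCoroot (x : dxGrading ε 0) : phiHat ε m s x =
    glCoroot m fun j => corr m (s - j) (((x : DxHat ε).base : DiffOp).coeff 0) +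
      algebraMap ℂ (Rm m) (x : DxHat ε).central := by
  set f := ((x : DxHat ε).base : DiffOp).coeff 0 with hf
  have hodd : f.comp (-X) = -f := DiffOp.coeff_zero_odd (x : DxHat ε).base.2
  obtain ⟨K, hK⟩ := exists_taylor_one_sub f
  refine CentralExt.ext ?_ ?_
  · rw [base_eq_diag (phiHat_mem m s x.2)]
    change _ = BandMatrix.diag 0 _
    congr 1
    funext j
    change aeval (-(j : Rm m) + (algebraMap ℂ (Rm m) s + uvar m))
      (((x : DxHat ε).base : DiffOp).coeff (j - (j - 0))) = _
    beta_reduce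
    rw [sub_zero, sub_self, ← hf, corr_diff m (s - j) K f hK hodd,
      corr_diff m (s - ((j - 1 : ℤ) : ℂ)) K f hK hodd, ← hK, map_sub, taylor_apply, aeval_comp]
    have e1 : -(j : Rm m) + (algebraMap ℂ (Rm m) s + uvar m) =
        algebraMap ℂ (Rm m) (s - j) + uvar m := by
      rw [map_sub, map_intCast]; ring
    have e2 : aeval (algebraMap ℂ (Rm m) (s - j) + uvar m) (X + C 1 : ℂ[X]) =
        algebraMap ℂ (Rm m) (s - ((j - 1 : ℤ) : ℂ)) + uvar m := by
      push_cast
      simp only [map_add, aeval_X, map_one, map_intCast]; ring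
    rw [e1, e2]
    ring
  · change corr m s f + _ = corr m (s - ((0 : ℤ) : ℂ)) f + _
    rw [Int.cast_zero, sub_zero]

/-- The series `Γ` of the pulled back weight. -/
def gammaSeries (s : ℂ) (Λ : Module.Dual ℂ (glGrading m 0)) (S : Finset ℤ) : PowerSeries ℂ :=
  -∑ j ∈ S, ∑ i ∈ Finset.range (m + 1), hLabel Λ j i • corrP i (s - j)

theorem umbral_neg (A : PowerSeries ℂ) : umbral (-A) = -umbral A := by
  rw [← neg_one_smul ℂ, umbral_smul, neg_one_smul]

theorem umbral_sum {α : Type*} (S : Finset α) (A : α → PowerSeries ℂ) :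
    umbral (∑ a ∈ S, A a) = ∑ a ∈ S, umbral (A a) := by
  classical
  induction S using Finset.induction_on with
  | empty => simpa using umbral_smul 0 0
  | insert a S ha ih => rw [Finset.sum_insert ha, Finset.sum_insert ha, umbral_add, ih]

theorem pullbackWeight_apply {S : Finset ℤ} (hS : ∀ c : ℤ → Rm m, Λ (glCoroot m c) =
      ∑ j ∈ S, Λ (glCoroot m (Pi.single j (c j)))) (x : dxGrading ε 0) :
    pullbackWeight ε s Λ x =
      -umbral (gammaSeries s Λ S) (((x : DxHat ε).base : DiffOp).coeff 0) +
        (x : DxHat ε).central * ∑ j ∈ S, hLabel Λ j 0 := by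
  have h1 : pullbackWeight ε s Λ x = Λ (glCoroot m fun j =>
      corr m (s - j) (((x : DxHat ε).base : DiffOp).coeff 0) +
        algebraMap ℂ (Rm m) (x : DxHat ε).central) :=
    congrArg Λ (Subtype.ext (phiHat_eq_glCoroot x))
  have h2 : ∀ (j : ℤ) (r r' : Rm m), (Pi.single j (r + r') : ℤ → Rm m) =
      Pi.single j r + Pi.single j r' := fun j r r' => 
      map_add (LinearMap.single ℂ (fun _ : ℤ => Rm m) j) r r'
  have h3 : ∀ (j : ℤ) (c : ℂ) (i : ℕ),
      Λ (glCoroot m (Pi.single j (c • uvar m ^ i))) = c * hLabel Λ j i := fun j c i => by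
    rw [Pi.single_smul, map_smul, map_smul, hLabel_eq, smul_eq_mul]
  have h4 : ∀ (j : ℤ) (f : ℕ → Rm m), Λ (glCoroot m (Pi.single j
      (∑ i ∈ Finset.range (m + 1), f i))) =
        ∑ i ∈ Finset.range (m + 1), Λ (glCoroot m (Pi.single j (f i))) := fun j f => by
    rw [← map_sum, ← map_sum]
    congr 2
    exact map_sum (LinearMap.single ℂ (fun _ : ℤ => Rm m) j) _ _
  rw [h1, hS, gammaSeries, umbral_neg, LinearMap.neg_apply, neg_neg, umbral_sum,
    LinearMap.sum_apply, Finset.mul_sum, ← Finset.sum_add_distrib]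
  refine Finset.sum_congr rfl fun j _ => ?_
  rw [h2, map_add, map_add, Algebra.algebraMap_eq_smul_one, ← pow_zero (uvar m), h3, corr_apply, h4,
    umbral_sum, LinearMap.sum_apply]
  congr 1
  refine Finset.sum_congr rfl fun i _ => ?_
  rw [h3, umbral_smul, LinearMap.smul_apply, smul_eq_mul, mul_comm]

theorem evalNegHom_expS (a : ℂ) : PowerSeries.evalNegHom (expS a) = expS (-a) := by
  rw [PowerSeries.evalNegHom, expS, PowerSeries.rescale_rescale, expS, mul_neg_one]

theorem evalNegHom_C (a : ℂ) : PowerSeries.evalNegHom (PowerSeries.C a) = PowerSeries.C a := by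
  ext n
  rw [PowerSeries.evalNegHom, PowerSeries.coeff_rescale, PowerSeries.coeff_C]
  split_ifs with h <;> simp [h]

theorem evalNegHom_coshS (a : ℂ) : PowerSeries.evalNegHom (coshS a) = coshS a := by
  rw [coshS, PowerSeries.smul_eq_C_mul, map_mul, evalNegHom_C, map_add, evalNegHom_expS,
    evalNegHom_expS, neg_neg, add_comm]

/-- The sign (-1)^i from x^i undoes the exchange of the two exponentials. -/
theorem evalNegHom_etaS (i : ℕ) (s : ℂ) : PowerSeries.evalNegHom (etaS i s) = etaS i s := by
  rw [etaS, PowerSeries.smul_eq_C_mul, map_mul, evalNegHom_C, map_mul, map_add, map_mul,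
    evalNegHom_expS, evalNegHom_expS, neg_neg, map_pow, map_pow, map_neg, map_one,
    PowerSeries.evalNegHom_X, neg_pow PowerSeries.X]
  have h : ((-1 : PowerSeries ℂ) ^ i) * (-1) ^ i = 1 := by
    rw [← mul_pow]; simp
  linear_combination PowerSeries.C (2 * (i.factorial : ℂ))⁻¹ * PowerSeries.X ^ i *
    expS (s - 1 / 2) * h

theorem two_smul_sinhS : (2 : ℂ) • sinhS (1 / 2) = expS (1 / 2) - expS (-(1 / 2)) := by
  rw [sinhS, smul_smul]; norm_num

theorem constantCoeff_expS (a : ℂ) : PowerSeries.constantCoeff (expS a) = 1 := by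
  rw [← PowerSeries.coeff_zero_eq_constantCoeff_apply, coeff_expS]; simp

theorem two_smul_sinhS_ne_zero : (2 : ℂ) • sinhS (1 / 2) ≠ 0 := by
  intro h
  have := congrArg (PowerSeries.coeff 1) h
  rw [two_smul_sinhS, map_sub, coeff_expS, coeff_expS] at this
  norm_num at this

theorem expS_mul_X_pow_mem (a : ℂ) (i : ℕ) :
    expS a * PowerSeries.X ^ i ∈ quasipolynomials :=
  Submodule.subset_span ⟨X ^ i, a, by rw [Polynomial.coe_pow, Polynomial.coe_X, mul_comm]⟩

theorem etaS_mem (i : ℕ) (s : ℂ) : etaS i s ∈ quasipolynomials := by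
  refine Submodule.smul_mem _ _ ?_
  rw [add_mul, mul_assoc, show ((-1 : PowerSeries ℂ) ^ i) = PowerSeries.C ((-1 : ℂ) ^ i) by simp,
    ← PowerSeries.smul_eq_C_mul]
  exact add_mem (expS_mul_X_pow_mem _ i) (Submodule.smul_mem _ _ (expS_mul_X_pow_mem _ i))

theorem coshS_mem (a : ℂ) : coshS a ∈ quasipolynomials := by
  refine Submodule.smul_mem _ _ ?_
  have h1 := expS_mul_X_pow_mem a 0
  have h2 := expS_mul_X_pow_mem (-a) 0
  rw [pow_zero, mul_one] at h1 h2
  exact add_mem h1 h2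

/-- The parity of i decides whether η_i(x, s - j) is x^i / i! times cosh or times sinh of (s - j -
1/2) x; this splits the labels between even and odd type exponents. -/
theorem evenMult_add_oddMult (j : ℤ) :
    (evenMult Λ j : PowerSeries ℂ) * coshS (s - j - 1 / 2) +
      (oddMult Λ j : PowerSeries ℂ) * sinhS (s - j - 1 / 2) =
    ∑ i ∈ Finset.range (m + 1), hLabel Λ j i • etaS i (s - j) := by
  have h1 : ∀ (T : Finset ℕ), ((∑ i ∈ T, C (hLabel Λ j i / (i.factorial : ℂ)) * X ^ i : ℂ[X]) :
      PowerSeries ℂ) = ∑ i ∈ T, PowerSeries.C (hLabel Λ j i * (i.factorial : ℂ)⁻¹) *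
        PowerSeries.X ^ i := fun T => by
    have := map_sum (Polynomial.coeToPowerSeries.ringHom (R := ℂ))
      (fun i => C (hLabel Λ j i / (i.factorial : ℂ)) * X ^ i) T
    refine this.trans (Finset.sum_congr rfl fun i _ => ?_)
    rw [Polynomial.coeToPowerSeries.ringHom_apply]
    simp [div_eq_mul_inv]
  rw [evenMult, oddMult, h1, h1, Finset.sum_filter, Finset.sum_filter, Finset.sum_mul,
    Finset.sum_mul, ← Finset.sum_add_distrib]
  refine Finset.sum_congr rfl fun i _ => ?_
  rw [etaS, coshS, sinhS]
  simp only [PowerSeries.smul_eq_C_mul, mul_inv, map_mul]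
  rcases Nat.even_or_odd i with h | h
  · rw [if_pos h, if_neg (Nat.not_odd_iff_even.2 h), h.neg_one_pow]; ring
  · rw [if_neg (Nat.not_even_iff_odd.2 h), if_pos h, h.neg_one_pow]; ring

theorem exponent_injective (s : ℂ) : Function.Injective fun j : ℤ => s - (j : ℂ) - 1 / 2 :=
  fun a b h => by simpa using h

theorem atExponents_apply (s : ℂ) (q : ℤ → ℂ[X]) (j : ℤ) :
    atExponents s q (s - j - 1 / 2) = q j := (exponent_injective s).extend_apply q 0 j

theorem exists_of_atExponents_ne_zero {q : ℤ → ℂ[X]} {e : ℂ} (h : atExponents s q e ≠ 0) :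
    ∃ j : ℤ, e = s - j - 1 / 2 ∧ q j ≠ 0 := by
  by_cases hj : ∃ j : ℤ, s - (j : ℂ) - 1 / 2 = e
  · obtain ⟨j, rfl⟩ := hj
    rw [atExponents_apply] at h
    exact ⟨j, rfl, h⟩
  · exact absurd (Function.extend_apply' _ _ _ hj) h

theorem finsum_atExponents {q : ℤ → ℂ[X]} {S : Finset ℤ} (hS : ∀ j ∉ S, q j = 0)
    (F : ℂ → PowerSeries ℂ) : ∑ᶠ e, (atExponents s q e : PowerSeries ℂ) * F e =
      ∑ j ∈ S, (q j : PowerSeries ℂ) * F (s - j - 1 / 2) := by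
  classical
  rw [finsum_eq_sum_of_support_subset (s := S.image fun j : ℤ => s - (j : ℂ) - 1 / 2),
    Finset.sum_image fun a _ b _ h => exponent_injective s h]
  · exact Finset.sum_congr rfl fun j _ => by rw [atExponents_apply]
  · intro e he
    have h1 : atExponents s q e ≠ 0 := fun h => he (by simp [h])
    obtain ⟨j, rfl, hj⟩ := exists_of_atExponents_ne_zero h1
    refine Finset.mem_coe.2 (Finset.mem_image_of_mem _ ?_)
    by_contra hc
    exact hj (hS j hc)

theorem evenMult_eq_zero {S : Finset ℤ} (hS : ∀ j ∉ S, ∀ i, hLabel Λ j i = 0) (j : ℤ) (hj : j ∉ S) :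
    evenMult Λ j = 0 := by simp [evenMult, hS j hj]

theorem oddMult_eq_zero {S : Finset ℤ} (hS : ∀ j ∉ S, ∀ i, hLabel Λ j i = 0) (j : ℤ) (hj : j ∉ S) :
    oddMult Λ j = 0 := by simp [oddMult, hS j hj]

theorem evenMult_comp_neg (j : ℤ) : (evenMult Λ j).comp (-X) = evenMult Λ j := by
  rw [evenMult, Polynomial.sum_comp]
  refine Finset.sum_congr rfl fun i hi => ?_
  rw [mul_comp, C_comp, pow_comp, X_comp, (Finset.mem_filter.1 hi).2.neg_pow]

theorem oddMult_comp_neg (j : ℤ) : (oddMult Λ j).comp (-X) = -oddMult Λ j := by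
  rw [oddMult, Polynomial.sum_comp, ← Finset.sum_neg_distrib]
  refine Finset.sum_congr rfl fun i hi => ?_
  rw [mul_comp, C_comp, pow_comp, X_comp, (Finset.mem_filter.1 hi).2.neg_pow, mul_neg]

theorem isExponentData (hs : ∀ n : ℤ, s ≠ (n : ℂ) / 2) {S : Finset ℤ}
    (hS : ∀ j ∉ S, ∀ i, hLabel Λ j i = 0) :
    IsExponentData (atExponents s (evenMult Λ)) (atExponents s (oddMult Λ)) := by
  have hfin : ∀ q : ℤ → ℂ[X], (∀ j ∉ S, q j = 0) → (Function.support (atExponents s q)).Finite := by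
    intro q hq
    refine (S.finite_toSet.image fun j : ℤ => s - (j : ℂ) - 1 / 2).subset fun e he => ?_
    obtain ⟨j, rfl, hj⟩ := exists_of_atExponents_ne_zero he
    refine ⟨j, ?_, rfl⟩
    by_contra hc
    exact hj (hq j hc)
  have hval : ∀ (q : ℤ → ℂ[X]) (e : ℂ), atExponents s q e = 0 ∨ ∃ j, atExponents s q e = q j :=
    fun q e => or_iff_not_imp_left.2 fun h => by
      obtain ⟨j, rfl, -⟩ := exists_of_atExponents_ne_zero h
      exact ⟨j, atExponents_apply s q j⟩
  have huniq : ∀ (q : ℤ → ℂ[X]) (e : ℂ), atExponents s q e ≠ 0 → atExponents s q (-e) = 0 := by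
    intro q e he
    by_contra hc
    obtain ⟨j, rfl, -⟩ := exists_of_atExponents_ne_zero he
    obtain ⟨l, h, -⟩ := exists_of_atExponents_ne_zero hc
    -- If s - l - 1/2 = -(s - j - 1/2), then 2s = j + l + 1.
    exact hs (j + l + 1) (by push_cast; linear_combination -h / 2)
  refine ⟨hfin _ (evenMult_eq_zero hS), hfin _ (oddMult_eq_zero hS), fun e => ?_, fun e => ?_,
    fun e _ => huniq _ e, fun e => huniq _ e⟩
  · rcases hval (evenMult Λ) e with h | ⟨j, h⟩
    · rw [h, zero_comp]
    · rw [h, evenMult_comp_neg]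
  · rcases hval (oddMult Λ) e with h | ⟨j, h⟩
    · rw [h, zero_comp, neg_zero]
    · rw [h, oddMult_comp_neg]

variable (ε) in
theorem hasExponents_pullbackWeight (hs : ∀ n : ℤ, s ≠ (n : ℂ) / 2) {S : Finset ℤ}
    (hS : ∀ c : ℤ → Rm m, Λ (glCoroot m c) = ∑ j ∈ S, Λ (glCoroot m (Pi.single j (c j))))
    (hS' : ∀ j ∉ S, ∀ i, hLabel Λ j i = 0) :
    HasExponents (pullbackWeight ε s Λ) (atExponents s (evenMult Λ))
      (atExponents s (oddMult Λ)) := by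
  set E : PowerSeries ℂ := ∑ j ∈ S, ∑ i ∈ Finset.range (m + 1), hLabel Λ j i • etaS i (s - j)
    with hE
  set c : ℂ := ∑ j ∈ S, hLabel Λ j 0 with hc
  set φ : PowerSeries ℂ := E - c • coshS (1 / 2) with hφ
  have hC : pullbackWeight ε s Λ (dCentral ε) = c := by
    rw [pullbackWeight_apply hS]
    change -umbral _ 0 + 1 * _ = _
    simp [hc]
  -- Only the corrections with i = 0 contain cosh(x/2), so its total coefficient is the sum of the
  -- labels with i = 0, which is also the value of the weight on C.
  have hΓ : ((2 : ℂ) • sinhS (1 / 2)) * gammaSeries s Λ S = φ := by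
    rw [two_smul_sinhS, gammaSeries, mul_neg, Finset.mul_sum, hφ, hE, hc, Finset.sum_smul,
      ← Finset.sum_sub_distrib, ← Finset.sum_neg_distrib]
    refine Finset.sum_congr rfl fun j _ => ?_
    rw [Finset.mul_sum]
    simp only [mul_smul_comm, mul_corrP, smul_sub, Finset.sum_sub_distrib]
    rw [Finset.sum_eq_single_of_mem 0 (by simp) fun i _ hi => by rw [if_neg hi, smul_zero],
      if_pos rfl]
    abel
  have hE' : PowerSeries.evalNegHom E = E := by
    rw [hE, map_sum]
    refine Finset.sum_congr rfl fun j _ => ?_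
    rw [map_sum]
    refine Finset.sum_congr rfl fun i _ => ?_
    rw [PowerSeries.smul_eq_C_mul, map_mul, evalNegHom_C, evalNegHom_etaS]
  have hφ' : PowerSeries.evalNegHom φ = φ := by
    rw [hφ, map_sub, hE', PowerSeries.smul_eq_C_mul, map_mul, evalNegHom_C, evalNegHom_coshS]
  have hodd : PowerSeries.evalNegHom (gammaSeries s Λ S) = -gammaSeries s Λ S := by
    apply mul_left_cancel₀ two_smul_sinhS_ne_zero
    have h1 := congrArg PowerSeries.evalNegHom hΓ
    rw [hφ', two_smul_sinhS, map_mul, map_sub, evalNegHom_expS, evalNegHom_expS, neg_neg] at h1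
    rw [two_smul_sinhS] at hΓ ⊢
    linear_combination hΓ - h1
  refine ⟨isExponentData hs hS', φ, gammaSeries s Λ S, ?_, hφ', ?_, hΓ, ?_, ?_⟩
  · refine sub_mem ?_ (Submodule.smul_mem _ _ (coshS_mem _))
    exact Submodule.sum_mem _ fun j _ => Submodule.sum_mem _ fun i _ =>
      Submodule.smul_mem _ _ (etaS_mem _ _)
  · rw [← hΓ, map_mul, two_smul_sinhS, map_sub, constantCoeff_expS, constantCoeff_expS, sub_self,
      zero_mul]
  -- For even l the value on D^(l+1) is -(l + 1)! times the coefficient of Γ, and division by l!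
  -- leaves the factor l + 1 of the derivative. For odd l both sides vanish because Γ is odd.
  · ext l
    rw [deltaSeries, PowerSeries.coeff_mk, PowerSeries.coeff_derivative]
    split_ifs with hl
    · obtain ⟨k, rfl⟩ := hl
      have hk : (k + k) / 2 = k := by omega
      rw [hk, pullbackWeight_apply hS]
      have h1 : (((dPower ε k : DxHat ε).base : DiffOp).coeff 0) = X ^ (k + k + 1) := by
        change (DiffOp.term 0 (X ^ (2 * k) * X)).coeff 0 = _
        rw [DiffOp.coeff_term_same, ← pow_succ, two_mul]
      have h2 : (dPower ε k : DxHat ε).central = 0 := rfl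
      rw [h1, h2, umbral_X_pow, zero_mul, add_zero, neg_neg, Nat.factorial_succ]
      have : ((k + k).factorial : ℂ) ≠ 0 := Nat.cast_ne_zero.2 (Nat.factorial_ne_zero _)
      push_cast
      field_simp
    · have h1 := congrArg (PowerSeries.coeff (l + 1)) hodd
      rw [PowerSeries.evalNegHom, PowerSeries.coeff_rescale,
        (Nat.not_even_iff_odd.1 hl).add_one.neg_one_pow, one_mul, map_neg] at h1
      have h2 : PowerSeries.coeff (l + 1) (gammaSeries s Λ S) = 0 := self_eq_neg.1 h1
      rw [h2, zero_mul]
  · rw [hC, hφ, sub_add_cancel, finsum_atExponents (evenMult_eq_zero hS'),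
      finsum_atExponents (oddMult_eq_zero hS'), ← Finset.sum_add_distrib]
    exact Finset.sum_congr rfl fun j _ => (evenMult_add_oddMult j).symm

/-- In degree zero the condition on σ makes f even in f(D) D, so only even powers of D occur besides
C. -/
theorem exists_eq_sum_dPower (x : dxGrading ε 0) : ∃ (n : ℕ) (a : ℕ → ℂ),
    x = ∑ k ∈ Finset.range n, a k • dPower ε k + (x : DxHat ε).central • dCentral ε := by
  have h1 := coeff_term_eq x.2
  obtain ⟨f, hf⟩ := (x : DxHat ε).base.2.1 0
  have hodd := DiffOp.coeff_zero_odd (x : DxHat ε).base.2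
  have heven : f.comp (-X) = f := by
    rw [hf, mul_comp, X_comp, neg_mul, neg_inj] at hodd
    exact mul_left_cancel₀ X_ne_zero hodd
  have hcoeff : ∀ n, Odd n → f.coeff n = 0 := fun n hn => by
    have h2 := congrArg (fun p => Polynomial.coeff p n) heven
    rw [← neg_one_mul (X : ℂ[X]), ← C_1, ← C_neg, comp_C_mul_X_coeff, hn.neg_one_pow, mul_neg_one] at h2
    exact self_eq_neg.1 h2.symm
  have hsum : f = ∑ k ∈ Finset.range (f.natDegree + 1), f.coeff (2 * k) • X ^ (2 * k) := by
    ext n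
    simp only [finsetSum_coeff, Polynomial.coeff_smul, coeff_X_pow, smul_eq_mul, mul_ite, mul_one, mul_zero]
    rcases Nat.even_or_odd' n with ⟨k, rfl | rfl⟩
    · by_cases hk : k < f.natDegree + 1
      · rw [Finset.sum_eq_single k]
        · simp
        · intro b _ hb
          rw [if_neg (by omega)]
        · intro h; simp at h; omega
      · rw [coeff_eq_zero_of_natDegree_lt (by omega), Finset.sum_eq_zero]
        intro b hb
        rw [Finset.mem_range] at hb
        rw [if_neg (by omega)]
    · rw [hcoeff _ (odd_two_mul_add_one k), Finset.sum_eq_zero]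
      intro b _
      rw [if_neg (by omega)]
  refine ⟨f.natDegree + 1, fun k => f.coeff (2 * k), Subtype.ext (CentralExt.ext ?_ ?_)⟩
  · rw [Submodule.coe_add, CentralExt.base_add, Submodule.coe_sum, CentralExt.base_sum]
    refine Subtype.ext ?_
    have e1 : (((x : DxHat ε).central • dCentral ε : dxGrading ε 0) : DxHat ε).base = 0 := by
      rw [Submodule.coe_smul, CentralExt.base_smul]
      exact smul_zero _
    rw [e1, add_zero]
    have e2 : ∀ s : Finset ℕ, ((∑ k ∈ s, ((f.coeff (2 * k) • dPower ε k : dxGrading ε 0) :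
        DxHat ε).base : DiffOp.Dx ε) : DiffOp) =
        ∑ k ∈ s, DiffOp.term 0 ((f.coeff (2 * k) • X ^ (2 * k)) * X) := fun s => by
      refine (map_sum (DiffOp.Dx ε).toSubmodule.subtype _ _).trans (Finset.sum_congr rfl fun k _ => ?_)
      rw [smul_mul_assoc, map_smul]
      rfl
    rw [e2, ← map_sum, ← Finset.sum_mul, ← hsum, h1, hf, mul_comm]
  · rw [Submodule.coe_add, CentralExt.central_add, Submodule.coe_sum, CentralExt.central_sum,
      Finset.sum_eq_zero, zero_add, Submodule.coe_smul, CentralExt.central_smul]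
    · exact (mul_one _).symm
    · intro k _
      rw [Submodule.coe_smul, CentralExt.central_smul]
      exact smul_zero _

/-- Since φ(0) = 0 and cosh(0) = 1, evaluation at x = 0 recovers μ(C), and hence φ. Cancelling 2
sinh(x/2) recovers Γ, whose derivative gives the values on the elements D^l D. -/
theorem HasExponents.unique {μ μ' : Module.Dual ℂ (dxGrading ε 0)} {ep em : ℂ → ℂ[X]}
    (h : HasExponents μ ep em) (h' : HasExponents μ' ep em) : μ = μ' := by
  obtain ⟨-, φ, Γ, -, -, h0, hΓ, hΔ, hφ⟩ := h
  obtain ⟨-, φ', Γ', -, -, h0', hΓ', hΔ', hφ'⟩ := h'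
  have hcosh : PowerSeries.constantCoeff (coshS (1 / 2)) = 1 := by
    rw [coshS, PowerSeries.smul_eq_C_mul, map_mul, map_add, constantCoeff_expS, constantCoeff_expS,
      PowerSeries.constantCoeff_C]
    norm_num
  have h1 := hφ.trans hφ'.symm
  have hC : μ (dCentral ε) = μ' (dCentral ε) := by
    have h2 := congrArg PowerSeries.constantCoeff h1
    simpa only [map_add, h0, h0', PowerSeries.smul_eq_C_mul, map_mul, hcosh, PowerSeries.constantCoeff_C, zero_add,
      mul_one] using h2
  have hφφ : φ = φ' := by
    rw [hC] at h1
    exact add_right_cancel h1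
  have hΓΓ : Γ = Γ' := by
    apply mul_left_cancel₀ two_smul_sinhS_ne_zero
    rw [hΓ, hΓ', hφφ]
  have hP : ∀ k, μ (dPower ε k) = μ' (dPower ε k) := fun k => by
    have h2 : deltaSeries μ = deltaSeries μ' := by rw [hΔ, hΔ', hΓΓ]
    have h3 := congrArg (PowerSeries.coeff (2 * k)) h2
    have : ((2 * k).factorial : ℂ) ≠ 0 := Nat.cast_ne_zero.2 (Nat.factorial_ne_zero _)
    rw [deltaSeries, deltaSeries, PowerSeries.coeff_mk, PowerSeries.coeff_mk,
      if_pos (even_two_mul k), if_pos (even_two_mul k), Nat.mul_div_cancel_left k two_pos,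
      div_left_inj' this, neg_inj] at h3
    exact h3
  ext x
  obtain ⟨n, a, hx⟩ := exists_eq_sum_dPower x
  rw [hx]
  simp only [map_add, map_sum, map_smul, hP, hC]

end Exponents

end DiffOpRep

end

theorem mainTheorem5 (ε : ℤˣ) (m : ℕ) (s : ℂ) (hs : ∀ n : ℤ, s ≠ (n : ℂ) / 2)
    (Λ : Module.Dual ℂ (glGrading m 0)) (hΛ : IrrHW.IsQuasifinite (glGrading m) Λ) :
    Function.Injective (phiHat ε m s) ∧
    (∃! μ : Module.Dual ℂ (dxGrading ε 0),
      HasExponents μ (atExponents s (evenMult Λ)) (atExponents s (oddMult Λ))) ∧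
    ∀ μ : Module.Dual ℂ (dxGrading ε 0),
      HasExponents μ (atExponents s (evenMult Λ)) (atExponents s (oddMult Λ)) →
      IrrHW.IsQuasifinite (dxGrading ε) μ ∧
      ∃ e : IrrHW (glGrading m) Λ ≃ₗ[ℂ] IrrHW (dxGrading ε) μ,
        ∀ (x : DxHat ε) (v : IrrHW (glGrading m) Λ), e ⁅phiHat ε m s x, v⁆ = ⁅x, e v⁆ := by
  obtain ⟨S, hS, hS'⟩ := exists_coroot_eq_sum hΛ
  have h := hasExponents_pullbackWeight ε hs hS hS'
  refine ⟨phiHat_injective ε m s, ⟨_, h, fun μ hμ => hμ.unique h⟩, fun μ hμ => ?_⟩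
  rw [hμ.unique h]
  exact exists_equiv_pullbackWeight ε hs hΛ
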